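/- For real $x$ put $e(x)=e^{2\pi i x}$; let $\Lambda$ be the von Mangoldt function and $\mu$ the Möbius function, and let $n\sim N$ mean $N\le n<2N$. Let $\varepsilon>0$ and $C\ge 10$ be fixed real numbers, and put $\rho_+=\frac25-\varepsilon$ and $\rho_-=\frac37-\varepsilon$. For real $N\ge 1$ and real $z_+\le N^{1/2}$, $z_-\le N^{1/3-\varepsilon}$, define \begin{align*} \mathcal D^{+,\mathrm{SEM}}&=\{p_1\cdots p_r\le N^{\rho_+}:\ z_+\ge p_1>\dots>p_r,\ p_1\cdots p_{2k-2}\,p_{2k-1}^2\le N^{\rho_+}\ \text{for all } k\ge 1 \text{ with } 2k-1\le r\},\\ \mathcal D^{-,\mathrm{SEM}}&=\{p_1\cdots p_r\le N^{\rho_-}:\ z_-\ge p_1>\dots>p_r,\ p_1\cdots p_{2k-1}\,p_{2k}^2\le N^{\rho_-}\ \text{for all } k\ge 1\text{ with } 2k\le r\}, \end{align*} where $r\ge 0$, the $p_i$ are primes, and the empty product ($r=0$) is $1$. Let $\lambda_d^{\pm,\mathrm{SEM}}=\mu(d)$ if $d\in\mathcal D^{\pm,\mathrm{SEM}}$ and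 $\lambda_d^{\pm,\mathrm{SEM}}=0$ otherwise (the upper and lower bound semilinear sieve weights). Then, for either choice of the sign $\pm$, there are constants $K$ and $N_0$ depending only on $\varepsilon$ and $C$ such that the following holds for all real $N\ge N_0$ and all $z_\pm$ as above. If $\alpha$ is a real number with $\left|\alpha-\frac aq\right|\le\frac1{q^2}$ for some coprime integers $a$ and $q$ with $q\in[(\log N)^{1000C},\,N(\log N)^{-1000C}]$, and $b\ne 0$ is any integer, then $$\sum_{\substack{1\le d\le N^{\rho_\pm}\\ (d,b)=1}}\bigg|\lambda_d^{\pm,\mathrm{SEM}}\sum_{\substack{n\sim N\\ n\equiv b\ (\mathrm{mod}\ d)}}\Lambda(n)e(\alpha n)\bigg|\le K\,\frac{N}{(\log N)^C}.$$ -/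

import Mathlib

namespace SemilinearSieve

/-- `e(x) = exp(2πix)`. -/
noncomputable def e (x : ℝ) : ℂ := Complex.exp (2 * Real.pi * Complex.I * (x : ℂ))

/-- `d = p₁ ⋯ p_r` with primes `z ≥ p₁ > ⋯ > p_r` (the values `p i` for `1 ≤ i ≤ r` are the only
ones that matter; `r = 0` gives `d = 1`). -/
def IsDecreasingFactorization (z : ℝ) (d r : ℕ) (p : ℕ → ℕ) : Prop :=
  d = ∏ i ∈ Finset.Icc 1 r, p i ∧
  (∀ i, 1 ≤ i → i ≤ r → (p i).Prime ∧ (p i : ℝ) ≤ z) ∧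
  (∀ i j, 1 ≤ i → i < j → j ≤ r → p j < p i)

/-- The support of the upper bound semilinear weights of level `D` and sifting parameter `z`:
all `d = p₁ ⋯ p_r ≤ D` with `z ≥ p₁ > ⋯ > p_r` and
`p₁ ⋯ p_{2k-2} p_{2k-1}² ≤ D` whenever `k ≥ 1` and `2k - 1 ≤ r`. -/
def upperSupport (D z : ℝ) : Set ℕ :=
  {d | (d : ℝ) ≤ D ∧ ∃ (r : ℕ) (p : ℕ → ℕ), IsDecreasingFactorization z d r p ∧
    ∀ k : ℕ, 1 ≤ k → 2 * k - 1 ≤ r →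
      (∏ i ∈ Finset.Icc 1 (2 * k - 2), (p i : ℝ)) * (p (2 * k - 1) : ℝ) ^ 2 ≤ D}

/-- The support of the lower bound semilinear weights of level `D` and sifting parameter `z`:
all `d = p₁ ⋯ p_r ≤ D` with `z ≥ p₁ > ⋯ > p_r` and
`p₁ ⋯ p_{2k-1} p_{2k}² ≤ D` whenever `k ≥ 1` and `2k ≤ r`. -/
def lowerSupport (D z : ℝ) : Set ℕ :=
  {d | (d : ℝ) ≤ D ∧ ∃ (r : ℕ) (p : ℕ → ℕ), IsDecreasingFactorization z d r p ∧
    ∀ k : ℕ, 1 ≤ k → 2 * k ≤ r →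
      (∏ i ∈ Finset.Icc 1 (2 * k - 1), (p i : ℝ)) * (p (2 * k) : ℝ) ^ 2 ≤ D}

/-- Upper bound semilinear sieve weights: the Möbius function restricted to `upperSupport`. -/
noncomputable def upperWeight (D z : ℝ) : ℕ → ℝ :=
  (upperSupport D z).indicator fun d => (ArithmeticFunction.moebius d : ℝ)

/-- Lower bound semilinear sieve weights: the Möbius function restricted to `lowerSupport`. -/
noncomputable def lowerWeight (D z : ℝ) : ℕ → ℝ :=
  (lowerSupport D z).indicator fun d => (ArithmeticFunction.moebius d : ℝ)

/-- The sum of `Λ(n) e(αn)` over the integers `N ≤ n < 2N` with `n ≡ b (mod d)`. -/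
noncomputable def primeExpSum (N α : ℝ) (b : ℤ) (d : ℕ) : ℂ :=
  ∑ n ∈ (Finset.Ico ⌈N⌉₊ ⌈2 * N⌉₊).filter (fun n : ℕ => (n : ℤ) ≡ b [ZMOD (d : ℤ)]),
    (ArithmeticFunction.vonMangoldt n : ℂ) * e (α * n)

/-- The sum of `|w(d) ∑_{N ≤ n < 2N, n ≡ b (d)} Λ(n) e(αn)|` over the integers `1 ≤ d ≤ D` with
`(d, b) = 1`. -/
noncomputable def weightedSum (w : ℕ → ℝ) (D N α : ℝ) (b : ℤ) : ℝ :=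
  ∑ d ∈ (Finset.Icc 1 ⌊D⌋₊).filter (fun d : ℕ => Int.gcd (d : ℤ) b = 1),
    ‖(w d : ℂ) * primeExpSum N α b d‖

end SemilinearSieve

/-!
Vaughan's identity with `U = N^{1/3}` writes the sum over primes in the progression `b` modulo `d`
as a combination of Type I sums, with a smooth variable and another one at most `N^{1/3}`, and of
Type II sums `∑ f(m) g(n) e(αmn)` with both variables between `N^{1/3}` and `N^{2/3}`. The sign of
`λ_d` plays no role: what is used of the sieve weights is that `|λ_d| ≤ 1` and that their support
consists of integers with flexible factorisations.

*Factorisation.* Every prime factor of an element of the upper support of level `D` is at most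
`D^{1/2}`. For the lower support this holds with `D^{1/3}`, except for one prime which is at most
`z ≤ N^{1/3-ε}`. With `D = N^{2/5-ε}` and `D = N^{3/7-ε}` respectively, a greedy choice of primes
therefore gives, for every size `M` of the longer variable (up to constants,
`N^{1/2} ≤ M ≤ N^{2/3}`), a decomposition `d = d₁ d₂` with `d₁ M` below `N` and `d₁ d₂²` below `M`,
in both cases by a power of `N` (`factorsAt_of_prime_le`). The levels are exactly what makes this possible: in both cases `D²`
times the bound for the primes is `N^{1-cε}`.

*Type II sums.* Cauchy–Schwarz is applied over `(d₁, m)` with `m ∼ M`, leaving `d₂` and `n` inside.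
Opening the square gives pairs `(d₂, d₂')` and `(n, n')` with `n ≡ n' (mod d₁)`, say
`n - n' = ±d₁ k`, while `m` runs through a segment of a progression modulo `d₁ [d₂, d₂']`. The
geometric sum over `m` is at most the minimum of its length and `1/‖α d₁² k [d₂, d₂']‖`. With
`l = k [d₂, d₂']`, which arises from few `(k, d₂, d₂')`, everything is reduced to the estimate
`IsMinor.sum_tau_sq_mul_cappedInv_le` for
`∑ d τ(l)² min(4N/(d²l), 1/‖αd²l‖)`, summed over `d² l ≤ T` with `T` a little below `N`. The
constraints `d₁ M < N` and `d₁ d₂² < M` are what controls the diagonal `n = n'` and the range of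
`d₁² l`.

*The minor arc estimate.* If `d ∼ D` with `D` at most a power of a logarithm, then `d² l` may be
treated as an arbitrary integer and the spacing of the multiples of `α` suffices. Otherwise the
Fejér kernel turns the count of the pairs with `‖αd²l‖` small into the sums
`∑_{d ∼ D} e(αhld²)`, and Weyl differencing in `d` reduces these again to the multiples of `α`. The
divisor functions that appear on the way are removed by Cauchy–Schwarz and cost powers of `log N`,
which the saving `R = (log N)^{30C}` absorbs.

*Type I sums.* The smooth variable runs through a progression modulo `d`, and the product of `d`
and the other variable is at most `N^{3/7+1/3}`; these sums are covered by the terms `d = 1` of the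
same estimate.
-/

namespace SemilinearSieve

open Finset

/-! ### Distance to the nearest integer and exponential sums over progressions -/

/-- The distance `‖x‖` from `x` to the nearest integer. -/
noncomputable def distInt (x : ℝ) : ℝ := |x - round x|

/-- `min(X, 1/‖y‖)` for `X > 0`. Writing it as the inverse of a maximum gives the value `X` when
`‖y‖ = 0`, without a separate case. -/
noncomputable def cappedInv (X y : ℝ) : ℝ := (max (distInt y) X⁻¹)⁻¹

lemma distInt_le_half (x : ℝ) : distInt x ≤ 1 / 2 := abs_sub_round x

lemma distInt_le (x : ℝ) (k : ℤ) : distInt x ≤ |x - k| := round_le x k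

lemma distInt_neg (x : ℝ) : distInt (-x) = distInt x := by
  have key : ∀ y : ℝ, distInt (-y) ≤ distInt y := fun y => by
    refine (distInt_le (-y) (-round y)).trans (le_of_eq ?_)
    rw [distInt, ← abs_neg]
    congr 1
    push_cast
    ring
  refine le_antisymm (key x) ?_
  simpa using key (-x)

lemma cappedInv_neg (X x : ℝ) : cappedInv X (-x) = cappedInv X x := by
  rw [cappedInv, distInt_neg, cappedInv]

lemma cappedInv_pos {X : ℝ} (hX : 0 < X) (y : ℝ) : 0 < cappedInv X y :=
  inv_pos.2 (lt_max_of_lt_right (inv_pos.2 hX))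

lemma cappedInv_le {X : ℝ} (hX : 0 < X) (y : ℝ) : cappedInv X y ≤ X :=
  inv_le_of_inv_le₀ hX (le_max_right _ _)

lemma cappedInv_mono {X Y : ℝ} (hX : 0 < X) (hXY : X ≤ Y) (y : ℝ) :
    cappedInv X y ≤ cappedInv Y y := by
  refine inv_anti₀ (lt_max_of_lt_right (inv_pos.2 (hX.trans_le hXY))) ?_
  exact max_le_max le_rfl (inv_anti₀ hX hXY)

lemma le_cappedInv {X y t : ℝ} (hX : 0 < X) (h1 : t ≤ X) (h2 : t * distInt y ≤ 1) :
    t ≤ cappedInv X y := by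
  rcases le_or_gt t 0 with ht | ht
  · exact ht.trans (cappedInv_pos hX y).le
  refine (le_inv_comm₀ ht (lt_max_of_lt_right (inv_pos.2 hX))).2 (max_le ?_ ?_)
  · rw [← one_div, le_div_iff₀ ht]
    linarith
  · exact inv_anti₀ ht h1

lemma e_add (x y : ℝ) : e (x + y) = e x * e y := by
  rw [e, e, e, ← Complex.exp_add]
  congr 1
  push_cast
  ring

lemma e_eq (x : ℝ) : e x = Complex.exp (Complex.I * ((2 * Real.pi * x : ℝ) : ℂ)) := by
  rw [e]
  congr 1
  push_cast
  ring

lemma norm_e (x : ℝ) : ‖e x‖ = 1 := by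
  rw [e_eq, Complex.norm_exp_I_mul_ofReal]

lemma conj_e (x : ℝ) : (starRingEnd ℂ) (e x) = e (-x) := by
  rw [e_eq, e_eq, ← Complex.exp_conj, map_mul, Complex.conj_I, Complex.conj_ofReal]
  congr 1
  push_cast
  ring

lemma e_intCast (k : ℤ) : e k = 1 := by
  rw [e, Complex.exp_eq_one_iff]
  exact ⟨k, by push_cast; ring⟩

lemma e_natCast_mul (k : ℕ) (x : ℝ) : e (k * x) = e x ^ k := by
  rw [e, e, ← Complex.exp_nat_mul]
  congr 1
  push_cast
  ring

lemma e_sub_round (x : ℝ) : e (x - round x) = e x := by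
  have := e_add (x - round x) (round x)
  rw [e_intCast, mul_one, sub_add_cancel] at this
  exact this.symm

lemma four_mul_distInt_le (x : ℝ) : 4 * distInt x ≤ ‖e x - 1‖ := by
  rw [← e_sub_round x, e_eq, Complex.norm_exp_I_mul_ofReal_sub_one]
  have h := abs_sub_round x
  have h1 : |2 * Real.pi * (x - round x) / 2| ≤ Real.pi / 2 := by
    rw [show 2 * Real.pi * (x - round x) / 2 = Real.pi * (x - round x) by ring, abs_mul,
      abs_of_pos Real.pi_pos]
    nlinarith [Real.pi_pos]
  have h2 := Real.mul_abs_le_abs_sin h1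
  rw [show 2 * Real.pi * (x - round x) / 2 = Real.pi * (x - round x) by ring, abs_mul,
      abs_of_pos Real.pi_pos] at h2
  rw [norm_mul, Real.norm_eq_abs, Real.norm_eq_abs, abs_two,
    show 2 * Real.pi * (x - round x) / 2 = Real.pi * (x - round x) by ring]
  have h3 : 2 / Real.pi * (Real.pi * |x - round x|) = 2 * |x - round x| := by
    field_simp
  rw [h3] at h2
  unfold distInt
  linarith

lemma norm_geom_sum_e_le (β : ℝ) (n : ℕ) {X : ℝ} (hX : 0 < X) (hn : (n : ℝ) ≤ X) :
    ‖∑ k ∈ range n, e (k * β)‖ ≤ cappedInv X β := by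
  refine le_cappedInv hX ?_ ?_
  · refine (norm_sum_le _ _).trans ?_
    simpa [norm_e] using hn
  · have h1 : (∑ k ∈ range n, e (k * β)) * (e β - 1) = e β ^ n - 1 := by
      simp_rw [e_natCast_mul]
      exact geom_sum_mul _ _
    have h2 : ‖∑ k ∈ range n, e (k * β)‖ * ‖e β - 1‖ ≤ 2 := by
      rw [← norm_mul, h1]
      refine (norm_sub_le _ _).trans ?_
      rw [norm_pow, norm_e]
      norm_num
    have h3 := mul_le_mul_of_nonneg_left (four_mul_distInt_le β)
      (norm_nonneg (∑ k ∈ range n, e (k * β)))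
    linarith

/-- A sum of `e(βm)` over a segment `S` of an arithmetic progression of modulus `v`. The segment is
described by its elements being congruent and by convexity, so that the sets
`{m : A ≤ mn < B, mn ≡ b (mod d), …}` can be fed in without computing their end points. -/
lemma norm_sum_e_progression_le (S : Finset ℕ) (v : ℕ) (hv : 1 ≤ v) (K β : ℝ) (hK : 0 ≤ K)
    (hS : ∀ m ∈ S, ∀ m' ∈ S, m ≤ m' → m ≡ m' [MOD v] ∧ ((m' : ℝ) - m ≤ K))
    (hconv : ∀ m ∈ S, ∀ m' ∈ S, ∀ t, m ≤ t → t ≤ m' → t ≡ m [MOD v] → t ∈ S)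
    {X : ℝ} (hX : K / v + 1 ≤ X) :
    ‖∑ m ∈ S, e (β * m)‖ ≤ cappedInv X (β * v) := by
  have hv0 : (0 : ℝ) < v := by exact_mod_cast hv
  have hX0 : 0 < X := lt_of_lt_of_le (by positivity) hX
  rcases S.eq_empty_or_nonempty with rfl | hne
  · simpa using (cappedInv_pos hX0 _).le
  set m₀ := S.min' hne with hm₀
  set m₁ := S.max' hne with hm₁
  have h0 : m₀ ∈ S := S.min'_mem hne
  have h1 : m₁ ∈ S := S.max'_mem hne
  have hle : m₀ ≤ m₁ := S.min'_le _ h1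
  obtain ⟨hmod, hlen⟩ := hS _ h0 _ h1 hle
  set n := (m₁ - m₀) / v + 1 with hn
  have hS' : ∑ m ∈ S, e (β * m) = ∑ k ∈ range n, e (β * (m₀ + v * k : ℕ)) := by
    symm
    refine sum_bij (fun k _ => m₀ + v * k) ?_ ?_ ?_ ?_
    · intro k hk
      refine hconv _ h0 _ h1 _ (Nat.le_add_right _ _) ?_ (by simp [Nat.ModEq])
      have h2 : k ≤ (m₁ - m₀) / v := by
        rw [mem_range] at hk
        lia
      have h3 := Nat.mul_le_mul_left v h2
      have h4 := Nat.mul_div_le (m₁ - m₀) v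
      lia
    · intro k _ k' _ h
      have h5 : v * k = v * k' := by lia
      exact Nat.eq_of_mul_eq_mul_left hv h5
    · intro m hm
      have hm0 : m₀ ≤ m := S.min'_le _ hm
      have hm1 : m ≤ m₁ := S.le_max' _ hm
      have hd : v ∣ m - m₀ := (Nat.modEq_iff_dvd' hm0).1 (hS _ h0 _ hm hm0).1
      refine ⟨(m - m₀) / v, ?_, ?_⟩
      · rw [mem_range, hn, Nat.lt_succ_iff]
        exact Nat.div_le_div_right (by lia)
      · rw [Nat.mul_div_cancel' hd]
        lia
    · intro k _
      rfl
  have h6 : ∀ k : ℕ, e (β * (m₀ + v * k : ℕ)) = e (β * m₀) * e (k * (β * v)) := by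
    intro k
    rw [← e_add]
    congr 1
    push_cast
    ring
  rw [hS']
  simp_rw [h6]
  rw [← mul_sum, norm_mul, norm_e, one_mul]
  refine norm_geom_sum_e_le _ _ hX0 (le_trans ?_ hX)
  rw [hn]
  push_cast
  have h7 : (((m₁ - m₀) / v : ℕ) : ℝ) ≤ ((m₁ - m₀ : ℕ) : ℝ) / v := Nat.cast_div_le
  rw [Nat.cast_sub hle] at h7
  have h8 : ((m₁ : ℝ) - m₀) / v ≤ K / v := by gcongr
  linarith

/-- The autocorrelation expansion behind both the Fejér kernel and Weyl differencing. -/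
lemma norm_sum_range_sq (z : ℕ → ℂ) (n : ℕ) :
    ‖∑ i ∈ range n, z i‖ ^ 2 = ∑ i ∈ range n, ‖z i‖ ^ 2 +
      2 * (∑ t ∈ Ico 1 n, ∑ i ∈ range (n - t), z (i + t) * (starRingEnd ℂ) (z i)).re := by
  have key : ∀ n, ∑ t ∈ Ico 1 n, ∑ i ∈ range (n - t), z (i + t) * (starRingEnd ℂ) (z i)
      = ∑ j ∈ range n, ∑ i ∈ range j, z j * (starRingEnd ℂ) (z i) := by
    intro n
    rw [sum_sigma', sum_sigma']
    refine sum_bij' (fun p _ => ⟨p.2 + p.1, p.2⟩) (fun p _ => ⟨p.1 - p.2, p.2⟩) ?_ ?_ ?_ ?_ ?_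
    · rintro ⟨t, i⟩ h
      simp only [mem_sigma, mem_Ico, mem_range] at h ⊢
      lia
    · rintro ⟨t, i⟩ h
      simp only [mem_sigma, mem_Ico, mem_range] at h ⊢
      lia
    · rintro ⟨t, i⟩ h
      simp
    · rintro ⟨t, i⟩ h
      simp only [mem_sigma, mem_range] at h
      simp only [Sigma.mk.injEq, heq_eq_eq, and_true]
      lia
    · rintro ⟨t, i⟩ h
      rfl
  rw [key]
  induction n with
  | zero => simp
  | succ n ih =>
    rw [sum_range_succ, sum_range_succ, sum_range_succ, Complex.add_re, ← mul_sum, ← map_sum]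
    rw [Complex.sq_norm, Complex.normSq_add, ← Complex.sq_norm, ih, ← Complex.sq_norm]
    have : ((∑ i ∈ range n, z i) * (starRingEnd ℂ) (z n)).re
        = (z n * (starRingEnd ℂ) (∑ i ∈ range n, z i)).re := by
      simp [Complex.mul_re]
      ring
    rw [this]
    ring

/-! ### Moments of the divisor function -/

/-- The number of divisors of `n`, as a real number. -/
noncomputable def tau (n : ℕ) : ℝ := n.divisors.card

lemma tau_nonneg (n : ℕ) : 0 ≤ tau n := Nat.cast_nonneg _

lemma one_le_tau {n : ℕ} (hn : 1 ≤ n) : 1 ≤ tau n := by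
  have : 1 ≤ n.divisors.card := card_pos.2 ⟨1, Nat.one_mem_divisors.2 (by lia)⟩
  unfold tau
  exact_mod_cast this

lemma tau_mul_le (m n : ℕ) : tau (m * n) ≤ tau m * tau n := by
  unfold tau
  rw [Nat.divisors_mul]
  exact_mod_cast card_mul_le

lemma sum_divisorsAntidiagonal_Ico {E : Type*} [AddCommMonoid E] {A : ℕ} (hA : 1 ≤ A) (B : ℕ)
    (F : ℕ → ℕ → E) :
    ∑ n ∈ Ico A B, ∑ p ∈ n.divisorsAntidiagonal, F p.1 p.2 =
      ∑ m ∈ Ico 1 B, ∑ k ∈ Ico 1 B, if A ≤ m * k ∧ m * k < B then F m k else 0 := by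
  rw [← sum_product', ← sum_filter, ← sum_fiberwise_of_maps_to (s := (Ico 1 B ×ˢ Ico 1 B).filter
    fun x => A ≤ x.1 * x.2 ∧ x.1 * x.2 < B) (t := Ico A B) (g := fun x => x.1 * x.2)]
  · refine sum_congr rfl fun n hn => sum_congr ?_ fun _ _ => rfl
    ext ⟨m, k⟩
    rw [mem_Ico] at hn
    simp only [Nat.mem_divisorsAntidiagonal, mem_filter, mem_product, mem_Ico]
    constructor
    · rintro ⟨rfl, h⟩
      have hm : 1 ≤ m := Nat.one_le_iff_ne_zero.2 (left_ne_zero_of_mul h)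
      have hk : 1 ≤ k := Nat.one_le_iff_ne_zero.2 (right_ne_zero_of_mul h)
      refine ⟨⟨⟨⟨hm, ?_⟩, hk, ?_⟩, hn⟩, rfl⟩
      · exact lt_of_le_of_lt (Nat.le_mul_of_pos_right m hk) hn.2
      · exact lt_of_le_of_lt (Nat.le_mul_of_pos_left k hm) hn.2
    · rintro ⟨_, rfl⟩
      exact ⟨rfl, by lia⟩
  · rintro ⟨m, k⟩ h
    exact mem_Ico.2 (mem_filter.1 h).2

lemma sum_one_div_le (n : ℕ) : ∑ k ∈ Icc 1 n, (1 : ℝ) / k ≤ 1 + Real.log n := by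
  have h := harmonic_le_one_add_log n
  rw [harmonic_eq_sum_Icc] at h
  push_cast at h
  simpa using h

/-- By submultiplicativity of `τ`, each moment is at most the square of the previous one. -/
lemma sum_tau_pow_div_le (k n : ℕ) :
    ∑ m ∈ Icc 1 n, tau m ^ k / m ≤ (1 + Real.log n) ^ 2 ^ k := by
  induction k with
  | zero => simpa using sum_one_div_le n
  | succ k ih =>
    have h0 : 0 ≤ ∑ m ∈ Icc 1 n, tau m ^ k / m :=
      sum_nonneg fun m _ => div_nonneg (pow_nonneg (tau_nonneg m) _) (Nat.cast_nonneg _)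
    have hI : Icc 1 n = Ico 1 (n + 1) := by
      ext
      simp
    calc ∑ m ∈ Icc 1 n, tau m ^ (k + 1) / m
        = ∑ m ∈ Ico 1 (n + 1), ∑ p ∈ m.divisorsAntidiagonal,
            tau (p.1 * p.2) ^ k / ((p.1 * p.2 : ℕ) : ℝ) := by
          rw [hI]
          refine sum_congr rfl fun m _ => ?_
          rw [sum_congr rfl (g := fun _ => tau m ^ k / m), sum_const, nsmul_eq_mul, pow_succ,
            ← Nat.map_div_right_divisors, card_map]
          · unfold tau
            ring
          · intro p hp
            rw [(Nat.mem_divisorsAntidiagonal.1 hp).1]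
      _ ≤ ∑ a ∈ Ico 1 (n + 1), ∑ b ∈ Ico 1 (n + 1), tau a ^ k / a * (tau b ^ k / b) := by
          rw [sum_divisorsAntidiagonal_Ico le_rfl (n + 1)
            (fun a b => tau (a * b) ^ k / ((a * b : ℕ) : ℝ))]
          refine sum_le_sum fun a _ => sum_le_sum fun b _ => ?_
          have h1 : tau (a * b) ^ k / ((a * b : ℕ) : ℝ) ≤ tau a ^ k / a * (tau b ^ k / b) := by
            rw [div_mul_div_comm, ← mul_pow]
            push_cast
            gcongr
            · exact tau_nonneg _
            · exact tau_mul_le a b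
          split_ifs
          · exact h1
          · exact le_trans (div_nonneg (pow_nonneg (tau_nonneg _) _) (Nat.cast_nonneg _)) h1
      _ = (∑ m ∈ Icc 1 n, tau m ^ k / m) ^ 2 := by
          rw [sq, sum_mul_sum, hI]
      _ ≤ (1 + Real.log n) ^ 2 ^ (k + 1) := by
          rw [pow_succ 2 k, pow_mul]
          gcongr

/-! ### Multiples of a real number with a rational approximation -/

/-- `α` has an approximation `a/q` in lowest terms with `|α - a/q| ≤ 1/q²`. -/
def HasApprox (α : ℝ) (q : ℕ) : Prop :=
  1 ≤ q ∧ ∃ a : ℤ, IsCoprime a (q : ℤ) ∧ |α - a / q| ≤ 1 / (q : ℝ) ^ 2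

lemma HasApprox.le_distInt {α : ℝ} {q : ℕ} (h : HasApprox α q) {t : ℤ} (ht : t ≠ 0)
    (htq : 2 * |t| ≤ q) : 1 / (2 * q : ℝ) ≤ distInt (α * t) := by
  obtain ⟨hq, a, hcop, hα⟩ := h
  have hq0 : (0 : ℝ) < q := by exact_mod_cast hq
  set k := round (α * t) with hk
  have hne : a * t - k * q ≠ 0 := by
    intro h0
    have hd : (q : ℤ) ∣ a * t := ⟨k, by linarith⟩
    have h1 := Int.le_of_dvd (abs_pos.2 ht) ((dvd_abs _ _).2 (hcop.symm.dvd_of_dvd_mul_left hd))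
    have := abs_pos.2 ht
    lia
  have h1 : (1 : ℝ) ≤ |(a : ℝ) * t - k * q| := by
    exact_mod_cast Int.one_le_abs hne
  have h2 : |(t : ℝ)| * 2 ≤ q := by
    have : (2 * |t| : ℤ) ≤ (q : ℤ) := htq
    have h3 : ((2 * |t| : ℤ) : ℝ) ≤ ((q : ℤ) : ℝ) := by exact_mod_cast this
    push_cast at h3
    linarith
  have h3 : (a : ℝ) * t - k * q = q * ((α * t - k) - (α - a / q) * t) := by
    field_simp
    ring
  rw [h3, abs_mul, abs_of_pos hq0] at h1
  have h4 : |(α * t - k) - (α - a / q) * t| ≤ |α * t - k| + 1 / (q : ℝ) ^ 2 * (q / 2) := by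
    refine (abs_sub _ _).trans ?_
    rw [abs_mul]
    gcongr
    linarith
  have h5 : 1 / (q : ℝ) ^ 2 * (q / 2) = 1 / (2 * q) := by
    field_simp
  rw [h5] at h4
  have h6 : 1 / (q : ℝ) ≤ |(α * t - k) - (α - a / q) * t| := by
    rw [div_le_iff₀ hq0]
    linarith
  have h7 : 1 / (q : ℝ) = 1 / (2 * q) + 1 / (2 * q) := by
    field_simp
    norm_num
  unfold distInt
  linarith

/-- Among the multiples `αl` with `0 ≤ l ≤ G`, those in a block of about `q/2` consecutive `l` are
`1/(2q)`-separated modulo `1`. Counting `l = 0` and then discarding it avoids an additive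
error `1`, which would be fatal for short ranges. -/
lemma HasApprox.card_distInt_le {α : ℝ} {q : ℕ} (h : HasApprox α q) (G : ℕ) {δ : ℝ}
    (hδ : 0 ≤ δ) :
    (((Icc 1 G).filter fun l : ℕ => distInt (α * l) ≤ δ).card : ℝ) ≤
      8 * G * δ + 4 * q * δ + 2 * G / q := by
  have hq0 : (0 : ℝ) < q := by exact_mod_cast h.1
  set s := q / 2 + 1 with hs
  set S := (range (G + 1)).filter fun l : ℕ => distInt (α * l) ≤ δ with hS
  have hcard : S.card ≤ (G / s + 1) * (⌊4 * q * δ⌋₊ + 1) := by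
    rw [← card_range (G / s + 1), ← card_range (⌊4 * q * δ⌋₊ + 1), ← card_product]
    refine card_le_card_of_injOn
      (fun l : ℕ => (l / s, ⌊2 * q * (α * l - round (α * l) + δ)⌋₊)) ?_ ?_
    · intro l hl
      rw [hS, mem_coe, mem_filter, mem_range] at hl
      have h1 := (abs_le.1 (show |α * l - round (α * l)| ≤ δ from hl.2)).2
      simp only [coe_product, Set.mem_prod, coe_range, Set.mem_Iio]
      refine ⟨Nat.lt_succ_iff.2 (Nat.div_le_div_right (by lia)),
        Nat.lt_succ_iff.2 (Nat.floor_le_floor ?_)⟩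
      nlinarith
    · intro l hl l' hl' hll
      rw [hS, mem_coe, mem_filter, mem_range] at hl hl'
      simp only [Prod.mk.injEq] at hll
      by_contra hne
      have h1 := (abs_le.1 (show |α * l - round (α * l)| ≤ δ from hl.2)).1
      have h1' := (abs_le.1 (show |α * l' - round (α * l')| ≤ δ from hl'.2)).1
      have h2 : |2 * q * (α * l - round (α * l) + δ) - 2 * q * (α * l' - round (α * l') + δ)|
          < 1 := by
        have p1 : 0 ≤ 2 * q * (α * l - round (α * l) + δ) := by
          have : 0 ≤ α * l - round (α * l) + δ := by linarith
          positivity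
        have p2 : 0 ≤ 2 * q * (α * l' - round (α * l') + δ) := by
          have : 0 ≤ α * l' - round (α * l') + δ := by linarith
          positivity
        have a1 := Nat.floor_le p1
        have a2 := Nat.lt_floor_add_one (2 * q * (α * l - round (α * l) + δ))
        have b1 := Nat.floor_le p2
        have b2 := Nat.lt_floor_add_one (2 * q * (α * l' - round (α * l') + δ))
        rw [hll.2] at a1 a2
        rw [abs_lt]
        constructor <;> linarith
      have hdiff : 2 * |(l : ℤ) - l'| ≤ q := by
        have e1 := Nat.div_add_mod l s
        have e2 := Nat.div_add_mod l' s
        have m1 := Nat.mod_lt l (show 0 < s by lia)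
        have m2 := Nat.mod_lt l' (show 0 < s by lia)
        rw [hll.1] at e1
        have habs : |(l : ℤ) - l'| ≤ q / 2 := abs_le.2 ⟨by lia, by lia⟩
        lia
      have h3 := h.le_distInt (t := (l : ℤ) - l') (by lia) hdiff
      have h4 := h3.trans (distInt_le _ (round (α * l) - round (α * l')))
      push_cast at h4
      have h5 : 2 * q * (α * l - round (α * l) + δ) - 2 * q * (α * l' - round (α * l') + δ)
          = 2 * q * (α * (l - l') - (round (α * l) - round (α * l'))) := by ring
      rw [h5, abs_mul, abs_of_pos (by positivity)] at h2
      rw [div_le_iff₀ (by positivity)] at h4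
      linarith
  have hS0 : S = insert 0 ((Icc 1 G).filter fun l : ℕ => distInt (α * l) ≤ δ) := by
    ext l
    simp only [hS, mem_filter, mem_range, mem_insert, mem_Icc]
    constructor
    · rintro ⟨h1, h2⟩
      rcases Nat.eq_zero_or_pos l with h0 | h0
      · exact Or.inl h0
      · exact Or.inr ⟨⟨h0, by lia⟩, h2⟩
    · rintro (rfl | h1)
      · refine ⟨by lia, ?_⟩
        simpa [distInt] using hδ
      · exact ⟨by lia, h1.2⟩
  rw [hS0, card_insert_of_notMem (by simp)] at hcard
  have hcard' : (((Icc 1 G).filter fun l : ℕ => distInt (α * l) ≤ δ).card : ℝ) + 1 ≤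
      ((G / s : ℕ) + 1) * (⌊4 * q * δ⌋₊ + 1) := by exact_mod_cast hcard
  have h1 : ((G / s : ℕ) : ℝ) ≤ 2 * G / q := by
    refine (Nat.cast_div_le).trans ?_
    rw [div_le_div_iff₀ (by positivity) hq0]
    have : (q : ℝ) ≤ 2 * s := by
      exact_mod_cast (show q ≤ 2 * s by lia)
    nlinarith [Nat.cast_nonneg (α := ℝ) G]
  have h2 : (⌊4 * q * δ⌋₊ : ℝ) ≤ 4 * q * δ := Nat.floor_le (by positivity)
  have h3 : (((G / s : ℕ) : ℝ) + 1) * (⌊4 * q * δ⌋₊ + 1)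
      ≤ (2 * G / q + 1) * (4 * q * δ + 1) := by gcongr
  have h4 : (2 * G / q + 1) * (4 * q * δ + 1) = 8 * G * δ + 4 * q * δ + 2 * G / q + 1 := by
    field_simp
    ring
  linarith

lemma cappedInv_le_sum_levels {X : ℝ} (hX : 0 < X) (J : ℕ) (hJ : X ≤ 2 ^ J) (y : ℝ) :
    cappedInv X y ≤
      ∑ j ∈ range (J + 1), if distInt y ≤ 1 / 2 ^ j then (2 : ℝ) ^ (j + 1) else 0 := by
  have key : ∀ J : ℕ, (distInt y ≤ 1 / 2 ^ J → (2 : ℝ) ^ J ≤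
        ∑ j ∈ range (J + 1), if distInt y ≤ 1 / 2 ^ j then (2 : ℝ) ^ (j + 1) else 0) ∧
      (1 / 2 ^ J < distInt y → (distInt y)⁻¹ ≤
        ∑ j ∈ range (J + 1), if distInt y ≤ 1 / 2 ^ j then (2 : ℝ) ^ (j + 1) else 0) := by
    intro J
    have hnn : ∀ n, 0 ≤ ∑ j ∈ range n, if distInt y ≤ 1 / 2 ^ j then (2 : ℝ) ^ (j + 1) else 0 :=
      fun n => sum_nonneg fun _ _ => by positivity
    induction J with
    | zero =>
      refine ⟨fun h => ?_, fun h => ?_⟩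
      · rw [sum_range_one, if_pos h]
        norm_num
      · have := distInt_le_half y
        norm_num at h
        linarith
    | succ J ih =>
      refine ⟨fun h => ?_, fun h => ?_⟩
      · rw [sum_range_succ, if_pos h]
        have := hnn (J + 1)
        have h2 : (2 : ℝ) ^ (J + 1) ≤ 2 ^ (J + 1 + 1) := by
          gcongr <;> norm_num
        linarith
      · rcases le_or_gt (distInt y) (1 / 2 ^ J) with h1 | h1
        · rw [sum_range_succ, sum_range_succ, if_pos h1]
          have h0 : (distInt y)⁻¹ ≤ 2 ^ (J + 1) := by
            rw [inv_le_comm₀ (lt_trans (by positivity) h) (by positivity), ← one_div]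
            exact h.le
          have := hnn J
          have : (0 : ℝ) ≤ if distInt y ≤ 1 / 2 ^ (J + 1) then (2 : ℝ) ^ (J + 1 + 1) else 0 := by
            positivity
          linarith
        · rw [sum_range_succ]
          have := ih.2 h1
          have : (0 : ℝ) ≤ if distInt y ≤ 1 / 2 ^ (J + 1) then (2 : ℝ) ^ (J + 1 + 1) else 0 := by
            positivity
          linarith
  rcases le_or_gt (distInt y) (1 / 2 ^ J) with h | h
  · exact (cappedInv_le hX y).trans (hJ.trans ((key J).1 h))
  · refine le_trans ?_ ((key J).2 h)
    exact inv_anti₀ (lt_trans (by positivity) h) (le_max_left _ _)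

lemma HasApprox.sum_cappedInv_le {α : ℝ} {q : ℕ} (h : HasApprox α q) (G : ℕ) {X : ℝ}
    (hX : 0 < X) (J : ℕ) (hJ : X ≤ 2 ^ J) (hJ' : (2 : ℝ) ^ J ≤ 2 * X) :
    ∑ l ∈ Icc 1 G, cappedInv X (α * l) ≤ (J + 1) * (16 * G + 8 * q) + 16 * X * G / q := by
  have hq0 : (0 : ℝ) < q := by exact_mod_cast h.1
  calc ∑ l ∈ Icc 1 G, cappedInv X (α * l)
      ≤ ∑ l ∈ Icc 1 G, ∑ j ∈ range (J + 1),
          if distInt (α * l) ≤ 1 / 2 ^ j then (2 : ℝ) ^ (j + 1) else 0 :=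
        sum_le_sum fun l _ => cappedInv_le_sum_levels hX J hJ _
    _ = ∑ j ∈ range (J + 1), (2 : ℝ) ^ (j + 1) *
          (((Icc 1 G).filter fun l : ℕ => distInt (α * l) ≤ 1 / 2 ^ j).card : ℝ) := by
        rw [sum_comm]
        refine sum_congr rfl fun j _ => ?_
        rw [← sum_filter, sum_const, nsmul_eq_mul, mul_comm]
    _ ≤ ∑ j ∈ range (J + 1), ((16 * (G : ℝ) + 8 * q) + (2 : ℝ) ^ j * (4 * G / q)) := by
        refine sum_le_sum fun j _ => ?_
        have h1 := h.card_distInt_le G (δ := 1 / 2 ^ j) (by positivity)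
        calc _ ≤ (2 : ℝ) ^ (j + 1) * (8 * G * (1 / 2 ^ j) + 4 * q * (1 / 2 ^ j) + 2 * G / q) := by
              gcongr
          _ = _ := by
              field_simp
              ring
    _ ≤ _ := by
        rw [sum_add_distrib, sum_const, card_range, nsmul_eq_mul, ← sum_mul,
          geom_sum_eq (by norm_num)]
        have h2 : ((2 : ℝ) ^ (J + 1) - 1) / (2 - 1) ≤ 4 * X := by
          rw [pow_succ]
          linarith
        have h3 := mul_le_mul_of_nonneg_right h2 (show 0 ≤ 4 * (G : ℝ) / q by positivity)
        have h4 : 4 * X * (4 * (G : ℝ) / q) = 16 * X * G / q := by ring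
        push_cast
        linarith

lemma exists_two_pow {X : ℝ} (hX : 1 ≤ X) : ∃ J : ℕ, X ≤ 2 ^ J ∧ (2 : ℝ) ^ J ≤ 2 * X := by
  obtain ⟨n, hn, hn'⟩ := exists_nat_pow_near hX (show (1 : ℝ) < 2 by norm_num)
  refine ⟨n + 1, hn'.le, ?_⟩
  rw [pow_succ]
  linarith

/-! ### Counting and Cauchy–Schwarz tools -/

/-- Cauchy–Schwarz in the form that strips a weight `w` from a sum of quantities `g ≤ u`. -/
lemma sq_sum_mul_le {ι : Type*} (s : Finset ι) (w g u : ι → ℝ)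
    (hg : ∀ i ∈ s, 0 ≤ g i) (hu : ∀ i ∈ s, g i ≤ u i) :
    (∑ i ∈ s, w i * g i) ^ 2 ≤ (∑ i ∈ s, w i ^ 2 * u i) * ∑ i ∈ s, g i := by
  calc (∑ i ∈ s, w i * g i) ^ 2 ≤ (∑ i ∈ s, w i ^ 2 * g i) * ∑ i ∈ s, g i := by
        refine sum_sq_le_sum_mul_sum_of_sq_le_mul s (fun i hi => ?_) hg
          fun i _ => le_of_eq (by ring)
        exact mul_nonneg (sq_nonneg _) (hg i hi)
    _ ≤ _ := by
        refine mul_le_mul_of_nonneg_right (sum_le_sum fun i hi => ?_) (sum_nonneg hg)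
        exact mul_le_mul_of_nonneg_left (hu i hi) (sq_nonneg _)

lemma sum_comp_le_sum_tau_sq {ι : Type*} (s : Finset ι) (T : Finset ℕ) (φ u v : ι → ℕ)
    (hT : ∀ x ∈ s, φ x ∈ T) (h0 : ∀ x ∈ s, φ x ≠ 0) (hu : ∀ x ∈ s, u x ∣ φ x)
    (hv : ∀ x ∈ s, v x ∣ φ x)
    (hinj : ∀ x ∈ s, ∀ y ∈ s, φ x = φ y → u x = u y → v x = v y → x = y)
    (f : ℕ → ℝ) (hf : ∀ n ∈ T, 0 ≤ f n) :
    ∑ x ∈ s, f (φ x) ≤ ∑ n ∈ T, tau n ^ 2 * f n := by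
  classical
  rw [← sum_fiberwise_of_maps_to hT]
  refine sum_le_sum fun n hn => ?_
  rw [sum_congr rfl (g := fun _ => f n) (fun x hx => by rw [(mem_filter.1 hx).2]), sum_const,
    nsmul_eq_mul]
  refine mul_le_mul_of_nonneg_right ?_ (hf n hn)
  have h1 : (s.filter fun x => φ x = n).card ≤ (n.divisors ×ˢ n.divisors).card := by
    refine card_le_card_of_injOn (fun x => (u x, v x)) ?_ ?_
    · intro x hx
      obtain ⟨hxs, rfl⟩ := mem_filter.1 hx
      simp only [coe_product, Set.mem_prod, mem_coe, Nat.mem_divisors]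
      exact ⟨⟨hu x hxs, h0 x hxs⟩, hv x hxs, h0 x hxs⟩
    · intro x hx y hy hxy
      obtain ⟨hx, hx'⟩ := mem_filter.1 hx
      obtain ⟨hy, hy'⟩ := mem_filter.1 hy
      simp only [Prod.mk.injEq] at hxy
      exact hinj x hx y hy (hx'.trans hy'.symm) hxy.1 hxy.2
  rw [card_product, ← sq] at h1
  unfold tau
  exact_mod_cast h1

lemma norm_e_sub_one_le (x : ℝ) : ‖e x - 1‖ ≤ 2 * Real.pi * |x| := by
  rw [e_eq]
  refine Real.norm_exp_I_mul_ofReal_sub_one_le.trans (le_of_eq ?_)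
  rw [Real.norm_eq_abs, abs_mul, abs_of_pos (by positivity)]

lemma le_norm_geom_sum_e {H : ℕ} (hH : 1 ≤ H) {y : ℝ} (hy : distInt y ≤ 1 / (8 * H)) :
    (H : ℝ) / 5 ≤ ‖∑ k ∈ range H, e (k * y)‖ := by
  have hH0 : (0 : ℝ) < H := by exact_mod_cast hH
  have h1 : ‖∑ k ∈ range H, (e (k * y) - 1)‖ ≤ H * (4 / 5) := by
    refine (norm_sum_le _ _).trans ?_
    refine (sum_le_card_nsmul _ _ (4 / 5) fun k hk => ?_).trans (by simp)
    rw [e_natCast_mul, ← e_sub_round y, ← e_natCast_mul]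
    refine (norm_e_sub_one_le _).trans ?_
    have hk' : (k : ℝ) ≤ H := by exact_mod_cast (mem_range.1 hk).le
    rw [abs_mul, Nat.abs_cast]
    have h2 : (k : ℝ) * |y - round y| ≤ 1 / 8 := by
      calc (k : ℝ) * |y - round y| ≤ H * (1 / (8 * H)) := by
            gcongr
            exact hy
        _ = 1 / 8 := by field_simp
    have h3 := Real.pi_lt_d2
    nlinarith [Real.pi_pos]
  rw [sum_sub_distrib] at h1
  simp only [sum_const, card_range, nsmul_eq_mul, mul_one] at h1
  have h4 := norm_sub_norm_le ((H : ℕ) : ℂ) (∑ k ∈ range H, e (k * y))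
  rw [norm_sub_rev, Complex.norm_natCast] at h4
  linarith

/-- The Fejér kernel bounds the number of points close to an integer by exponential sums. -/
lemma card_distInt_le_sum_norm {ι : Type*} (Y : Finset ι) (φ : ι → ℝ) {H : ℕ} (hH : 1 ≤ H) :
    (H : ℝ) * ((Y.filter fun x => distInt (φ x) ≤ 1 / (8 * H)).card : ℝ) ≤
      25 * (Y.card + 2 * ∑ h ∈ Ico 1 H, ‖∑ x ∈ Y, e (h * φ x)‖) := by
  have hH0 : (0 : ℝ) < H := by exact_mod_cast hH
  have h1 : ((Y.filter fun x => distInt (φ x) ≤ 1 / (8 * H)).card : ℝ) * ((H : ℝ) / 5) ^ 2 ≤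
      ∑ x ∈ Y, ‖∑ k ∈ range H, e (k * φ x)‖ ^ 2 := by
    rw [← nsmul_eq_mul, ← sum_const]
    refine (sum_le_sum fun x hx => ?_).trans
      (sum_le_sum_of_subset_of_nonneg (filter_subset _ _) fun _ _ _ => sq_nonneg _)
    exact pow_le_pow_left₀ (by positivity) (le_norm_geom_sum_e hH (mem_filter.1 hx).2) 2
  have h2 : ∑ x ∈ Y, ‖∑ k ∈ range H, e (k * φ x)‖ ^ 2 =
      H * Y.card + 2 * (∑ t ∈ Ico 1 H, ((H - t : ℕ) : ℂ) * ∑ x ∈ Y, e (t * φ x)).re := by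
    have h3 : ∀ x ∈ Y, ‖∑ k ∈ range H, e (k * φ x)‖ ^ 2 =
        H + 2 * (∑ t ∈ Ico 1 H, ((H - t : ℕ) : ℂ) * e (t * φ x)).re := by
      intro x _
      rw [norm_sum_range_sq]
      congr 1
      · simp [norm_e]
      · congr 2
        refine sum_congr rfl fun t _ => ?_
        rw [sum_congr rfl (g := fun _ => e (t * φ x)), sum_const, card_range, nsmul_eq_mul]
        intro i _
        rw [conj_e, ← e_add]
        congr 1
        push_cast
        ring
    rw [sum_congr rfl h3, sum_add_distrib, ← mul_sum, ← Complex.re_sum, sum_comm]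
    simp_rw [mul_sum]
    simp [mul_comm]
  have h4 : (∑ t ∈ Ico 1 H, ((H - t : ℕ) : ℂ) * ∑ x ∈ Y, e (t * φ x)).re ≤
      H * ∑ t ∈ Ico 1 H, ‖∑ x ∈ Y, e (t * φ x)‖ := by
    refine (Complex.re_le_norm _).trans ((norm_sum_le _ _).trans ?_)
    rw [mul_sum]
    refine sum_le_sum fun t _ => ?_
    rw [norm_mul, Complex.norm_natCast]
    gcongr
    exact Nat.sub_le _ _
  rw [h2] at h1
  have h5 : (H : ℝ) * (H * ((Y.filter fun x => distInt (φ x) ≤ 1 / (8 * H)).card : ℝ)) ≤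
      H * (25 * (Y.card + 2 * ∑ h ∈ Ico 1 H, ‖∑ x ∈ Y, e (h * φ x)‖)) := by
    nlinarith
  exact le_of_mul_le_mul_left h5 hH0

/-- Weyl differencing for a quadratic phase. -/
lemma norm_sum_e_sq_le (β : ℝ) {D : ℕ} (hD : 1 ≤ D) :
    ‖∑ d ∈ Ico D (2 * D), e (β * (d : ℝ) ^ 2)‖ ^ 2 ≤
      D + 2 * ∑ t ∈ Ico 1 D, cappedInv D (β * (2 * t)) := by
  have hD0 : (0 : ℝ) < D := by exact_mod_cast hD
  rw [sum_Ico_eq_sum_range, show 2 * D - D = D by lia, norm_sum_range_sq]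
  have h1 : ∑ i ∈ range D, ‖e (β * ((D + i : ℕ) : ℝ) ^ 2)‖ ^ 2 = (D : ℝ) := by
    simp [norm_e]
  rw [h1]
  gcongr
  refine (Complex.re_le_norm _).trans ((norm_sum_le _ _).trans (sum_le_sum fun t _ => ?_))
  have h2 : ∀ i : ℕ, e (β * ((D + (i + t) : ℕ) : ℝ) ^ 2) *
      (starRingEnd ℂ) (e (β * ((D + i : ℕ) : ℝ) ^ 2)) =
      e (β * (2 * D * t + t ^ 2)) * e (i * (β * (2 * t))) := by
    intro i
    rw [conj_e, ← e_add, ← e_add]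
    congr 1
    push_cast
    ring
  simp_rw [h2]
  rw [← mul_sum, norm_mul, norm_e, one_mul]
  exact norm_geom_sum_e_le _ _ hD0 (by exact_mod_cast Nat.sub_le _ _)

/-! ### The bilinear sum over `d²l` -/

/-- `α` is on a minor arc: it has an approximation with denominator `q` in `[R³², N/R³²]`.
The number `L` is an upper bound for `log N` and large enough to absorb numerical constants. -/
structure IsMinor (α N R L : ℝ) (q : ℕ) : Prop where
  hasApprox : HasApprox α q
  le_L : 2000 ≤ L
  log_le : Real.log N ≤ L
  one_le_R : 1 ≤ R
  le_q : R ^ 32 ≤ q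
  q_le : q * R ^ 32 ≤ N

namespace IsMinor

variable {α N R L : ℝ} {q : ℕ}

lemma one_le_q (h : IsMinor α N R L q) : (1 : ℝ) ≤ q := by exact_mod_cast h.hasApprox.1

lemma one_le_N (h : IsMinor α N R L q) : 1 ≤ N := by
  have h1 := h.one_le_q
  have h2 : (1 : ℝ) ≤ R ^ 32 := one_le_pow₀ h.one_le_R
  nlinarith [h.q_le]

lemma one_add_log_le (h : IsMinor α N R L q) {x : ℝ} (hx0 : 0 < x) (hx : x ≤ 64 * N) :
    1 + Real.log x ≤ 2 * L := by
  have hN := h.one_le_N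
  have h1 := Real.log_le_log hx0 hx
  rw [Real.log_mul (by norm_num) (by linarith)] at h1
  have h2 : Real.log 64 ≤ 63 := by
    have := Real.log_le_sub_one_of_pos (show (0 : ℝ) < 64 by norm_num)
    linarith
  linarith [h.log_le, h.le_L]

lemma level_le (h : IsMinor α N R L q) {J : ℕ} (hJ : (2 : ℝ) ^ J ≤ 64 * N) :
    (J : ℝ) + 1 ≤ 4 * L := by
  have h1 := h.one_add_log_le (by positivity) hJ
  rw [Real.log_pow] at h1
  have := Real.log_two_gt_d9
  have hJ0 : (0 : ℝ) ≤ J := Nat.cast_nonneg J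
  nlinarith [h.le_L]

/-- Cauchy–Schwarz removes the divisor weight that arises from gluing several variables. -/
lemma sum_tau_sq_cappedInv_le (h : IsMinor α N R L q) {G D : ℕ} (hD : 1 ≤ D) (hG : 1 ≤ G)
    (hDR : R ^ 8 ≤ D) (hlow : N ≤ (D * G : ℝ) * R ^ 8) (hGN : (D * G : ℝ) ≤ 4 * N) :
    ∑ g ∈ Icc 1 G, tau g ^ 2 * cappedInv D (α * g) ≤ D * G * (2 ^ 8 * L ^ 9 / R ^ 4) := by
  have hR := h.one_le_R
  have hL := h.le_L
  have hq := h.one_le_q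
  have hD0 : (1 : ℝ) ≤ D := by exact_mod_cast hD
  have hG0 : (1 : ℝ) ≤ G := by exact_mod_cast hG
  obtain ⟨J, hJ, hJ'⟩ := exists_two_pow hD0
  have hJL : (J : ℝ) + 1 ≤ 4 * L := h.level_le (by nlinarith)
  have hR8 : (1 : ℝ) ≤ R ^ 8 := one_le_pow₀ hR
  have h1 := sq_sum_mul_le (Icc 1 G) (fun g => tau g ^ 2) (fun g => cappedInv D (α * g))
    (fun _ => (D : ℝ)) (fun g _ => (cappedInv_pos (by linarith) _).le)
    (fun g _ => cappedInv_le (by linarith) _)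
  have h2 : ∑ g ∈ Icc 1 G, (tau g ^ 2) ^ 2 * (D : ℝ) ≤ D * G * (2 * L) ^ 16 := by
    have h3 := sum_tau_pow_div_le 4 G
    have h4 : (1 + Real.log G) ^ 2 ^ 4 ≤ (2 * L) ^ 16 := by
      refine pow_le_pow_left₀ ?_ (h.one_add_log_le (by linarith) (by nlinarith)) 16
      have := Real.log_nonneg hG0
      linarith
    have h5 : ∑ g ∈ Icc 1 G, (tau g ^ 2) ^ 2 * (D : ℝ) ≤
        D * G * ∑ g ∈ Icc 1 G, tau g ^ 4 / g := by
      rw [mul_sum]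
      refine sum_le_sum fun g hg => ?_
      obtain ⟨hg1, hgG⟩ := mem_Icc.1 hg
      have hg1' : (1 : ℝ) ≤ g := by exact_mod_cast hg1
      have hgG' : (g : ℝ) ≤ G := by exact_mod_cast hgG
      rw [← pow_mul, mul_div_assoc', le_div_iff₀ (by linarith)]
      have h0 : 0 ≤ tau g ^ (2 * 2) * (D : ℝ) := by
        have := tau_nonneg g
        positivity
      calc tau g ^ (2 * 2) * (D : ℝ) * g ≤ tau g ^ (2 * 2) * (D : ℝ) * G := by gcongr
        _ = D * G * tau g ^ 4 := by ring
    refine h5.trans ?_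
    gcongr
    exact h3.trans h4
  have h6 : ∑ g ∈ Icc 1 G, cappedInv D (α * g) ≤ D * G * (L ^ 2 / R ^ 8) := by
    refine (h.hasApprox.sum_cappedInv_le G (by linarith) J hJ hJ').trans ?_
    have e1 : (G : ℝ) ≤ D * G / R ^ 8 := by
      rw [le_div_iff₀ (by positivity)]
      nlinarith
    have e2 : (q : ℝ) ≤ D * G / R ^ 8 := by
      rw [le_div_iff₀ (by positivity)]
      have s1 := h.q_le
      have s2 : (q : ℝ) * R ^ 8 * R ^ 8 ≤ D * G * R ^ 8 := by
        have : (q : ℝ) * R ^ 8 * R ^ 8 ≤ q * R ^ 32 := by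
          rw [mul_assoc, ← pow_add]
          gcongr
          norm_num
        linarith
      exact le_of_mul_le_mul_right s2 (by positivity)
    have e3 : 16 * (D : ℝ) * G / q ≤ 16 * (D * G / R ^ 8) := by
      rw [mul_assoc, mul_div_assoc]
      gcongr
      refine le_trans ?_ h.le_q
      exact pow_le_pow_right₀ hR (by norm_num)
    have e4 : 0 ≤ D * G / R ^ 8 := by positivity
    calc (J + 1) * (16 * (G : ℝ) + 8 * q) + 16 * D * G / q
        ≤ 4 * L * (16 * (D * G / R ^ 8) + 8 * (D * G / R ^ 8)) + 16 * (D * G / R ^ 8) := by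
          gcongr
      _ = (96 * L + 16) * (D * G / R ^ 8) := by ring
      _ ≤ L ^ 2 * (D * G / R ^ 8) := by
          gcongr
          nlinarith
      _ = _ := by ring
  have h7 : (∑ g ∈ Icc 1 G, tau g ^ 2 * cappedInv D (α * g)) ^ 2 ≤
      (D * G * (2 ^ 8 * L ^ 9 / R ^ 4)) ^ 2 := by
    refine h1.trans ?_
    calc _ ≤ (D * G * (2 * L) ^ 16) * (D * G * (L ^ 2 / R ^ 8)) := by
          refine mul_le_mul h2 h6 (sum_nonneg fun g _ => ?_) (by positivity)
          exact (cappedInv_pos (by linarith) _).le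
      _ = _ := by
          field_simp
  exact le_of_sq_le_sq h7 (by positivity)

/-- After the Fejér kernel, the exponential sums over `d ∼ D` save a power of `R`, provided that
`D` is at least a power of `R`. -/
lemma sum_norm_sum_e_sq_le (h : IsMinor α N R L q) {D J H : ℕ} (hD : 1 ≤ D) (hJ : 1 ≤ J)
    (hH : 1 ≤ H) (hDR : R ^ 8 ≤ D) (hlow : N ≤ (4 * H * J * D ^ 2 : ℝ) * R ^ 8)
    (hup : (4 * H * J * D ^ 2 : ℝ) ≤ 4 * N) :
    ∑ k ∈ Ico 1 H, ‖∑ x ∈ Ico D (2 * D) ×ˢ Ico J (2 * J),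
        e (k * (α * ((x.1 : ℝ) ^ 2 * x.2)))‖ ≤ 2 * N / D * (L ^ 5 / R ^ 2) := by
  have hR := h.one_le_R
  have hL := h.le_L
  have hD0 : (1 : ℝ) ≤ D := by exact_mod_cast hD
  have hJ0 : (1 : ℝ) ≤ J := by exact_mod_cast hJ
  have hH0 : (1 : ℝ) ≤ H := by exact_mod_cast hH
  set f : ℕ × ℕ → ℝ := fun p => ‖∑ d ∈ Ico D (2 * D), e (α * p.1 * p.2 * (d : ℝ) ^ 2)‖ with hf
  have h1 : ∑ k ∈ Ico 1 H, ‖∑ x ∈ Ico D (2 * D) ×ˢ Ico J (2 * J),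
      e (k * (α * ((x.1 : ℝ) ^ 2 * x.2)))‖ ≤ ∑ p ∈ Ico 1 H ×ˢ Ico J (2 * J), f p := by
    rw [sum_product]
    refine sum_le_sum fun k _ => ?_
    rw [sum_product_right]
    refine (norm_sum_le _ _).trans (sum_le_sum fun l _ => le_of_eq ?_)
    rw [hf]
    congr 1
    refine sum_congr rfl fun d _ => ?_
    congr 1
    push_cast
    ring
  set G := 4 * H * J * D with hG
  have hG1 : 1 ≤ G := by
    have : 0 < 4 * H * J * D := by positivity
    lia
  have hDG : (D * G : ℝ) = 4 * H * J * D ^ 2 := by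
    rw [hG]
    push_cast
    ring
  have h2 : ∑ p ∈ Ico 1 H ×ˢ Ico J (2 * J), f p ^ 2 ≤ D * G * (L ^ 10 / R ^ 4) := by
    have h3 : ∑ p ∈ Ico 1 H ×ˢ Ico J (2 * J), f p ^ 2 ≤
        ∑ p ∈ Ico 1 H ×ˢ Ico J (2 * J), (D + 2 * ∑ t ∈ Ico 1 D,
          cappedInv D (α * ((2 * p.1 * p.2 * t : ℕ) : ℝ))) := by
      refine sum_le_sum fun p _ => (norm_sum_e_sq_le _ hD).trans (le_of_eq ?_)
      congr 2
      refine sum_congr rfl fun t _ => ?_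
      congr 1
      push_cast
      ring
    have h4 : ∑ p ∈ Ico 1 H ×ˢ Ico J (2 * J), ∑ t ∈ Ico 1 D,
          cappedInv D (α * ((2 * p.1 * p.2 * t : ℕ) : ℝ)) ≤
        ∑ g ∈ Icc 1 G, tau g ^ 2 * cappedInv D (α * g) := by
      rw [← sum_product']
      refine sum_comp_le_sum_tau_sq ((Ico 1 H ×ˢ Ico J (2 * J)) ×ˢ Ico 1 D) (Icc 1 G)
        (fun x => 2 * x.1.1 * x.1.2 * x.2) (fun x => x.1.1) (fun x => x.1.2) ?_ ?_ ?_ ?_ ?_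
        (fun g => cappedInv D (α * g)) fun g _ => (cappedInv_pos (by linarith) _).le
      · rintro ⟨⟨k, l⟩, t⟩ hx
        simp only [mem_product, mem_Ico] at hx
        obtain ⟨⟨⟨hk, hk'⟩, hl, hl'⟩, ht, ht'⟩ := hx
        rw [mem_Icc]
        have : 1 ≤ l := hJ.trans hl
        refine ⟨Nat.one_le_iff_ne_zero.2 (by positivity), ?_⟩
        calc 2 * k * l * t ≤ 2 * H * (2 * J) * D := by gcongr
          _ = G := by rw [hG]; ring
      · rintro ⟨⟨k, l⟩, t⟩ hx
        simp only [mem_product, mem_Ico] at hx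
        obtain ⟨⟨⟨hk, hk'⟩, hl, hl'⟩, ht, ht'⟩ := hx
        have : 1 ≤ l := hJ.trans hl
        positivity
      · rintro ⟨⟨k, l⟩, t⟩ _
        exact ⟨2 * l * t, by ring⟩
      · rintro ⟨⟨k, l⟩, t⟩ _
        exact ⟨2 * k * t, by ring⟩
      · rintro ⟨⟨k, l⟩, t⟩ hx ⟨⟨k', l'⟩, t'⟩ _ h1 h2 h3
        simp only [mem_product, mem_Ico] at hx h1 h2 h3
        subst h2 h3
        have : 1 ≤ l := hJ.trans hx.1.2.1
        have : 1 ≤ k := hx.1.1.1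
        rw [Nat.eq_of_mul_eq_mul_left (by positivity) h1]
    have h5 := h.sum_tau_sq_cappedInv_le hD hG1 hDR (by rw [hDG]; exact hlow)
      (by rw [hDG]; exact hup)
    rw [sum_add_distrib, ← mul_sum, sum_const, card_product, Nat.card_Ico, Nat.card_Ico,
      nsmul_eq_mul] at h3
    have h6 : (((H - 1) * (2 * J - J) : ℕ) : ℝ) * D ≤ D * G * (1 / R ^ 4) := by
      have s1 : (((H - 1) * (2 * J - J) : ℕ) : ℝ) ≤ H * J := by
        have : (H - 1) * (2 * J - J) ≤ H * J := Nat.mul_le_mul (Nat.sub_le _ _) (by lia)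
        exact_mod_cast this
      have s2 : R ^ 4 ≤ D := (pow_le_pow_right₀ hR (by norm_num)).trans hDR
      rw [hDG, mul_one_div, le_div_iff₀ (by positivity)]
      calc _ ≤ (H * J : ℝ) * D * D := by gcongr
        _ ≤ 4 * H * J * D ^ 2 := by nlinarith [show 0 ≤ (H * J : ℝ) * D * D by positivity]
    calc _ ≤ D * G * (1 / R ^ 4) + 2 * (D * G * (2 ^ 8 * L ^ 9 / R ^ 4)) := by linarith
      _ = D * G * ((1 + 512 * L ^ 9) / R ^ 4) := by ring
      _ ≤ _ := by
          gcongr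
          have : 1 ≤ L ^ 9 := one_le_pow₀ (by linarith)
          have e : L ^ 10 = L * L ^ 9 := by ring
          rw [e]
          nlinarith
  have h8 : (∑ p ∈ Ico 1 H ×ˢ Ico J (2 * J), f p) ^ 2 ≤ (2 * N / D * (L ^ 5 / R ^ 2)) ^ 2 := by
    refine (sq_sum_le_card_mul_sum_sq).trans ?_
    have h9 : (((Ico 1 H ×ˢ Ico J (2 * J)).card : ℕ) : ℝ) ≤ H * J := by
      rw [card_product, Nat.card_Ico, Nat.card_Ico]
      have : (H - 1) * (2 * J - J) ≤ H * J := Nat.mul_le_mul (Nat.sub_le _ _) (by lia)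
      exact_mod_cast this
    calc _ ≤ (H * J : ℝ) * (D * G * (L ^ 10 / R ^ 4)) := by
          gcongr
      _ = ((4 * H * J * D ^ 2 : ℝ) / (2 * D) * (L ^ 5 / R ^ 2)) ^ 2 := by
          rw [hDG]
          field_simp
          ring
      _ ≤ ((4 * N) / (2 * D) * (L ^ 5 / R ^ 2)) ^ 2 := by gcongr
      _ = _ := by
          congr 2
          field_simp
          ring
  have hN := h.one_le_N
  exact h1.trans (le_of_sq_le_sq h8 (by positivity))

end IsMinor

lemma sum_dyadic {E : Type*} [AddCommMonoid E] (f : ℕ → E) (n : ℕ) :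
    ∑ i ∈ range n, ∑ m ∈ Ico (2 ^ i) (2 * 2 ^ i), f m = ∑ m ∈ Ico 1 (2 ^ n), f m := by
  induction n with
  | zero => simp
  | succ n ih =>
    rw [sum_range_succ, ih, pow_succ, mul_comm (2 ^ n) 2,
      sum_Ico_consecutive _ Nat.one_le_two_pow (by lia)]

namespace IsMinor

variable {α N R L : ℝ} {q : ℕ}

/-- For short ranges of `d` the multiples `d²l` are treated as arbitrary integers, which loses
a factor `D²`. -/
lemma sum_block_le_of_le (h : IsMinor α N R L q) {D J : ℕ} (hD : 1 ≤ D) (hJ : 1 ≤ J) {X : ℝ}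
    (hXDJ : X * (D ^ 2 * J) = 4 * N) (hX20 : 4 * R ^ 20 ≤ X) {K : ℕ} (hK : X ≤ 2 ^ K)
    (hK' : (2 : ℝ) ^ K ≤ 2 * X) (hKL : (K : ℝ) + 1 ≤ 4 * L) (hDR : (D : ℝ) ≤ R ^ 8) :
    ∑ x ∈ Ico D (2 * D) ×ˢ Ico J (2 * J), cappedInv X (α * ((x.1 : ℝ) ^ 2 * x.2)) ≤
      N / D * (L ^ 8 / R ^ 2) := by
  have hR := h.one_le_R
  have hL := h.le_L
  have hN := h.one_le_N
  have hq := h.one_le_q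
  have hD0 : (1 : ℝ) ≤ D := by exact_mod_cast hD
  have hJ0 : (1 : ℝ) ≤ J := by exact_mod_cast hJ
  have hR20 : (1 : ℝ) ≤ R ^ 20 := one_le_pow₀ hR
  have hX0 : 0 < X := by linarith
  have h1 : ∀ d ∈ Ico D (2 * D), ∑ l ∈ Ico J (2 * J), cappedInv X (α * ((d : ℝ) ^ 2 * l)) ≤
      ∑ g ∈ Icc 1 (8 * D ^ 2 * J), cappedInv X (α * (g : ℕ)) := by
    intro d hd
    obtain ⟨hd1, hd2⟩ := mem_Ico.1 hd
    have hd0 : 0 < d := by lia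
    have hinj : Set.InjOn (fun l => d ^ 2 * l) (Ico J (2 * J) : Set ℕ) := fun l _ l' _ hll =>
      Nat.eq_of_mul_eq_mul_left (pow_pos hd0 2) hll
    calc _ = ∑ g ∈ (Ico J (2 * J)).image (fun l => d ^ 2 * l), cappedInv X (α * (g : ℕ)) := by
          rw [sum_image hinj]
          push_cast
          rfl
      _ ≤ _ := by
          refine sum_le_sum_of_subset_of_nonneg ?_ fun _ _ _ => (cappedInv_pos hX0 _).le
          intro g hg
          obtain ⟨l, hl, rfl⟩ := mem_image.1 hg
          obtain ⟨hl1, hl2⟩ := mem_Ico.1 hl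
          have hl0 : 0 < l := by lia
          refine mem_Icc.2 ⟨Nat.mul_pos (pow_pos hd0 2) hl0, ?_⟩
          calc d ^ 2 * l ≤ (2 * D) ^ 2 * (2 * J) := by gcongr
            _ = _ := by ring
  rw [sum_product]
  have h2 := h.hasApprox.sum_cappedInv_le (8 * D ^ 2 * J) hX0 K hK hK'
  push_cast at h2
  have e1 : (D ^ 2 * J : ℝ) ≤ N / R ^ 20 := by
    rw [le_div_iff₀ (by positivity)]
    have : 4 * R ^ 20 * (D ^ 2 * J : ℝ) ≤ X * (D ^ 2 * J) := by gcongr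
    linarith
  have e2 : (q : ℝ) ≤ N / R ^ 20 := by
    rw [le_div_iff₀ (by positivity)]
    refine le_trans ?_ h.q_le
    gcongr
    norm_num
  have e3 : 16 * X * (8 * D ^ 2 * J) / q ≤ 512 * (N / R ^ 20) := by
    rw [show 16 * X * (8 * D ^ 2 * J) = 512 * N by linear_combination 128 * hXDJ,
      mul_div_assoc]
    gcongr
    refine le_trans ?_ h.le_q
    exact pow_le_pow_right₀ hR (by norm_num)
  calc _ ≤ ∑ d ∈ Ico D (2 * D), ∑ g ∈ Icc 1 (8 * D ^ 2 * J), cappedInv X (α * (g : ℕ)) :=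
        sum_le_sum h1
    _ = D * ∑ g ∈ Icc 1 (8 * D ^ 2 * J), cappedInv X (α * (g : ℕ)) := by
        rw [sum_const, Nat.card_Ico, nsmul_eq_mul, show 2 * D - D = D by lia]
    _ ≤ D * (4 * L * (16 * (8 * (N / R ^ 20)) + 8 * (N / R ^ 20)) + 512 * (N / R ^ 20)) := by
        have e4 : 16 * (8 * D ^ 2 * J : ℝ) + 8 * q ≤
            16 * (8 * (N / R ^ 20)) + 8 * (N / R ^ 20) := by
          linarith
        gcongr
        exact h2.trans (add_le_add (mul_le_mul hKL e4 (by positivity) (by linarith)) e3)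
    _ = D ^ 2 * (N / D) * ((544 * L + 512) / R ^ 20) := by
        field_simp
        ring
    _ ≤ (R ^ 8) ^ 2 * (N / D) * (L ^ 2 / R ^ 20) := by
        gcongr
        nlinarith
    _ = (N / D) * (L ^ 2 / R ^ 4) := by
        field_simp
    _ ≤ _ := by
        gcongr
        · linarith
        · norm_num
        · norm_num

/-- For long ranges of `d` there is enough room to exploit the variable `d` by Weyl differencing,
unless the level is so low that counting all pairs suffices. -/
lemma card_level_le (h : IsMinor α N R L q) {D J : ℕ} (hD : 1 ≤ D) (hJ : 1 ≤ J) {X : ℝ}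
    (hXDJ : X * (D ^ 2 * J) = 4 * N) (hX20 : 4 * R ^ 20 ≤ X) (hDR : R ^ 8 ≤ (D : ℝ))
    {k : ℕ} (hk : (2 : ℝ) ^ k ≤ 2 * X) :
    (2 : ℝ) ^ (k + 1) * (((Ico D (2 * D) ×ˢ Ico J (2 * J)).filter fun x =>
      distInt (α * ((x.1 : ℝ) ^ 2 * x.2)) ≤ 1 / 2 ^ k).card : ℝ) ≤ N / D * (L ^ 6 / R ^ 2) := by
  have hR := h.one_le_R
  have hL := h.le_L
  have hN := h.one_le_N
  have hD0 : (1 : ℝ) ≤ D := by exact_mod_cast hD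
  have hJ0 : (1 : ℝ) ≤ J := by exact_mod_cast hJ
  set Y := Ico D (2 * D) ×ˢ Ico J (2 * J) with hY
  have hYc : (Y.card : ℝ) = D * J := by
    rw [hY, card_product, Nat.card_Ico, Nat.card_Ico, show 2 * D - D = D by lia,
      show 2 * J - J = J by lia]
    push_cast
    ring
  have hDJ : X * (D * J : ℝ) = 4 * (N / D) := by
    field_simp
    linarith
  rcases le_or_gt ((2 : ℝ) ^ k * R ^ 8) (8 * X) with hs | hs
  · have h1 : ((Y.filter fun x => distInt (α * ((x.1 : ℝ) ^ 2 * x.2)) ≤ 1 / 2 ^ k).card : ℝ)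
        ≤ D * J := by
      rw [← hYc]
      exact_mod_cast card_filter_le _ _
    have h2 : (2 : ℝ) ^ k ≤ 8 * X / R ^ 8 := by rwa [le_div_iff₀ (by positivity)]
    calc _ ≤ (2 : ℝ) ^ (k + 1) * (D * J) := by gcongr
      _ = 2 * (2 : ℝ) ^ k * (D * J) := by ring
      _ ≤ 2 * (8 * X / R ^ 8) * (D * J) := by gcongr
      _ = (N / D) * (64 / R ^ 8) := by
          linear_combination 16 / R ^ 8 * hDJ
      _ ≤ _ := by
          gcongr
          · calc (64 : ℝ) ≤ L ^ 1 := by linarith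
              _ ≤ L ^ 6 := pow_le_pow_right₀ (by linarith) (by norm_num)
          · norm_num
  · have hk3 : 3 ≤ k := by
      by_contra hlt
      have h1 : (2 : ℝ) ^ k ≤ 2 ^ 3 := pow_le_pow_right₀ (by norm_num) (by lia)
      have h2 : R ^ 8 ≤ R ^ 20 := pow_le_pow_right₀ hR (by norm_num)
      have h3 : (1 : ℝ) ≤ R ^ 8 := one_le_pow₀ hR
      nlinarith
    obtain ⟨H, hH1, hHk⟩ : ∃ H : ℕ, 1 ≤ H ∧ (2 : ℝ) ^ k = 8 * H := by
      refine ⟨2 ^ (k - 3), Nat.one_le_two_pow, ?_⟩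
      push_cast
      rw [show (8 : ℝ) = 2 ^ 3 by norm_num, ← pow_add]
      congr 1
      lia
    have hHX : 4 * (H : ℝ) ≤ X := by linarith
    have hHX' : X ≤ H * R ^ 8 := by
      rw [hHk] at hs
      linarith
    have h1 := card_distInt_le_sum_norm Y (fun x => α * ((x.1 : ℝ) ^ 2 * x.2)) hH1
    have h2 := h.sum_norm_sum_e_sq_le hD hJ hH1 hDR
      (by
        have : X * (D ^ 2 * J) ≤ H * R ^ 8 * (D ^ 2 * J) := by gcongr
        nlinarith)
      (by
        have : 4 * (H : ℝ) * (D ^ 2 * J) ≤ X * (D ^ 2 * J) := by gcongr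
        nlinarith)
    have h3 : (D * J : ℝ) ≤ N / D * (L ^ 5 / R ^ 2) := by
      have e1 : 4 * R ^ 20 * (D * J : ℝ) ≤ 4 * (N / D) := by
        rw [← hDJ]
        gcongr
      have e2 : (D * J : ℝ) ≤ N / D * (1 / R ^ 20) := by
        rw [mul_one_div, le_div_iff₀ (by positivity)]
        linarith
      refine e2.trans ?_
      gcongr
      · exact one_le_pow₀ (by linarith)
      · norm_num
    rw [hYc] at h1
    rw [pow_succ, hHk]
    set c := ((Y.filter fun x => distInt (α * ((x.1 : ℝ) ^ 2 * x.2)) ≤ 1 / (8 * H)).card : ℝ)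
    set W := ∑ k ∈ Ico 1 H, ‖∑ x ∈ Y, e (k * (α * ((x.1 : ℝ) ^ 2 * x.2)))‖
    have h4 : N / D * (2000 * L ^ 5 / R ^ 2) ≤ N / D * (L ^ 6 / R ^ 2) := by
      gcongr
      rw [pow_succ L 5]
      have : 0 ≤ L ^ 5 := by positivity
      nlinarith
    have h5 : 2 * N / D * (L ^ 5 / R ^ 2) = 2 * (N / D * (L ^ 5 / R ^ 2)) := by ring
    have h6 : N / D * (2000 * L ^ 5 / R ^ 2) = 2000 * (N / D * (L ^ 5 / R ^ 2)) := by ring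
    linarith

lemma sum_block_le (h : IsMinor α N R L q) {D J : ℕ} (hD : 1 ≤ D) (hJ : 1 ≤ J)
    (hT : (D ^ 2 * J : ℝ) * R ^ 20 ≤ N) :
    ∑ x ∈ Ico D (2 * D) ×ˢ Ico J (2 * J),
      cappedInv (4 * N / (D ^ 2 * J)) (α * ((x.1 : ℝ) ^ 2 * x.2)) ≤ N / D * (L ^ 8 / R ^ 2) := by
  have hR := h.one_le_R
  have hL := h.le_L
  have hN := h.one_le_N
  have hD0 : (1 : ℝ) ≤ D := by exact_mod_cast hD
  have hJ0 : (1 : ℝ) ≤ J := by exact_mod_cast hJ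
  set X : ℝ := 4 * N / (D ^ 2 * J) with hX
  have hXDJ : X * (D ^ 2 * J) = 4 * N := by
    rw [hX]
    field_simp
  have hX20 : 4 * R ^ 20 ≤ X := by
    rw [hX, le_div_iff₀ (by positivity)]
    linarith
  have hR20 : (1 : ℝ) ≤ R ^ 20 := one_le_pow₀ hR
  have hX1 : 1 ≤ X := by linarith
  have hXN : X ≤ 4 * N := by
    rw [hX]
    refine div_le_self (by linarith) ?_
    nlinarith [one_le_pow₀ (n := 2) hD0]
  obtain ⟨K, hK, hK'⟩ := exists_two_pow hX1
  have hKL : (K : ℝ) + 1 ≤ 4 * L := h.level_le (by linarith)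
  rcases le_or_gt (D : ℝ) (R ^ 8) with hDR | hDR
  · exact h.sum_block_le_of_le hD hJ hXDJ hX20 hK hK' hKL hDR
  · calc _ ≤ ∑ x ∈ Ico D (2 * D) ×ˢ Ico J (2 * J), ∑ k ∈ range (K + 1),
            if distInt (α * ((x.1 : ℝ) ^ 2 * x.2)) ≤ 1 / 2 ^ k then (2 : ℝ) ^ (k + 1) else 0 :=
          sum_le_sum fun x _ => cappedInv_le_sum_levels (by linarith) K hK _
      _ = ∑ k ∈ range (K + 1), (2 : ℝ) ^ (k + 1) *
          (((Ico D (2 * D) ×ˢ Ico J (2 * J)).filter fun x =>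
            distInt (α * ((x.1 : ℝ) ^ 2 * x.2)) ≤ 1 / 2 ^ k).card : ℝ) := by
          rw [sum_comm]
          refine sum_congr rfl fun k _ => ?_
          rw [← sum_filter, sum_const, nsmul_eq_mul, mul_comm]
      _ ≤ ∑ k ∈ range (K + 1), N / D * (L ^ 6 / R ^ 2) := by
          refine sum_le_sum fun k hk => h.card_level_le hD hJ hXDJ hX20 hDR.le ?_
          refine le_trans (pow_le_pow_right₀ (by norm_num) ?_) hK'
          exact Nat.lt_succ_iff.1 (mem_range.1 hk)
      _ = (K + 1) * (N / D * (L ^ 6 / R ^ 2)) := by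
          rw [sum_const, card_range, nsmul_eq_mul]
          push_cast
          ring
      _ ≤ L ^ 2 * (N / D * (L ^ 6 / R ^ 2)) := by
          gcongr
          nlinarith
      _ = _ := by ring

lemma sum_mul_cappedInv_le (h : IsMinor α N R L q) {T : ℝ} (hT : T * R ^ 20 ≤ N)
    (S : Finset (ℕ × ℕ))
    (hS : ∀ x ∈ S, 1 ≤ x.1 ∧ 1 ≤ x.2 ∧ (x.1 : ℝ) ^ 2 * x.2 ≤ T) :
    ∑ x ∈ S, (x.1 : ℝ) * cappedInv (4 * N / ((x.1 : ℝ) ^ 2 * x.2)) (α * ((x.1 : ℝ) ^ 2 * x.2)) ≤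
      N * (L ^ 11 / R ^ 2) := by
  have hR := h.one_le_R
  have hL := h.le_L
  have hN := h.one_le_N
  have hN0 : 0 < N := by linarith
  obtain ⟨n, hn, hn'⟩ := exists_two_pow (show (1 : ℝ) ≤ 2 * N by linarith)
  have hnL : (n : ℝ) + 1 ≤ 4 * L := h.level_le (by linarith)
  set g : ℕ → ℕ → ℝ := fun d l =>
    (d : ℝ) * cappedInv (4 * N / ((d : ℝ) ^ 2 * l)) (α * ((d : ℝ) ^ 2 * l)) with hg
  have hg0 : ∀ d l : ℕ, 1 ≤ d → 1 ≤ l → 0 ≤ g d l := fun d l hd hl => by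
    have hd' : (0 : ℝ) < d := by exact_mod_cast hd
    have hl' : (0 : ℝ) < l := by exact_mod_cast hl
    exact mul_nonneg hd'.le (cappedInv_pos (by positivity) _).le
  have hR20 : (1 : ℝ) ≤ R ^ 20 := one_le_pow₀ hR
  have hsub : S ⊆ Ico 1 (2 ^ n) ×ˢ Ico 1 (2 ^ n) := by
    intro x hx
    obtain ⟨h1, h2, h3⟩ := hS x hx
    have h1' : (1 : ℝ) ≤ x.1 := by exact_mod_cast h1
    have h2' : (1 : ℝ) ≤ x.2 := by exact_mod_cast h2
    have hTN : T ≤ N := by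
      have : 1 ≤ T := by nlinarith [one_le_pow₀ (n := 2) h1']
      nlinarith
    have h4 : (x.1 : ℝ) ^ 2 * x.2 < 2 ^ n := by linarith
    have h5 : (x.1 : ℝ) < 2 ^ n := lt_of_le_of_lt (by nlinarith) h4
    have h6 : (x.2 : ℝ) < 2 ^ n := lt_of_le_of_lt (by nlinarith [one_le_pow₀ (n := 2) h1']) h4
    rw [mem_product, mem_Ico, mem_Ico]
    exact ⟨⟨h1, by exact_mod_cast h5⟩, h2, by exact_mod_cast h6⟩
  have block : ∀ i ∈ range n, ∀ j ∈ range n,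
      ∑ x ∈ Ico (2 ^ i) (2 * 2 ^ i) ×ˢ Ico (2 ^ j) (2 * 2 ^ j),
        (if x ∈ S then g x.1 x.2 else 0) ≤ 2 * N * (L ^ 8 / R ^ 2) := by
    intro i _ j _
    by_cases hne : ∃ x ∈ Ico (2 ^ i) (2 * 2 ^ i) ×ˢ Ico (2 ^ j) (2 * 2 ^ j), x ∈ S
    · obtain ⟨x, hx, hxS⟩ := hne
      rw [mem_product, mem_Ico, mem_Ico] at hx
      obtain ⟨_, _, hxT⟩ := hS x hxS
      set D := 2 ^ i with hDdef
      set J := 2 ^ j with hJdef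
      have hD : 1 ≤ D := Nat.one_le_two_pow
      have hJ : 1 ≤ J := Nat.one_le_two_pow
      have hD0 : (0 : ℝ) < D := by exact_mod_cast hD
      have hJ0 : (0 : ℝ) < J := by exact_mod_cast hJ
      have hDJ : (D ^ 2 * J : ℝ) ≤ T := by
        have e1 : (D : ℝ) ≤ x.1 := by exact_mod_cast hx.1.1
        have e2 : (J : ℝ) ≤ x.2 := by exact_mod_cast hx.2.1
        exact le_trans (by gcongr) hxT
      have hb := h.sum_block_le hD hJ (le_trans (by gcongr) hT)
      calc _ ≤ ∑ x ∈ Ico D (2 * D) ×ˢ Ico J (2 * J),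
            2 * D * cappedInv (4 * N / (D ^ 2 * J)) (α * ((x.1 : ℝ) ^ 2 * x.2)) := by
            refine sum_le_sum fun y hy => ?_
            have hpos := (cappedInv_pos (show 0 < 4 * N / ((D : ℝ) ^ 2 * J) by positivity)
              (α * ((y.1 : ℝ) ^ 2 * y.2))).le
            rw [mem_product, mem_Ico, mem_Ico] at hy
            have e1 : (D : ℝ) ≤ y.1 := by exact_mod_cast hy.1.1
            have e2 : (J : ℝ) ≤ y.2 := by exact_mod_cast hy.2.1
            have e3 : (y.1 : ℝ) ≤ 2 * D := by exact_mod_cast hy.1.2.le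
            have e4 : (0 : ℝ) < y.1 := by linarith
            have e5 : (0 : ℝ) < y.2 := by linarith
            split_ifs
            · refine mul_le_mul e3 (cappedInv_mono (by positivity) (by gcongr) _)
                (cappedInv_pos (by positivity) _).le (by positivity)
            · positivity
        _ ≤ 2 * D * (N / D * (L ^ 8 / R ^ 2)) := by
            rw [← mul_sum]
            gcongr
        _ = _ := by field_simp
    · push Not at hne
      rw [sum_eq_zero fun x hx => if_neg (hne x hx)]
      positivity
  have h1 : ∑ x ∈ S, g x.1 x.2 =
      ∑ i ∈ range n, ∑ j ∈ range n, ∑ x ∈ Ico (2 ^ i) (2 * 2 ^ i) ×ˢ Ico (2 ^ j) (2 * 2 ^ j),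
        (if x ∈ S then g x.1 x.2 else 0) := by
    rw [← inter_eq_right.2 hsub, ← sum_ite_mem, sum_product]
    simp_rw [inter_eq_right.2 hsub]
    rw [← sum_dyadic]
    refine sum_congr rfl fun i _ => ?_
    simp_rw [← sum_dyadic _ n, sum_product]
    rw [sum_comm]
  calc ∑ x ∈ S, g x.1 x.2 ≤ ∑ i ∈ range n, ∑ j ∈ range n, 2 * N * (L ^ 8 / R ^ 2) := by
        rw [h1]
        exact sum_le_sum fun i hi => sum_le_sum fun j hj => block i hi j hj
    _ = n ^ 2 * (2 * N * (L ^ 8 / R ^ 2)) := by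
        simp only [sum_const, card_range, nsmul_eq_mul]
        ring
    _ ≤ (4 * L) ^ 2 * (2 * N * (L ^ 8 / R ^ 2)) := by
        gcongr
        linarith
    _ = N * (32 * L ^ 10 / R ^ 2) := by ring
    _ ≤ _ := by
        gcongr
        rw [pow_succ L 10]
        have : 0 ≤ L ^ 10 := by positivity
        nlinarith

/-- The minor arc estimate on which everything rests: the sum of
`d τ(l)² min(4N/(d²l), 1/‖αd²l‖)` over `d²l ≤ T` saves a factor `R` over the trivial bound. The
moduli enter through `d²` because two variables congruent modulo `d` differ by a multiple of `d`,
and the remaining variable runs through a progression whose modulus is again divisible by `d`. -/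
lemma sum_tau_sq_mul_cappedInv_le (h : IsMinor α N R L q) {T : ℝ} (hT : T * R ^ 20 ≤ N)
    (S : Finset (ℕ × ℕ))
    (hS : ∀ x ∈ S, 1 ≤ x.1 ∧ 1 ≤ x.2 ∧ (x.1 : ℝ) ^ 2 * x.2 ≤ T) :
    ∑ x ∈ S, tau x.2 ^ 2 * ((x.1 : ℝ) *
      cappedInv (4 * N / ((x.1 : ℝ) ^ 2 * x.2)) (α * ((x.1 : ℝ) ^ 2 * x.2))) ≤
      N * (L ^ 15 / R) := by
  have hR := h.one_le_R
  have hL := h.le_L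
  have hN := h.one_le_N
  have hN0 : 0 < N := by linarith
  have hpos : ∀ x ∈ S, (0 : ℝ) < x.1 ∧ (0 : ℝ) < x.2 := fun x hx => by
    obtain ⟨h1, h2, _⟩ := hS x hx
    exact ⟨by exact_mod_cast h1, by exact_mod_cast h2⟩
  have h1 := sq_sum_mul_le S (fun x => tau x.2 ^ 2) (fun x => (x.1 : ℝ) *
      cappedInv (4 * N / ((x.1 : ℝ) ^ 2 * x.2)) (α * ((x.1 : ℝ) ^ 2 * x.2)))
    (fun x => (x.1 : ℝ) * (4 * N / ((x.1 : ℝ) ^ 2 * x.2)))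
    (fun x hx => by
      obtain ⟨p1, p2⟩ := hpos x hx
      exact mul_nonneg p1.le (cappedInv_pos (by positivity) _).le)
    (fun x hx => by
      obtain ⟨p1, p2⟩ := hpos x hx
      exact mul_le_mul_of_nonneg_left (cappedInv_le (by positivity) _) p1.le)
  set M := ⌊N⌋₊ with hM
  have hM1 : (1 : ℝ) ≤ M := by exact_mod_cast Nat.one_le_floor_iff _ |>.2 hN
  have hMN : (M : ℝ) ≤ N := Nat.floor_le hN0.le
  have hlog := h.one_add_log_le (x := M) (by linarith) (by linarith)
  have hlog0 := Real.log_nonneg hM1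
  have hR20 : (1 : ℝ) ≤ R ^ 20 := one_le_pow₀ hR
  have h2 : ∑ x ∈ S, (tau x.2 ^ 2) ^ 2 * ((x.1 : ℝ) * (4 * N / ((x.1 : ℝ) ^ 2 * x.2))) ≤
      4 * N * (2 * L) ^ 17 := by
    calc _ = ∑ x ∈ S, 4 * N * (1 / (x.1 : ℝ) * (tau x.2 ^ 4 / x.2)) := by
          refine sum_congr rfl fun x hx => ?_
          obtain ⟨p1, p2⟩ := hpos x hx
          field_simp
      _ ≤ ∑ x ∈ Icc 1 M ×ˢ Icc 1 M, 4 * N * (1 / (x.1 : ℝ) * (tau x.2 ^ 4 / x.2)) := by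
          refine sum_le_sum_of_subset_of_nonneg ?_ fun x _ _ => by
            have := tau_nonneg x.2
            positivity
          intro x hx
          obtain ⟨p1, p2, p3⟩ := hS x hx
          have p1' : (1 : ℝ) ≤ x.1 := by exact_mod_cast p1
          have p2' : (1 : ℝ) ≤ x.2 := by exact_mod_cast p2
          have p4 := one_le_pow₀ (n := 2) p1'
          have hTN : T ≤ N := by
            have : 1 ≤ T := by nlinarith
            nlinarith
          rw [mem_product, mem_Icc, mem_Icc, hM]
          exact ⟨⟨p1, Nat.le_floor (by nlinarith)⟩, p2, Nat.le_floor (by nlinarith)⟩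
      _ = 4 * N * ((∑ d ∈ Icc 1 M, 1 / (d : ℝ)) * ∑ l ∈ Icc 1 M, tau l ^ 4 / l) := by
          rw [← mul_sum, sum_product, sum_mul_sum]
      _ ≤ 4 * N * ((2 * L) * (2 * L) ^ 16) := by
          have e1 := sum_tau_pow_div_le 4 M
          have e2 : (1 + Real.log M) ^ 2 ^ 4 ≤ (2 * L) ^ 16 :=
            pow_le_pow_left₀ (by linarith) hlog 16
          have e3 : 0 ≤ ∑ l ∈ Icc 1 M, tau l ^ 4 / l := sum_nonneg fun l _ => by
            have := tau_nonneg l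
            positivity
          exact mul_le_mul_of_nonneg_left (mul_le_mul ((sum_one_div_le M).trans hlog)
            (e1.trans e2) e3 (by linarith)) (by linarith)
      _ = _ := by ring
  have h3 := h.sum_mul_cappedInv_le hT S hS
  refine le_of_sq_le_sq (h1.trans ?_) (by positivity)
  calc _ ≤ 4 * N * (2 * L) ^ 17 * (N * (L ^ 11 / R ^ 2)) := by
        refine mul_le_mul h2 h3 (sum_nonneg fun x hx => ?_) (by positivity)
        obtain ⟨p1, p2⟩ := hpos x hx
        exact mul_nonneg p1.le (cappedInv_pos (by positivity) _).le
    _ = N ^ 2 * (2 ^ 19 * L ^ 28 / R ^ 2) := by ring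
    _ ≤ N ^ 2 * (L ^ 30 / R ^ 2) := by
        gcongr
        rw [show L ^ 30 = L ^ 2 * L ^ 28 by ring]
        gcongr
        nlinarith
    _ = _ := by ring

end IsMinor

/-! ### Bilinear sums with a congruence condition, and sums of Type I -/

/-- The bilinear sum of `f(m) g(k) e(αmk)` over `m ∈ I`, `k ∈ J` with `A ≤ mk < B` and
`mk ≡ b (mod d)`. -/
noncomputable def bilinearSum (A B : ℕ) (α : ℝ) (b : ℤ) (d : ℕ) (I J : Finset ℕ) (f g : ℕ → ℂ) :
    ℂ :=
  ∑ m ∈ I, ∑ k ∈ J,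
    if (A ≤ m * k ∧ m * k < B) ∧ ((m * k : ℕ) : ℤ) ≡ b [ZMOD (d : ℤ)] then
      f m * g k * e (α * ((m * k : ℕ) : ℝ)) else 0

lemma coprime_of_modEq {b : ℤ} {d n : ℕ} (hd : Int.gcd (d : ℤ) b = 1)
    (h : (n : ℤ) ≡ b [ZMOD (d : ℤ)]) : Nat.Coprime d n := by
  obtain ⟨k, hk⟩ := h.dvd
  rw [← Nat.isCoprime_iff_coprime, show (n : ℤ) = b + d * (-k) by linarith]
  exact (Int.isCoprime_iff_gcd_eq_one.2 hd).add_mul_left_right _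

/-- Two solutions of `mk ≡ b (mod d)` with the same `m` are congruent, as `b` is a unit. -/
lemma modEq_of_mul_modEq {b : ℤ} {d m k k' : ℕ} (hd : Int.gcd (d : ℤ) b = 1)
    (h : ((m * k : ℕ) : ℤ) ≡ b [ZMOD (d : ℤ)]) (h' : ((m * k' : ℕ) : ℤ) ≡ b [ZMOD (d : ℤ)]) :
    k ≡ k' [MOD d] := by
  have h1 : m * k ≡ m * k' [MOD d] := Int.natCast_modEq_iff.1 (h.trans h'.symm)
  exact Nat.ModEq.cancel_left_of_coprime (coprime_of_modEq hd h).coprime_mul_right_right h1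

/-- Partial summation against a nondecreasing weight. -/
lemma norm_sum_mul_le_of_monotone (S : Finset ℕ) (g : ℕ → ℝ) (hg : Monotone g) (hg0 : 0 ≤ g 0)
    (z : ℕ → ℂ) {B : ℕ} (hB : ∀ k ∈ S, k ≤ B) {M : ℝ}
    (hM : ∀ j, ‖∑ k ∈ S.filter fun k => j ≤ k, z k‖ ≤ M) :
    ‖∑ k ∈ S, (g k : ℂ) * z k‖ ≤ g B * M := by
  have h1 : ∑ k ∈ S, (g k : ℂ) * z k = (g 0 : ℂ) * ∑ k ∈ S.filter (fun k => 0 ≤ k), z k +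
      ∑ j ∈ range B, ((g (j + 1) - g j : ℝ) : ℂ) * ∑ k ∈ S.filter (fun k => j + 1 ≤ k), z k := by
    simp_rw [sum_filter, mul_sum]
    rw [sum_comm, ← sum_add_distrib]
    refine sum_congr rfl fun k hk => ?_
    have h2 : ∑ j ∈ range B, ((g (j + 1) - g j : ℝ) : ℂ) * (if j + 1 ≤ k then z k else 0) =
        ((g k - g 0 : ℝ) : ℂ) * z k := by
      rw [← sum_range_sub, Complex.ofReal_sum, sum_mul]
      refine (sum_subset (range_mono (hB k hk)) fun j _ hj => ?_).symm.trans ?_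
      · rw [mem_range, not_lt] at hj
        rw [if_neg (by lia), mul_zero]
      · refine sum_congr rfl fun j hj => ?_
        rw [if_pos (Nat.succ_le_of_lt (mem_range.1 hj))]
    rw [h2, if_pos (Nat.zero_le k)]
    push_cast
    ring
  rw [h1]
  refine (norm_add_le _ _).trans ?_
  have h3 : ‖∑ j ∈ range B, ((g (j + 1) - g j : ℝ) : ℂ) *
      ∑ k ∈ S.filter (fun k => j + 1 ≤ k), z k‖ ≤ (g B - g 0) * M := by
    rw [← sum_range_sub, sum_mul]
    refine (norm_sum_le _ _).trans (sum_le_sum fun j _ => ?_)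
    have h4 : 0 ≤ g (j + 1) - g j := sub_nonneg.2 (hg (Nat.le_succ j))
    rw [norm_mul, Complex.norm_real, Real.norm_of_nonneg h4]
    exact mul_le_mul_of_nonneg_left (hM _) h4
  rw [norm_mul, Complex.norm_real, Real.norm_of_nonneg hg0]
  have h5 := mul_le_mul_of_nonneg_left (hM 0) hg0
  linarith

namespace IsMinor

variable {α N R L : ℝ} {q : ℕ}

lemma norm_typeI_inner_le {A B d m : ℕ} {b : ℤ} (hAB : (B : ℝ) - A ≤ 2 * N) (hd : 1 ≤ d)
    (hm : 1 ≤ m) (hdb : Int.gcd (d : ℤ) b = 1) (hdm : (d * m : ℝ) ≤ N) (g : ℕ → ℝ)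
    (hg : Monotone g) (hg0 : 0 ≤ g 0) :
    ‖∑ k ∈ Ico 1 B, if (A ≤ m * k ∧ m * k < B) ∧ ((m * k : ℕ) : ℤ) ≡ b [ZMOD (d : ℤ)] then
      (g k : ℂ) * e (α * ((m * k : ℕ) : ℝ)) else 0‖ ≤
      g B * cappedInv (4 * N / ((d * m : ℕ) : ℝ)) (α * ((d * m : ℕ) : ℝ)) := by
  have hd0 : (1 : ℝ) ≤ d := by exact_mod_cast hd
  have hm0 : (1 : ℝ) ≤ m := by exact_mod_cast hm
  have hN : 1 ≤ N := le_trans (by nlinarith) hdm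
  rw [← sum_filter]
  refine norm_sum_mul_le_of_monotone _ g hg hg0 _
    (fun k hk => (mem_Ico.1 (mem_filter.1 hk).1).2.le) fun j => ?_
  rw [filter_filter]
  rcases le_or_gt A B with hAB' | hAB'
  swap
  · rw [filter_false_of_mem, sum_empty, norm_zero]
    · exact (cappedInv_pos (by push_cast; positivity) _).le
    · rintro k _ ⟨⟨h, _⟩, _⟩
      lia
  have hAB0 : (0 : ℝ) ≤ B - A := by
    rw [sub_nonneg]
    exact_mod_cast hAB'
  have h1 := norm_sum_e_progression_le ((Ico 1 B).filter fun k =>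
      ((A ≤ m * k ∧ m * k < B) ∧ ((m * k : ℕ) : ℤ) ≡ b [ZMOD (d : ℤ)]) ∧ j ≤ k) d hd
      ((B - A) / m) (α * m) (by positivity) ?_ ?_ (X := 4 * N / ((d * m : ℕ) : ℝ)) ?_
  · have h2 : ∀ k : ℕ, α * m * k = α * ((m * k : ℕ) : ℝ) := fun k => by
      push_cast
      ring
    have h3 : α * m * d = α * ((d * m : ℕ) : ℝ) := by
      push_cast
      ring
    rw [h3] at h1
    simp_rw [h2] at h1
    exact h1
  · intro k hk k' hk' _
    obtain ⟨_, ⟨⟨h2, _⟩, h3⟩, _⟩ := mem_filter.1 hk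
    obtain ⟨_, ⟨⟨_, h2'⟩, h3'⟩, _⟩ := mem_filter.1 hk'
    refine ⟨modEq_of_mul_modEq hdb h3 h3', ?_⟩
    rw [le_div_iff₀ (by linarith)]
    have e1 : (A : ℝ) ≤ m * k := by exact_mod_cast h2
    have e2 : (m * k' : ℝ) ≤ B := by exact_mod_cast h2'.le
    linarith
  · intro k hk k' hk' t hkt htk htm
    obtain ⟨h1, ⟨⟨h2, _⟩, h3⟩, h4⟩ := mem_filter.1 hk
    obtain ⟨h1', ⟨⟨_, h2'⟩, _⟩, _⟩ := mem_filter.1 hk'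
    rw [mem_Ico] at h1 h1'
    refine mem_filter.2 ⟨mem_Ico.2 ⟨by lia, by lia⟩, ⟨⟨⟨?_, ?_⟩, ?_⟩, by lia⟩⟩
    · exact h2.trans (Nat.mul_le_mul_left m hkt)
    · exact lt_of_le_of_lt (Nat.mul_le_mul_left m htk) h2'
    · exact (Int.natCast_modEq_iff.2 (htm.mul_left m)).trans h3
  · push_cast
    rw [div_div, mul_comm (m : ℝ) d, div_add_one (by positivity)]
    gcongr
    linarith

/-- Type I sums: the variable carrying the smooth weight `g` is summed over a progression, and the
product of the modulus and the other variable is an integer counted with a divisor weight. -/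
lemma sum_norm_typeI_le (h : IsMinor α N R L q) {T : ℝ} (hT : T * R ^ 20 ≤ N) {A B : ℕ} {b : ℤ}
    (hAB : (B : ℝ) - A ≤ 2 * N) (S I : Finset ℕ) (hS : ∀ d ∈ S, 1 ≤ d ∧ Int.gcd (d : ℤ) b = 1)
    (hI : ∀ m ∈ I, 1 ≤ m) (hSI : ∀ d ∈ S, ∀ m ∈ I, (d * m : ℝ) ≤ T) (f : ℕ → ℂ) {F : ℝ}
    (hF : ∀ m ∈ I, ‖f m‖ ≤ F) (hF0 : 0 ≤ F) (g : ℕ → ℝ) (hg : Monotone g) (hg0 : 0 ≤ g 0) :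
    ∑ d ∈ S, ‖bilinearSum A B α b d I (Ico 1 B) f fun k => (g k : ℂ)‖ ≤
      F * g B * (N * (L ^ 15 / R)) := by
  have hN := h.one_le_N
  have hR20 : (1 : ℝ) ≤ R ^ 20 := one_le_pow₀ h.one_le_R
  have hgB : 0 ≤ g B := hg0.trans (hg (Nat.zero_le B))
  set c : ℕ → ℝ := fun n => cappedInv (4 * N / (n : ℝ)) (α * (n : ℝ)) with hc
  have h1 : ∀ d ∈ S, ‖bilinearSum A B α b d I (Ico 1 B) f fun k => (g k : ℂ)‖ ≤
      ∑ m ∈ I, F * g B * c (d * m) := by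
    intro d hd
    refine (norm_sum_le _ _).trans (sum_le_sum fun m hm => ?_)
    have e1 : ∀ k : ℕ, (if (A ≤ m * k ∧ m * k < B) ∧ ((m * k : ℕ) : ℤ) ≡ b [ZMOD (d : ℤ)] then
        f m * (g k : ℂ) * e (α * ((m * k : ℕ) : ℝ)) else 0) = f m *
        (if (A ≤ m * k ∧ m * k < B) ∧ ((m * k : ℕ) : ℤ) ≡ b [ZMOD (d : ℤ)] then
        (g k : ℂ) * e (α * ((m * k : ℕ) : ℝ)) else 0) := fun k => by
      split_ifs
      · ring
      · ring
    simp_rw [e1]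
    rw [← mul_sum, norm_mul, mul_assoc]
    have hdm := hSI d hd m hm
    have hd1 : (1 : ℝ) ≤ d := by exact_mod_cast (hS d hd).1
    have hm1 : (1 : ℝ) ≤ m := by exact_mod_cast hI m hm
    have hdm1 : (1 : ℝ) ≤ d * m := by nlinarith
    refine mul_le_mul (hF m hm) (norm_typeI_inner_le hAB (hS d hd).1 (hI m hm) (hS d hd).2 ?_ g
      hg hg0) (norm_nonneg _) hF0
    nlinarith
  have hc0 : ∀ n : ℕ, 1 ≤ n → 0 ≤ c n := fun n hn => by
    have : (1 : ℝ) ≤ n := by exact_mod_cast hn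
    exact (cappedInv_pos (by positivity) _).le
  have h2 : ∑ x ∈ S ×ˢ I, c (x.1 * x.2) ≤ ∑ n ∈ Icc 1 ⌊T⌋₊, tau n ^ 2 * c n := by
    refine sum_comp_le_sum_tau_sq (S ×ˢ I) (Icc 1 ⌊T⌋₊) (fun x => x.1 * x.2) (fun x => x.1)
      (fun x => x.2) ?_ ?_ (fun x _ => ⟨x.2, rfl⟩) (fun x _ => ⟨x.1, mul_comm _ _⟩)
      (fun x _ y _ _ h1 h2 => Prod.ext h1 h2) c fun n hn => hc0 n (mem_Icc.1 hn).1
    · intro x hx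
      obtain ⟨hx1, hx2⟩ := mem_product.1 hx
      refine mem_Icc.2 ⟨Nat.mul_pos (hS _ hx1).1 (hI _ hx2), Nat.le_floor ?_⟩
      push_cast
      exact hSI _ hx1 _ hx2
    · intro x hx
      obtain ⟨hx1, hx2⟩ := mem_product.1 hx
      exact (Nat.mul_pos (hS _ hx1).1 (hI _ hx2)).ne'
  have h3 := h.sum_tau_sq_mul_cappedInv_le hT ({1} ×ˢ Icc 1 ⌊T⌋₊) ?_
  · rw [sum_product, sum_singleton] at h3
    simp only [Nat.cast_one, one_pow, one_mul] at h3
    calc _ ≤ ∑ d ∈ S, ∑ m ∈ I, F * g B * c (d * m) := sum_le_sum h1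
      _ = F * g B * ∑ x ∈ S ×ˢ I, c (x.1 * x.2) := by
          rw [mul_sum, sum_product]
      _ ≤ _ := by
          have := mul_nonneg hF0 hgB
          gcongr
          exact h2.trans h3
  · intro x hx
    obtain ⟨hx1, hx2⟩ := mem_product.1 hx
    rw [mem_singleton] at hx1
    obtain ⟨hx2, hx3⟩ := mem_Icc.1 hx2
    rw [hx1]
    refine ⟨le_rfl, hx2, ?_⟩
    rw [Nat.cast_one, one_pow, one_mul]
    exact (Nat.le_floor_iff' (by lia)).1 hx3

end IsMinor

/-! ### Sums of Type II -/

lemma sum_le_sum_of_injOn {ι κ : Type*} (s : Finset ι) (t : Finset κ) (φ : ι → κ) (F : κ → ℝ)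
    (hF : ∀ k ∈ t, 0 ≤ F k) (hφ : ∀ x ∈ s, φ x ∈ t)
    (hinj : ∀ x ∈ s, ∀ y ∈ s, φ x = φ y → x = y) : ∑ x ∈ s, F (φ x) ≤ ∑ k ∈ t, F k := by
  classical
  rw [← sum_image (f := F) (g := φ) fun x hx y hy h => hinj x hx y hy h]
  exact sum_le_sum_of_subset_of_nonneg (image_subset_iff.2 hφ) fun k hk _ => hF k hk

/-- A sum over `n' ≡ n (mod d)` in a dyadic range, as a sum over the quotients `|n' - n|/d`. -/
lemma sum_modEq_le {M n d : ℕ} (hd : 1 ≤ d) (hn : n ∈ Ico M (2 * M)) (F : ℕ → ℝ)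
    (hF : ∀ k, 0 ≤ F k) :
    ∑ n' ∈ Ico M (2 * M), (if n ≡ n' [MOD d] then F (((n : ℤ) - n').natAbs / d) else 0) ≤
      F 0 + 2 * ∑ k ∈ Icc 1 (M / d), F k := by
  rw [mem_Ico] at hn
  set S := (Ico M (2 * M)).filter fun n' => n ≡ n' [MOD d] with hS
  have key : ∀ n' ∈ S, n' ≠ n → (d ∣ ((n : ℤ) - n').natAbs) ∧
      ((n : ℤ) - n').natAbs / d ∈ Icc 1 (M / d) := by
    intro n' hn' hne
    obtain ⟨h1, h2⟩ := mem_filter.1 hn'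
    rw [mem_Ico] at h1
    have h3 : d ∣ ((n : ℤ) - n').natAbs := by
      rw [← Int.natCast_dvd]
      have := (Int.natCast_modEq_iff.2 h2).dvd
      rw [← neg_sub]
      exact this.neg_right
    refine ⟨h3, mem_Icc.2 ⟨?_, Nat.div_le_div_right (by lia)⟩⟩
    exact Nat.div_pos (Nat.le_of_dvd (by lia) h3) hd
  have half : ∀ U ⊆ S, (∀ x ∈ U, ∀ y ∈ U, ((n : ℤ) - x).natAbs = ((n : ℤ) - y).natAbs → x = y) →
      (∀ x ∈ U, x ≠ n) →
      ∑ n' ∈ U, F (((n : ℤ) - n').natAbs / d) ≤ ∑ k ∈ Icc 1 (M / d), F k := by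
    intro U hU hinj hne
    refine sum_le_sum_of_injOn U _ (fun n' : ℕ => ((n : ℤ) - n').natAbs / d) F (fun k _ => hF k)
      (fun x hx => (key x (hU hx) (hne x hx)).2) fun x hx y hy hxy => hinj x hx y hy ?_
    rw [← Nat.div_mul_cancel (key x (hU hx) (hne x hx)).1, hxy,
      Nat.div_mul_cancel (key y (hU hy) (hne y hy)).1]
  have h1 := half (S.filter fun n' => n' < n) (filter_subset _ _)
    (fun x hx y hy h => by
      have := (mem_filter.1 hx).2
      have := (mem_filter.1 hy).2
      lia) fun x hx => ((mem_filter.1 hx).2).ne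
  have h2 := half (S.filter fun n' => n < n') (filter_subset _ _)
    (fun x hx y hy h => by
      have := (mem_filter.1 hx).2
      have := (mem_filter.1 hy).2
      lia) fun x hx => ((mem_filter.1 hx).2).ne'
  have hnS : n ∈ S := mem_filter.2 ⟨mem_Ico.2 hn, Nat.ModEq.refl n⟩
  have hsplit : S = insert n ((S.filter fun n' => n' < n) ∪ S.filter fun n' => n < n') := by
    ext x
    simp only [mem_insert, mem_union, mem_filter]
    constructor
    · intro hx
      rcases lt_trichotomy x n with h | h | h
      · exact Or.inr (Or.inl ⟨hx, h⟩)
      · exact Or.inl h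
      · exact Or.inr (Or.inr ⟨hx, h⟩)
    · rintro (rfl | h | h)
      · exact hnS
      · exact h.1
      · exact h.1
  rw [← sum_filter, ← hS, hsplit, sum_insert (by simp), sum_union]
  · simp only [sub_self, Int.natAbs_zero, Nat.zero_div]
    linarith
  · rw [disjoint_left]
    intro x hx hy
    have := (mem_filter.1 hx).2
    have := (mem_filter.1 hy).2
    lia

/-- Duality: a mean square is bounded through the correlations of the functions involved. The
coefficients of the second copy are removed by `2|uv| ≤ |u|² + |v|²`. -/
lemma sum_norm_sum_sq_le {ι κ : Type*} (I : Finset ι) (T : Finset κ) (γ : κ → ℂ)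
    (φ : κ → ι → ℂ) (Q : κ → κ → ℝ)
    (hQ : ∀ i ∈ T, ∀ j ∈ T, ‖∑ m ∈ I, φ i m * (starRingEnd ℂ) (φ j m)‖ ≤ Q i j) :
    ∑ m ∈ I, ‖∑ i ∈ T, γ i * φ i m‖ ^ 2 ≤ ∑ i ∈ T, ‖γ i‖ ^ 2 * ∑ j ∈ T, Q i j := by
  set P : κ → κ → ℂ := fun i j => ∑ m ∈ I, φ i m * (starRingEnd ℂ) (φ j m) with hP
  have hsymm : ∀ i j, ‖P i j‖ = ‖P j i‖ := by
    intro i j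
    rw [← Complex.norm_conj (P j i), hP]
    simp only [map_sum, map_mul, Complex.conj_conj]
    simp_rw [mul_comm]
  have h1 : ((∑ m ∈ I, ‖∑ i ∈ T, γ i * φ i m‖ ^ 2 : ℝ) : ℂ) =
      ∑ i ∈ T, ∑ j ∈ T, γ i * (starRingEnd ℂ) (γ j) * P i j := by
    rw [Complex.ofReal_sum]
    have h2 : ∀ m ∈ I, ((‖∑ i ∈ T, γ i * φ i m‖ ^ 2 : ℝ) : ℂ) =
        ∑ i ∈ T, ∑ j ∈ T, γ i * (starRingEnd ℂ) (γ j) * (φ i m * (starRingEnd ℂ) (φ j m)) := by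
      intro m _
      rw [Complex.sq_norm, ← Complex.mul_conj, map_sum, sum_mul_sum]
      refine sum_congr rfl fun i _ => sum_congr rfl fun j _ => ?_
      rw [map_mul]
      ring
    rw [sum_congr rfl h2, sum_comm]
    refine sum_congr rfl fun i _ => ?_
    rw [sum_comm]
    refine sum_congr rfl fun j _ => ?_
    rw [hP, mul_sum]
  have h3 : ∑ m ∈ I, ‖∑ i ∈ T, γ i * φ i m‖ ^ 2 ≤ ∑ i ∈ T, ∑ j ∈ T, ‖γ i‖ * ‖γ j‖ * ‖P i j‖ := by
    have h4 : ∑ m ∈ I, ‖∑ i ∈ T, γ i * φ i m‖ ^ 2 =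
        ‖((∑ m ∈ I, ‖∑ i ∈ T, γ i * φ i m‖ ^ 2 : ℝ) : ℂ)‖ := by
      rw [Complex.norm_real, Real.norm_of_nonneg (sum_nonneg fun _ _ => sq_nonneg _)]
    rw [h4, h1]
    refine (norm_sum_le _ _).trans (sum_le_sum fun i _ => (norm_sum_le _ _).trans
      (sum_le_sum fun j _ => ?_))
    rw [norm_mul, norm_mul, Complex.norm_conj]
  have h5 : ∑ i ∈ T, ∑ j ∈ T, ‖γ i‖ * ‖γ j‖ * ‖P i j‖ ≤
      ∑ i ∈ T, ∑ j ∈ T, (‖γ i‖ ^ 2 * ‖P i j‖ / 2 + ‖γ j‖ ^ 2 * ‖P j i‖ / 2) := by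
    refine sum_le_sum fun i _ => sum_le_sum fun j _ => ?_
    rw [hsymm j i]
    nlinarith [mul_nonneg (sq_nonneg (‖γ i‖ - ‖γ j‖)) (norm_nonneg (P i j))]
  have h6 : ∑ i ∈ T, ∑ j ∈ T, (‖γ i‖ ^ 2 * ‖P i j‖ / 2 + ‖γ j‖ ^ 2 * ‖P j i‖ / 2) =
      ∑ i ∈ T, ‖γ i‖ ^ 2 * ∑ j ∈ T, ‖P i j‖ := by
    simp_rw [sum_add_distrib]
    rw [sum_comm (f := fun i j => ‖γ j‖ ^ 2 * ‖P j i‖ / 2), ← sum_add_distrib]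
    refine sum_congr rfl fun i _ => ?_
    rw [← sum_add_distrib, mul_sum]
    refine sum_congr rfl fun j _ => ?_
    ring
  refine h3.trans (h5.trans (h6.le.trans (sum_le_sum fun i hi => ?_)))
  exact mul_le_mul_of_nonneg_left (sum_le_sum fun j hj => hQ i hi j hj) (sq_nonneg _)

/-- The inner function of a Type II sum: `e(αmn)` restricted by `A ≤ mn < B`,
`mn ≡ b (mod d)`. -/
noncomputable def typeIIPhase (A B : ℕ) (α : ℝ) (b : ℤ) (d n m : ℕ) : ℂ :=
  if (A ≤ m * n ∧ m * n < B) ∧ ((m * n : ℕ) : ℤ) ≡ b [ZMOD (d : ℤ)] then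
    e (α * ((m * n : ℕ) : ℝ)) else 0

/-- Correlations of the inner functions: the common modulus `d₁` forces `n ≡ n' (mod d₁)`, and then
`m` runs through a segment of a progression modulo `d₁ [d₂, d₂']`. -/
lemma norm_sum_typeIIPhase_le {A B : ℕ} {α : ℝ} {b : ℤ} {M d₁ d₂ d₂' n n' : ℕ} {Z : ℝ}
    (hd₁ : 1 ≤ d₁) (hd₂ : 1 ≤ d₂) (hd₂' : 1 ≤ d₂') (hb : Int.gcd ((d₁ * d₂ : ℕ) : ℤ) b = 1)
    (hb' : Int.gcd ((d₁ * d₂' : ℕ) : ℤ) b = 1) (hM : ((d₁ * d₂.lcm d₂' : ℕ) : ℝ) ≤ Z)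
    (hZ : Z ≤ M) :
    ‖∑ m ∈ Ico M (2 * M), typeIIPhase A B α b (d₁ * d₂) n m *
        (starRingEnd ℂ) (typeIIPhase A B α b (d₁ * d₂') n' m)‖ ≤
      if n ≡ n' [MOD d₁] then cappedInv (2 * M / ((d₁ * d₂.lcm d₂' : ℕ) : ℝ))
        (α * ((d₁ ^ 2 * ((((n : ℤ) - n').natAbs / d₁) * d₂.lcm d₂') : ℕ) : ℝ)) else 0 := by
  set r := d₂.lcm d₂' with hr
  have hr1 : 1 ≤ r := Nat.lcm_pos hd₂ hd₂'
  have hv1 : 1 ≤ d₁ * r := Nat.mul_pos hd₁ hr1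
  have hv0 : (1 : ℝ) ≤ ((d₁ * r : ℕ) : ℝ) := by exact_mod_cast hv1
  set S := (Ico M (2 * M)).filter fun m =>
    ((A ≤ m * n ∧ m * n < B) ∧ ((m * n : ℕ) : ℤ) ≡ b [ZMOD ((d₁ * d₂ : ℕ) : ℤ)]) ∧
    ((A ≤ m * n' ∧ m * n' < B) ∧ ((m * n' : ℕ) : ℤ) ≡ b [ZMOD ((d₁ * d₂' : ℕ) : ℤ)]) with hS
  have h1 : ∑ m ∈ Ico M (2 * M), typeIIPhase A B α b (d₁ * d₂) n m *
        (starRingEnd ℂ) (typeIIPhase A B α b (d₁ * d₂') n' m) =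
      ∑ m ∈ S, e (α * ((n : ℝ) - n') * m) := by
    rw [hS, sum_filter]
    refine sum_congr rfl fun m _ => ?_
    unfold typeIIPhase
    by_cases c1 : (A ≤ m * n ∧ m * n < B) ∧ ((m * n : ℕ) : ℤ) ≡ b [ZMOD ((d₁ * d₂ : ℕ) : ℤ)]
    · by_cases c2 : (A ≤ m * n' ∧ m * n' < B) ∧
          ((m * n' : ℕ) : ℤ) ≡ b [ZMOD ((d₁ * d₂' : ℕ) : ℤ)]
      · rw [if_pos c1, if_pos c2, if_pos ⟨c1, c2⟩, conj_e, ← e_add]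
        congr 1
        push_cast
        ring
      · rw [if_neg c2, map_zero, mul_zero, if_neg fun h => c2 h.2]
    · rw [if_neg c1, zero_mul, if_neg fun h => c1 h.1]
  rw [h1]
  have hdvd : ∀ {d d' : ℕ} {x : ℤ}, x ≡ b [ZMOD ((d * d' : ℕ) : ℤ)] → x ≡ b [ZMOD (d : ℤ)] := by
    intro d d' x hx
    refine hx.of_dvd ?_
    push_cast
    exact dvd_mul_right _ _
  have hb₁ : Int.gcd (d₁ : ℤ) b = 1 := by
    rw [← Int.isCoprime_iff_gcd_eq_one] at hb ⊢
    push_cast at hb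
    exact hb.of_mul_left_left
  split_ifs with hmod
  swap
  · refine le_of_eq ?_
    rw [hS, filter_false_of_mem, sum_empty, norm_zero]
    rintro m _ ⟨⟨_, h2⟩, _, h3⟩
    exact hmod (modEq_of_mul_modEq hb₁ (hdvd h2) (hdvd h3))
  · have hdiv : d₁ ∣ ((n : ℤ) - n').natAbs := by
      rw [← Int.natCast_dvd]
      have := (Int.natCast_modEq_iff.2 hmod).dvd
      rw [← neg_sub]
      exact this.neg_right
    have h2 := norm_sum_e_progression_le S (d₁ * r) hv1 M (α * ((n : ℝ) - n')) (by positivity)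
      ?_ ?_ (X := 2 * M / ((d₁ * r : ℕ) : ℝ)) ?_
    · refine h2.trans (le_of_eq ?_)
      have h3 : ((d₁ ^ 2 * ((((n : ℤ) - n').natAbs / d₁) * r) : ℕ) : ℝ) =
          |(n : ℝ) - n'| * ((d₁ * r : ℕ) : ℝ) := by
        obtain ⟨k, hk⟩ := hdiv
        have h4 : |(n : ℝ) - n'| = ((d₁ * k : ℕ) : ℝ) := by
          rw [← hk, Nat.cast_natAbs]
          push_cast
          rfl
        rw [h4, hk, Nat.mul_div_cancel_left k hd₁]
        push_cast
        ring
      rw [h3]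
      rcases abs_choice ((n : ℝ) - n') with h | h
      · rw [h]
        congr 1
        ring
      · rw [h, ← cappedInv_neg]
        congr 1
        ring
    · intro m hm m' hm' _
      obtain ⟨h3, ⟨_, h4⟩, _, h5⟩ := mem_filter.1 hm
      obtain ⟨h3', ⟨_, h4'⟩, _, h5'⟩ := mem_filter.1 hm'
      rw [mem_Ico] at h3 h3'
      constructor
      · have e1 : m ≡ m' [MOD d₁ * d₂] := by
          rw [mul_comm m] at h4
          rw [mul_comm m'] at h4'
          exact modEq_of_mul_modEq hb h4 h4'
        have e2 : m ≡ m' [MOD d₁ * d₂'] := by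
          rw [mul_comm m] at h5
          rw [mul_comm m'] at h5'
          exact modEq_of_mul_modEq hb' h5 h5'
        rw [hr, ← Nat.lcm_mul_left, ← Int.natCast_modEq_iff]
        rw [← Int.natCast_modEq_iff] at e1 e2
        have e3 := Int.modEq_and_modEq_iff_modEq_lcm.1 ⟨e1, e2⟩
        exact e3
      · have e1 : (m' : ℝ) ≤ 2 * M := by exact_mod_cast h3'.2.le
        have e2 : (M : ℝ) ≤ m := by exact_mod_cast h3.1
        linarith
    · intro m hm m' hm' t hmt htm ht
      obtain ⟨h3, ⟨h6, h4⟩, h7, h5⟩ := mem_filter.1 hm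
      obtain ⟨h3', ⟨h6', _⟩, h7', _⟩ := mem_filter.1 hm'
      rw [mem_Ico] at h3 h3'
      have hcong : ∀ {x y : ℕ}, y ∣ r → ((m * x : ℕ) : ℤ) ≡ b [ZMOD ((d₁ * y : ℕ) : ℤ)] →
          ((t * x : ℕ) : ℤ) ≡ b [ZMOD ((d₁ * y : ℕ) : ℤ)] := by
        intro x y hy hx
        have e1 : t ≡ m [MOD d₁ * y] := ht.of_dvd (Nat.mul_dvd_mul_left d₁ hy)
        exact (Int.natCast_modEq_iff.2 (e1.mul_right x)).trans hx
      refine mem_filter.2 ⟨mem_Ico.2 ⟨by lia, by lia⟩, ⟨⟨?_, ?_⟩, hcong (Nat.dvd_lcm_left _ _) h4⟩,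
        ⟨?_, ?_⟩, hcong (Nat.dvd_lcm_right _ _) h5⟩
      · exact h6.1.trans (Nat.mul_le_mul_right n hmt)
      · exact lt_of_le_of_lt (Nat.mul_le_mul_right n htm) h6'.2
      · exact h7.1.trans (Nat.mul_le_mul_right n' hmt)
      · exact lt_of_le_of_lt (Nat.mul_le_mul_right n' htm) h7'.2
    · rw [div_add_one (by linarith)]
      gcongr
      linarith

lemma exists_norm_le_one_mul_eq_norm (z : ℂ) : ∃ θ : ℂ, ‖θ‖ ≤ 1 ∧ θ * z = (‖z‖ : ℂ) := by
  rcases eq_or_ne z 0 with rfl | hz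
  · exact ⟨0, by simp, by simp⟩
  · have hz' : (‖z‖ : ℂ) ≠ 0 := by exact_mod_cast norm_ne_zero_iff.2 hz
    refine ⟨(starRingEnd ℂ) z / ‖z‖, ?_, ?_⟩
    · rw [norm_div, Complex.norm_conj, Complex.norm_real, norm_norm, div_self]
      exact norm_ne_zero_iff.2 hz
    · rw [div_mul_eq_mul_div, Complex.conj_mul', sq, mul_div_assoc, div_self hz', mul_one]

lemma bilinearSum_eq_sum_typeIIPhase (A B : ℕ) (α : ℝ) (b : ℤ) (d : ℕ) (I J : Finset ℕ)
    (f g : ℕ → ℂ) : bilinearSum A B α b d I J f g =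
      ∑ m ∈ I, f m * ∑ n ∈ J, g n * typeIIPhase A B α b d n m := by
  unfold bilinearSum typeIIPhase
  refine sum_congr rfl fun m _ => ?_
  rw [mul_sum]
  refine sum_congr rfl fun n _ => ?_
  split_ifs
  · ring
  · ring

/-- Cauchy–Schwarz over `(d₁, m)`. The weight `d₁` makes the sum over all `d₁` behave like one
over a dyadic range. -/
lemma sq_sum_norm_bilinearSum_le (A B : ℕ) (α : ℝ) (b : ℤ) (𝒟 I J : Finset ℕ)
    (E : ℕ → Finset ℕ) (f g : ℕ → ℂ) (h𝒟 : ∀ d₁ ∈ 𝒟, 1 ≤ d₁) :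
    ∃ θ : ℕ → ℕ → ℂ, (∀ d₁ d₂, ‖θ d₁ d₂‖ ≤ 1) ∧
    (∑ d₁ ∈ 𝒟, ∑ d₂ ∈ E d₁, ‖bilinearSum A B α b (d₁ * d₂) I J f g‖) ^ 2 ≤
      ((∑ d₁ ∈ 𝒟, 1 / (d₁ : ℝ)) * ∑ m ∈ I, ‖f m‖ ^ 2) *
      ∑ d₁ ∈ 𝒟, (d₁ : ℝ) * ∑ m ∈ I, ‖∑ x ∈ E d₁ ×ˢ J,
        (θ d₁ x.1 * g x.2) * typeIIPhase A B α b (d₁ * x.1) x.2 m‖ ^ 2 := by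
  choose θ hθ hθ' using fun d₁ d₂ : ℕ =>
    exists_norm_le_one_mul_eq_norm (bilinearSum A B α b (d₁ * d₂) I J f g)
  refine ⟨θ, hθ, ?_⟩
  set V : ℕ → ℕ → ℂ := fun d₁ m => ∑ x ∈ E d₁ ×ˢ J,
    (θ d₁ x.1 * g x.2) * typeIIPhase A B α b (d₁ * x.1) x.2 m with hV
  have h1 : ∑ d₁ ∈ 𝒟, ∑ d₂ ∈ E d₁, ‖bilinearSum A B α b (d₁ * d₂) I J f g‖ ≤
      ∑ y ∈ 𝒟 ×ˢ I, ‖f y.2‖ * ‖V y.1 y.2‖ := by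
    rw [sum_product]
    refine sum_le_sum fun d₁ _ => ?_
    have h2 : ((∑ d₂ ∈ E d₁, ‖bilinearSum A B α b (d₁ * d₂) I J f g‖ : ℝ) : ℂ) =
        ∑ m ∈ I, f m * V d₁ m := by
      rw [Complex.ofReal_sum]
      simp_rw [← hθ', bilinearSum_eq_sum_typeIIPhase, mul_sum]
      rw [sum_comm]
      refine sum_congr rfl fun m _ => ?_
      simp only [hV]
      rw [sum_product, mul_sum]
      refine sum_congr rfl fun d₂ _ => ?_
      rw [mul_sum]
      refine sum_congr rfl fun n _ => ?_
      ring
    calc ∑ d₂ ∈ E d₁, ‖bilinearSum A B α b (d₁ * d₂) I J f g‖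
        = ‖((∑ d₂ ∈ E d₁, ‖bilinearSum A B α b (d₁ * d₂) I J f g‖ : ℝ) : ℂ)‖ := by
          rw [Complex.norm_real, Real.norm_of_nonneg (sum_nonneg fun _ _ => norm_nonneg _)]
      _ ≤ _ := by
          rw [h2]
          refine (norm_sum_le _ _).trans (sum_le_sum fun m _ => ?_)
          rw [norm_mul]
  have h3 : (∑ y ∈ 𝒟 ×ˢ I, ‖f y.2‖ * ‖V y.1 y.2‖) ^ 2 ≤
      (∑ y ∈ 𝒟 ×ˢ I, 1 / (y.1 : ℝ) * ‖f y.2‖ ^ 2) *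
        ∑ y ∈ 𝒟 ×ˢ I, (y.1 : ℝ) * ‖V y.1 y.2‖ ^ 2 := by
    refine sum_sq_le_sum_mul_sum_of_sq_le_mul _ (fun y _ => by positivity)
      (fun y _ => by positivity) fun y hy => le_of_eq ?_
    have : (y.1 : ℝ) ≠ 0 := by
      have := h𝒟 _ (mem_product.1 hy).1
      positivity
    field_simp
  refine (pow_le_pow_left₀ (sum_nonneg fun _ _ => sum_nonneg fun _ _ => norm_nonneg _) h1 2).trans
    (h3.trans (le_of_eq ?_))
  rw [sum_product, sum_product]
  congr 1
  · rw [sum_mul_sum]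
  · refine sum_congr rfl fun d₁ _ => ?_
    rw [mul_sum]

namespace IsMinor

variable {α N R L : ℝ} {q : ℕ}

lemma sum_one_div_lcm_le (h : IsMinor α N R L q) (E : Finset ℕ) {Z : ℝ} (hZ : Z ≤ N)
    (hE : ∀ d ∈ E, 1 ≤ d) (hEZ : ∀ d ∈ E, ∀ d' ∈ E, ((d.lcm d' : ℕ) : ℝ) ≤ Z) :
    ∑ x ∈ E ×ˢ E, 1 / ((x.1.lcm x.2 : ℕ) : ℝ) ≤ 16 * L ^ 4 := by
  have hN := h.one_le_N
  set K := ⌊N⌋₊ with hK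
  have hK1 : (1 : ℝ) ≤ K := by exact_mod_cast Nat.one_le_floor_iff _ |>.2 hN
  have hKN : (K : ℝ) ≤ N := Nat.floor_le (by linarith)
  have hlog := h.one_add_log_le (x := K) (by linarith) (by linarith)
  have hlog0 := Real.log_nonneg hK1
  have hlcm : ∀ x ∈ E ×ˢ E, 1 ≤ x.1.lcm x.2 := fun x hx =>
    Nat.lcm_pos (hE _ (mem_product.1 hx).1) (hE _ (mem_product.1 hx).2)
  have h1 := sum_comp_le_sum_tau_sq (E ×ˢ E) (Icc 1 K) (fun x => x.1.lcm x.2) (fun x => x.1)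
    (fun x => x.2) (fun x hx => mem_Icc.2 ⟨hlcm x hx, Nat.le_floor
      ((hEZ _ (mem_product.1 hx).1 _ (mem_product.1 hx).2).trans hZ)⟩)
    (fun x hx => (Nat.one_le_iff_ne_zero.1 (hlcm x hx)))
    (fun x _ => Nat.dvd_lcm_left _ _) (fun x _ => Nat.dvd_lcm_right _ _)
    (fun x _ y _ _ h1 h2 => Prod.ext h1 h2) (fun n => 1 / (n : ℝ)) fun n _ => by positivity
  refine h1.trans ?_
  have h2 := sum_tau_pow_div_le 2 K
  have h3 : (1 + Real.log K) ^ 2 ^ 2 ≤ (2 * L) ^ 4 := pow_le_pow_left₀ (by linarith) hlog 4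
  calc _ = ∑ m ∈ Icc 1 K, tau m ^ 2 / m := sum_congr rfl fun m _ => by ring
    _ ≤ (2 * L) ^ 4 := h2.trans h3
    _ = _ := by ring

/-- The mean square over `m` for a fixed `d₁`: a diagonal term and the sum over `l = k [d₂, d₂']`,
where `k d₁` is the difference of the two inner variables. -/
lemma sum_norm_sq_typeII_le (h : IsMinor α N R L q) {A B M M' d₁ : ℕ} {b : ℤ} (hM : 1 ≤ M)
    (hMM : (M * M' : ℝ) ≤ 2 * N) {Z : ℝ} (hZM : Z ≤ M) (hZN : Z ≤ N) (hd₁ : 1 ≤ d₁)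
    (E : Finset ℕ) (hE : ∀ d₂ ∈ E, 1 ≤ d₂ ∧ (d₁ * d₂ ^ 2 : ℝ) ≤ Z ∧
      Int.gcd ((d₁ * d₂ : ℕ) : ℤ) b = 1) (θ g : ℕ → ℂ) (hθ : ∀ d, ‖θ d‖ ≤ 1) :
    ∑ m ∈ Ico M (2 * M), ‖∑ x ∈ E ×ˢ Ico M' (2 * M'),
      (θ x.1 * g x.2) * typeIIPhase A B α b (d₁ * x.1) x.2 m‖ ^ 2 ≤
    (∑ n ∈ Ico M' (2 * M'), ‖g n‖ ^ 2) * (2 * M / d₁ * (16 * L ^ 4) +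
      2 * ∑ l ∈ (Icc 1 ⌊M' * Z⌋₊).filter (fun l : ℕ => (d₁ : ℝ) ^ 2 * l ≤ M' * Z),
        tau l ^ 2 * cappedInv (4 * N / ((d₁ : ℝ) ^ 2 * l)) (α * ((d₁ : ℝ) ^ 2 * l))) := by
  have hN := h.one_le_N
  have hM0 : (1 : ℝ) ≤ M := by exact_mod_cast hM
  have hd₁0 : (1 : ℝ) ≤ d₁ := by exact_mod_cast hd₁
  set J := Ico M' (2 * M') with hJ
  have hlcm : ∀ d ∈ E, ∀ d' ∈ E, 1 ≤ d.lcm d' ∧ ((d₁ * d.lcm d' : ℕ) : ℝ) ≤ Z := by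
    intro d hd d' hd'
    obtain ⟨p1, p2, _⟩ := hE d hd
    obtain ⟨p1', p2', _⟩ := hE d' hd'
    refine ⟨Nat.lcm_pos p1 p1', ?_⟩
    have e1 : d.lcm d' ≤ d * d' := Nat.le_of_dvd (Nat.mul_pos p1 p1') (Nat.lcm_dvd_mul d d')
    have e2 : ((d₁ * d.lcm d' : ℕ) : ℝ) ≤ d₁ * (d * d') := by
      exact_mod_cast Nat.mul_le_mul_left d₁ e1
    nlinarith [mul_nonneg (zero_le_one.trans hd₁0) (sq_nonneg ((d : ℝ) - d'))]
  -- the correlation at distance `k d₁`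
  set F : ℕ → ℕ → ℝ := fun r k =>
    cappedInv (2 * M / ((d₁ * r : ℕ) : ℝ)) (α * ((d₁ ^ 2 * (k * r) : ℕ) : ℝ)) with hF
  set c : ℕ → ℝ := fun l => cappedInv (4 * N / ((d₁ : ℝ) ^ 2 * l)) (α * ((d₁ : ℝ) ^ 2 * l)) with hc
  have hFpos : ∀ r k, 1 ≤ r → 0 ≤ F r k := fun r k hr => by
    have : 1 ≤ d₁ * r := Nat.mul_pos hd₁ hr
    have : (1 : ℝ) ≤ ((d₁ * r : ℕ) : ℝ) := by exact_mod_cast this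
    exact (cappedInv_pos (by positivity) _).le
  have hcpos : ∀ l, 1 ≤ l → 0 ≤ c l := fun l hl => by
    have : (1 : ℝ) ≤ l := by exact_mod_cast hl
    exact (cappedInv_pos (by positivity) _).le
  have hF0 : ∀ r, 1 ≤ r → F r 0 ≤ 2 * M / d₁ * (1 / (r : ℝ)) := fun r hr => by
    have hr0 : (1 : ℝ) ≤ r := by exact_mod_cast hr
    refine (cappedInv_le ?_ _).trans (le_of_eq ?_)
    · push_cast
      positivity
    · push_cast
      field_simp
  have hFc : ∀ r k, 1 ≤ r → k ∈ Icc 1 (M' / d₁) → F r k ≤ c (k * r) := fun r k hr hk => by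
    obtain ⟨hk1, hk2⟩ := mem_Icc.1 hk
    have hr0 : (1 : ℝ) ≤ r := by exact_mod_cast hr
    have hk0 : (1 : ℝ) ≤ k := by exact_mod_cast hk1
    have hkd : (k * d₁ : ℝ) ≤ M' := by
      exact_mod_cast (Nat.le_div_iff_mul_le hd₁).1 hk2
    rw [hF, hc]
    push_cast
    refine cappedInv_mono (by positivity) ?_ _
    rw [div_le_div_iff₀ (by positivity) (by positivity)]
    have e1 : (M : ℝ) * (k * d₁) ≤ 2 * N := le_trans (by gcongr) hMM
    calc 2 * (M : ℝ) * (d₁ ^ 2 * (k * r)) = 2 * (M * (k * d₁)) * (d₁ * r) := by ring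
      _ ≤ 2 * (2 * N) * (d₁ * r) := by gcongr
      _ = _ := by ring
  have h1 := sum_norm_sum_sq_le (Ico M (2 * M)) (E ×ˢ J) (fun x => θ x.1 * g x.2)
    (fun x m => typeIIPhase A B α b (d₁ * x.1) x.2 m)
    (fun x y => if x.2 ≡ y.2 [MOD d₁] then
      F (x.1.lcm y.1) (((x.2 : ℤ) - y.2).natAbs / d₁) else 0) (fun x hx y hy => by
      obtain ⟨hx1, _⟩ := mem_product.1 hx
      obtain ⟨hy1, _⟩ := mem_product.1 hy
      obtain ⟨p1, _, p3⟩ := hE _ hx1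
      obtain ⟨p1', _, p3'⟩ := hE _ hy1
      exact norm_sum_typeIIPhase_le hd₁ p1 p1' p3 p3' (hlcm _ hx1 _ hy1).2 hZM)
  refine h1.trans ?_
  have h2 : ∀ x ∈ E ×ˢ J, ‖θ x.1 * g x.2‖ ^ 2 * ∑ y ∈ E ×ˢ J, (if x.2 ≡ y.2 [MOD d₁] then
      F (x.1.lcm y.1) (((x.2 : ℤ) - y.2).natAbs / d₁) else 0) ≤
      ‖g x.2‖ ^ 2 * ∑ d' ∈ E, (2 * M / d₁ * (1 / ((x.1.lcm d' : ℕ) : ℝ)) +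
        2 * ∑ k ∈ Icc 1 (M' / d₁), c (k * x.1.lcm d')) := by
    intro x hx
    obtain ⟨hx1, hx2⟩ := mem_product.1 hx
    rw [sum_product]
    have e1 : ‖θ x.1 * g x.2‖ ≤ ‖g x.2‖ := by
      rw [norm_mul]
      exact mul_le_of_le_one_left (norm_nonneg _) (hθ _)
    refine mul_le_mul (pow_le_pow_left₀ (norm_nonneg _) e1 2) (sum_le_sum fun d' hd' => ?_)
      (sum_nonneg fun d' hd' => sum_nonneg fun n' _ => ?_) (sq_nonneg _)
    · have hr := (hlcm _ hx1 _ hd').1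
      refine (sum_modEq_le hd₁ hx2 (F (x.1.lcm d')) fun k => hFpos _ _ hr).trans ?_
      exact add_le_add (hF0 _ hr) (mul_le_mul_of_nonneg_left
        (sum_le_sum fun k hk => hFc _ _ hr hk) (by norm_num))
    · split_ifs
      · exact hFpos _ _ (hlcm _ hx1 _ hd').1
      · exact le_rfl
  refine (sum_le_sum h2).trans ?_
  rw [sum_product_right]
  simp_rw [← mul_sum]
  rw [← sum_mul]
  refine mul_le_mul_of_nonneg_left ?_ (sum_nonneg fun _ _ => sq_nonneg _)
  simp_rw [sum_add_distrib, ← mul_sum]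
  rw [← sum_product' E E (fun d d' => 1 / ((d.lcm d' : ℕ) : ℝ)),
    ← sum_product' E E (fun d d' => ∑ k ∈ Icc 1 (M' / d₁), c (k * d.lcm d')),
    ← sum_product' (E ×ˢ E) _ (fun x k => c (k * x.1.lcm x.2))]
  refine add_le_add (mul_le_mul_of_nonneg_left ?_ (by positivity))
    (mul_le_mul_of_nonneg_left ?_ (by norm_num))
  · refine h.sum_one_div_lcm_le E hZN (fun d hd => (hE d hd).1) fun d hd d' hd' => ?_
    refine le_trans ?_ (hlcm d hd d' hd').2
    exact_mod_cast Nat.le_mul_of_pos_left _ hd₁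
  · refine sum_comp_le_sum_tau_sq ((E ×ˢ E) ×ˢ Icc 1 (M' / d₁)) _
      (fun x => x.2 * x.1.1.lcm x.1.2) (fun x => x.1.1) (fun x => x.1.2) ?_ ?_
      (fun x _ => (Nat.dvd_lcm_left _ _).mul_left _)
      (fun x _ => (Nat.dvd_lcm_right _ _).mul_left _) ?_ c
      fun l hl => hcpos l (mem_Icc.1 (mem_filter.1 hl).1).1
    · rintro ⟨⟨d, d'⟩, k⟩ hx
      simp only [mem_product] at hx
      obtain ⟨⟨hd, hd'⟩, hk⟩ := hx
      obtain ⟨hk1, hk2⟩ := mem_Icc.1 hk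
      obtain ⟨hr1, hr2⟩ := hlcm d hd d' hd'
      push_cast at hr2
      have hkd : (k * d₁ : ℝ) ≤ M' := by
        exact_mod_cast (Nat.le_div_iff_mul_le hd₁).1 hk2
      have hZ0 : 0 ≤ Z := le_trans (by positivity) hr2
      have e1 : (d₁ : ℝ) ^ 2 * ((k * d.lcm d' : ℕ) : ℝ) ≤ M' * Z := by
        push_cast
        calc (d₁ : ℝ) ^ 2 * (k * (d.lcm d' : ℕ)) = (k * d₁) * (d₁ * (d.lcm d' : ℕ)) := by ring
          _ ≤ _ := by gcongr
      refine mem_filter.2 ⟨mem_Icc.2 ⟨Nat.mul_pos hk1 hr1, Nat.le_floor ?_⟩, e1⟩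
      refine le_trans ?_ e1
      exact le_mul_of_one_le_left (Nat.cast_nonneg _) (one_le_pow₀ hd₁0)
    · rintro ⟨⟨d, d'⟩, k⟩ hx
      simp only [mem_product] at hx
      obtain ⟨⟨hd, hd'⟩, hk⟩ := hx
      exact (Nat.mul_pos (mem_Icc.1 hk).1 (hlcm d hd d' hd').1).ne'
    · rintro ⟨⟨d, d'⟩, k⟩ hx ⟨⟨e, e'⟩, k'⟩ _ h1 h2 h3
      simp only [mem_product] at hx h1 h2 h3
      subst h2 h3
      rw [Nat.eq_of_mul_eq_mul_right (hlcm d hx.1.1 d' hx.1.2).1 h1]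

/-- Type II sums over moduli `d₁ d₂`: the saving is `R^{1/2}` as soon as `d₁ M` and `d₁ d₂² / M`
stay below `N` and `1` by a power of `R`. -/
lemma sq_sum_norm_typeII_le (h : IsMinor α N R L q) {A B M M' : ℕ} {b : ℤ} (hM : 1 ≤ M)
    (hMM : (M * M' : ℝ) ≤ 2 * N) {Y Z : ℝ} (hY0 : 0 ≤ Y) (hY : Y * R ≤ N) (hZM : Z ≤ M)
    (hZN : Z ≤ N) (hZ : M' * Z * R ^ 20 ≤ N) (𝒟 : Finset ℕ) (E : ℕ → Finset ℕ)
    (h𝒟 : ∀ d₁ ∈ 𝒟, 1 ≤ d₁ ∧ (d₁ * M : ℝ) ≤ Y)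
    (hE : ∀ d₁ ∈ 𝒟, ∀ d₂ ∈ E d₁, 1 ≤ d₂ ∧ (d₁ * d₂ ^ 2 : ℝ) ≤ Z ∧
      Int.gcd ((d₁ * d₂ : ℕ) : ℤ) b = 1) (f g : ℕ → ℂ) {U V : ℝ}
    (hU : ∑ m ∈ Ico M (2 * M), ‖f m‖ ^ 2 ≤ U) (hV : ∑ n ∈ Ico M' (2 * M'), ‖g n‖ ^ 2 ≤ V) :
    (∑ d₁ ∈ 𝒟, ∑ d₂ ∈ E d₁, ‖bilinearSum A B α b (d₁ * d₂) (Ico M (2 * M))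
      (Ico M' (2 * M')) f g‖) ^ 2 ≤ U * V * (N * (L ^ 18 / R)) := by
  have hR := h.one_le_R
  have hL := h.le_L
  have hN := h.one_le_N
  have hM0 : (1 : ℝ) ≤ M := by exact_mod_cast hM
  have hU0 : 0 ≤ U := le_trans (sum_nonneg fun _ _ => sq_nonneg _) hU
  have hV0 : 0 ≤ V := le_trans (sum_nonneg fun _ _ => sq_nonneg _) hV
  obtain ⟨θ, hθ, h1⟩ := sq_sum_norm_bilinearSum_le A B α b 𝒟 (Ico M (2 * M)) (Ico M' (2 * M')) E
    f g fun d hd => (h𝒟 d hd).1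
  set c : ℕ → ℕ → ℝ := fun d l =>
    cappedInv (4 * N / ((d : ℝ) ^ 2 * l)) (α * ((d : ℝ) ^ 2 * l)) with hc
  set S := (𝒟 ×ˢ Icc 1 ⌊M' * Z⌋₊).filter fun x : ℕ × ℕ => (x.1 : ℝ) ^ 2 * x.2 ≤ M' * Z with hS
  have h2 := h.sum_tau_sq_mul_cappedInv_le hZ S fun x hx => by
    obtain ⟨hx1, hx2⟩ := mem_filter.1 hx
    obtain ⟨hx3, hx4⟩ := mem_product.1 hx1
    exact ⟨(h𝒟 _ hx3).1, (mem_Icc.1 hx4).1, hx2⟩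
  have h3 : ∑ d₁ ∈ 𝒟, 1 / (d₁ : ℝ) ≤ 2 * L := by
    set K := ⌊N⌋₊ with hK
    have hK1 : (1 : ℝ) ≤ K := by exact_mod_cast Nat.one_le_floor_iff _ |>.2 hN
    have hKN : (K : ℝ) ≤ N := Nat.floor_le (by linarith)
    refine le_trans (sum_le_sum_of_subset_of_nonneg (t := Icc 1 K) ?_ fun _ _ _ => by positivity)
      ((sum_one_div_le K).trans (h.one_add_log_le (by linarith) (by linarith)))
    intro d hd
    obtain ⟨p1, p2⟩ := h𝒟 d hd
    refine mem_Icc.2 ⟨p1, Nat.le_floor ?_⟩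
    have : (1 : ℝ) ≤ d := by exact_mod_cast p1
    nlinarith
  have h4 : (𝒟.card * M : ℝ) ≤ Y := by
    have e1 : 𝒟 ⊆ Icc 1 ⌊Y / M⌋₊ := fun d hd => by
      obtain ⟨p1, p2⟩ := h𝒟 d hd
      refine mem_Icc.2 ⟨p1, Nat.le_floor ?_⟩
      rwa [le_div_iff₀ (by linarith)]
    have e2 := card_le_card e1
    rw [Nat.card_Icc, Nat.add_sub_cancel] at e2
    have e3 : (𝒟.card : ℝ) ≤ Y / M :=
      (show (𝒟.card : ℝ) ≤ ⌊Y / M⌋₊ by exact_mod_cast e2).trans (Nat.floor_le (by positivity))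
    rwa [le_div_iff₀ (by linarith)] at e3
  have h5 : ∑ d₁ ∈ 𝒟, (d₁ : ℝ) * ∑ m ∈ Ico M (2 * M), ‖∑ x ∈ E d₁ ×ˢ Ico M' (2 * M'),
      (θ d₁ x.1 * g x.2) * typeIIPhase A B α b (d₁ * x.1) x.2 m‖ ^ 2 ≤
      V * (N * (L ^ 16 / R)) := by
    calc _ ≤ ∑ d₁ ∈ 𝒟, V * (2 * M * (16 * L ^ 4) + 2 * ∑ l ∈ (Icc 1 ⌊M' * Z⌋₊).filter
            (fun l : ℕ => (d₁ : ℝ) ^ 2 * l ≤ M' * Z), tau l ^ 2 * (d₁ * c d₁ l)) := by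
          refine sum_le_sum fun d₁ hd => ?_
          obtain ⟨p1, p2⟩ := h𝒟 d₁ hd
          have hd0 : (1 : ℝ) ≤ d₁ := by exact_mod_cast p1
          have e1 := h.sum_norm_sq_typeII_le (A := A) (B := B) hM hMM hZM hZN p1 (E d₁) (hE d₁ hd)
            (θ d₁) g (hθ d₁)
          have e2 : 0 ≤ ∑ l ∈ (Icc 1 ⌊M' * Z⌋₊).filter (fun l : ℕ => (d₁ : ℝ) ^ 2 * l ≤ M' * Z),
              tau l ^ 2 * c d₁ l := sum_nonneg fun l hl => by
            have : (1 : ℝ) ≤ l := by exact_mod_cast (mem_Icc.1 (mem_filter.1 hl).1).1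
            exact mul_nonneg (sq_nonneg _) (cappedInv_pos (by positivity) _).le
          calc _ ≤ (d₁ : ℝ) * (V * (2 * M / d₁ * (16 * L ^ 4) +
                2 * ∑ l ∈ (Icc 1 ⌊M' * Z⌋₊).filter (fun l : ℕ => (d₁ : ℝ) ^ 2 * l ≤ M' * Z),
                  tau l ^ 2 * c d₁ l)) := by
                gcongr
                refine e1.trans ?_
                gcongr
            _ = V * (2 * M * (16 * L ^ 4) + 2 * ((d₁ : ℝ) *
                ∑ l ∈ (Icc 1 ⌊M' * Z⌋₊).filter (fun l : ℕ => (d₁ : ℝ) ^ 2 * l ≤ M' * Z),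
                  tau l ^ 2 * c d₁ l)) := by
                field_simp
            _ = _ := by
                rw [mul_sum]
                congr 3
                refine sum_congr rfl fun l _ => ?_
                ring
      _ = V * (32 * (𝒟.card * M) * L ^ 4 + 2 * ∑ x ∈ S, tau x.2 ^ 2 * (x.1 * c x.1 x.2)) := by
          rw [← mul_sum, sum_add_distrib, sum_const, nsmul_eq_mul, ← mul_sum, hS, sum_filter,
            sum_product]
          simp_rw [sum_filter]
          ring
      _ ≤ V * (32 * (N / R) * L ^ 4 + 2 * (N * (L ^ 15 / R))) := by
          have e3 : (𝒟.card * M : ℝ) ≤ N / R := h4.trans (by rwa [le_div_iff₀ (by linarith)])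
          gcongr
      _ = V * (N * ((32 * L ^ 4 + 2 * L ^ 15) / R)) := by ring
      _ ≤ _ := by
          gcongr
          have e4 : L ^ 4 ≤ L ^ 15 := pow_le_pow_right₀ (by linarith) (by norm_num)
          have e5 : 0 ≤ L ^ 15 := by positivity
          rw [pow_succ L 15]
          nlinarith
  refine h1.trans ?_
  calc _ ≤ (2 * L * U) * (V * (N * (L ^ 16 / R))) := by
        refine mul_le_mul (mul_le_mul h3 hU (sum_nonneg fun _ _ => sq_nonneg _) (by linarith)) h5
          (sum_nonneg fun _ _ => mul_nonneg (Nat.cast_nonneg _) (sum_nonneg fun _ _ => sq_nonneg _))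
          (by positivity)
    _ = U * V * (N * (2 * L ^ 17 / R)) := by ring
    _ ≤ _ := by
        gcongr
        rw [pow_succ L 17]
        have : 0 ≤ L ^ 17 := by positivity
        nlinarith

end IsMinor

/-- `d` factors as `d₁ d₂` with `d₁ M ≤ N/ρ` and `d₁ d₂² ≤ M/ρ`: what the Type II estimate needs
when the longer variable has size `M`. -/
def FactorsAt (N ρ : ℝ) (M d : ℕ) : Prop :=
  ∃ d₁ d₂ : ℕ, d = d₁ * d₂ ∧ (d₁ * M : ℝ) ≤ N / ρ ∧ (d₁ * d₂ ^ 2 : ℝ) ≤ M / ρ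

lemma bilinearSum_comm (A B : ℕ) (α : ℝ) (b : ℤ) (d : ℕ) (I J : Finset ℕ) (f g : ℕ → ℂ) :
    bilinearSum A B α b d I J f g = bilinearSum A B α b d J I g f := by
  unfold bilinearSum
  rw [sum_comm]
  refine sum_congr rfl fun k _ => sum_congr rfl fun m _ => ?_
  rw [mul_comm m k, mul_comm (f m)]

namespace IsMinor

variable {α N R L : ℝ} {q : ℕ}

lemma sum_norm_sq_le_of_le_tau (h : IsMinor α N R L q) {M : ℕ} (hM : 1 ≤ M)
    (hMN : (M : ℝ) ≤ 8 * N) (f : ℕ → ℂ)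
    (hf : ∀ m ∈ Ico M (2 * M), ‖f m‖ ≤ 2 * L * tau m) :
    ∑ m ∈ Ico M (2 * M), ‖f m‖ ^ 2 ≤ M * L ^ 7 := by
  have hL := h.le_L
  have hM0 : (1 : ℝ) ≤ M := by exact_mod_cast hM
  have hlog := h.one_add_log_le (x := ((2 * M : ℕ) : ℝ)) (by push_cast; linarith)
    (by push_cast; linarith)
  have hlog0 : 0 ≤ Real.log ((2 * M : ℕ) : ℝ) := Real.log_nonneg (by push_cast; linarith)
  have h2 := sum_tau_pow_div_le 2 (2 * M)
  have h3 : (1 + Real.log ((2 * M : ℕ) : ℝ)) ^ 2 ^ 2 ≤ (2 * L) ^ 4 :=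
    pow_le_pow_left₀ (by linarith) hlog 4
  calc ∑ m ∈ Ico M (2 * M), ‖f m‖ ^ 2
      ≤ ∑ m ∈ Ico M (2 * M), 4 * L ^ 2 * (2 * M) * (tau m ^ 2 / m) := by
        refine sum_le_sum fun m hm => ?_
        obtain ⟨hm1, hm2⟩ := mem_Ico.1 hm
        have hm0 : (1 : ℝ) ≤ m := by exact_mod_cast hM.trans hm1
        have hm3 : (m : ℝ) ≤ 2 * M := by exact_mod_cast hm2.le
        have e1 := pow_le_pow_left₀ (norm_nonneg _) (hf m hm) 2
        refine e1.trans ?_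
        rw [mul_div_assoc', le_div_iff₀ (by linarith)]
        calc (2 * L * tau m) ^ 2 * m = 4 * L ^ 2 * m * tau m ^ 2 := by ring
          _ ≤ 4 * L ^ 2 * (2 * M) * tau m ^ 2 := by gcongr
    _ ≤ ∑ m ∈ Icc 1 (2 * M), 4 * L ^ 2 * (2 * M) * (tau m ^ 2 / m) := by
        refine sum_le_sum_of_subset_of_nonneg (fun m hm => ?_) fun _ _ _ => by positivity
        rw [mem_Ico] at hm
        rw [mem_Icc]
        lia
    _ ≤ 4 * L ^ 2 * (2 * M) * (2 * L) ^ 4 := by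
        rw [← mul_sum]
        gcongr
        exact h2.trans h3
    _ = 128 * (M * L ^ 6) := by ring
    _ ≤ L * (M * L ^ 6) := by
        gcongr
        linarith
    _ = _ := by ring

lemma sum_norm_bilinearSum_block_le (h : IsMinor α N R L q) {A B M M' : ℕ} {b : ℤ} {ρ : ℝ}
    (hρ : 2 * R ^ 20 ≤ ρ) (hM : 1 ≤ M) (hM' : 1 ≤ M') (hMM : (M * M' : ℝ) ≤ 2 * N)
    (S : Finset ℕ) (hS : ∀ d ∈ S, 1 ≤ d ∧ Int.gcd (d : ℤ) b = 1) (hSM : ∀ d ∈ S, FactorsAt N ρ M d)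
    (f g : ℕ → ℂ) (hf : ∀ m ∈ Ico M (2 * M), ‖f m‖ ≤ 2 * L * tau m)
    (hg : ∀ m ∈ Ico M' (2 * M'), ‖g m‖ ≤ 2 * L * tau m) :
    ∑ d ∈ S, ‖bilinearSum A B α b d (Ico M (2 * M)) (Ico M' (2 * M')) f g‖ ≤
      N * (L ^ 17 / Real.sqrt R) := by
  have hR := h.one_le_R
  have hL := h.le_L
  have hN := h.one_le_N
  have hM0 : (1 : ℝ) ≤ M := by exact_mod_cast hM
  have hM0' : (1 : ℝ) ≤ M' := by exact_mod_cast hM'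
  have hR20 : R ≤ R ^ 20 := le_self_pow₀ hR (by norm_num)
  have hρ1 : 1 ≤ ρ := by linarith
  set n := S.sup id with hn
  have hSn : ∀ d ∈ S, d ≤ n := fun d hd => le_sup (f := id) hd
  set 𝒟 := (Icc 1 n).filter fun d₁ : ℕ => (d₁ * M : ℝ) ≤ N / ρ with h𝒟
  set E : ℕ → Finset ℕ := fun d₁ => (Icc 1 n).filter fun d₂ : ℕ =>
    (d₁ * d₂ ^ 2 : ℝ) ≤ M / ρ ∧ Int.gcd ((d₁ * d₂ : ℕ) : ℤ) b = 1 with hE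
  have hMN : (M : ℝ) ≤ 2 * N := by nlinarith
  have hMN' : (M' : ℝ) ≤ 2 * N := by nlinarith
  have h1 := h.sq_sum_norm_typeII_le (A := A) (B := B) (b := b) hM hMM (Y := N / ρ) (Z := M / ρ)
    (by positivity)
    (by
      rw [div_mul_eq_mul_div, div_le_iff₀ (by linarith)]
      gcongr
      linarith)
    (div_le_self (by linarith) hρ1)
    (by
      rw [div_le_iff₀ (by linarith)]
      nlinarith)
    (by
      rw [mul_div_assoc', div_mul_eq_mul_div, div_le_iff₀ (by linarith)]
      calc (M' * M : ℝ) * R ^ 20 = (M * M') * R ^ 20 := by ring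
        _ ≤ 2 * N * R ^ 20 := by gcongr
        _ = N * (2 * R ^ 20) := by ring
        _ ≤ _ := by gcongr)
    𝒟 E (fun d₁ hd => ⟨(mem_Icc.1 (mem_filter.1 hd).1).1, (mem_filter.1 hd).2⟩)
    (fun d₁ _ d₂ hd => ⟨(mem_Icc.1 (mem_filter.1 hd).1).1, (mem_filter.1 hd).2⟩) f g
    (h.sum_norm_sq_le_of_le_tau hM (by linarith) f hf)
    (h.sum_norm_sq_le_of_le_tau hM' (by linarith) g hg)
  have h2 : ∑ d ∈ S, ‖bilinearSum A B α b d (Ico M (2 * M)) (Ico M' (2 * M')) f g‖ ≤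
      ∑ d₁ ∈ 𝒟, ∑ d₂ ∈ E d₁, ‖bilinearSum A B α b (d₁ * d₂) (Ico M (2 * M))
        (Ico M' (2 * M')) f g‖ := by
    choose! u v huv hu hv using hSM
    rw [sum_sigma']
    calc _ = ∑ d ∈ S, ‖bilinearSum A B α b (u d * v d) (Ico M (2 * M))
          (Ico M' (2 * M')) f g‖ := by
          refine sum_congr rfl fun d hd => ?_
          rw [← huv d hd]
      _ ≤ _ := by
          refine sum_le_sum_of_injOn S _ (fun d => (⟨u d, v d⟩ : Σ _ : ℕ, ℕ))
            (fun x => ‖bilinearSum A B α b (x.1 * x.2) (Ico M (2 * M))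
              (Ico M' (2 * M')) f g‖) (fun _ _ => norm_nonneg _) ?_ ?_
          · intro d hd
            obtain ⟨hd1, hdb⟩ := hS d hd
            have hdn := hSn d hd
            have hd2 := huv d hd
            have hu1 : 1 ≤ u d := Nat.one_le_iff_ne_zero.2 fun h0 => by
              rw [h0, zero_mul] at hd2
              lia
            have hv1 : 1 ≤ v d := Nat.one_le_iff_ne_zero.2 fun h0 => by
              rw [h0, mul_zero] at hd2
              lia
            have hun : u d ≤ n := by nlinarith
            have hvn : v d ≤ n := by nlinarith
            refine mem_sigma.2 ⟨mem_filter.2 ⟨mem_Icc.2 ⟨hu1, hun⟩, hu d hd⟩,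
              mem_filter.2 ⟨mem_Icc.2 ⟨hv1, hvn⟩, hv d hd, ?_⟩⟩
            rw [← hd2]
            exact hdb
          · intro d hd d' hd' hdd
            have e1 := congrArg Sigma.fst hdd
            have e2 := eq_of_heq (Sigma.mk.inj hdd).2
            rw [huv d hd, huv d' hd']
            exact congrArg₂ _ e1 e2
  refine h2.trans (le_of_sq_le_sq (h1.trans ?_) (by positivity))
  calc (M * L ^ 7 : ℝ) * (M' * L ^ 7) * (N * (L ^ 18 / R))
      = (M * M') * (N * (L ^ 32 / R)) := by ring
    _ ≤ 2 * N * (N * (L ^ 32 / R)) := by gcongr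
    _ = N ^ 2 * (2 * L ^ 32 / R) := by ring
    _ ≤ N ^ 2 * (L ^ 34 / R) := by
        gcongr
        rw [show L ^ 34 = L ^ 2 * L ^ 32 by ring]
        gcongr
        nlinarith
    _ = _ := by
        rw [mul_pow, div_pow, Real.sq_sqrt (by linarith)]
        ring

/-- A bilinear sum with both variables at least `U`, over moduli that factor suitably for every
possible size of the longer variable. -/
lemma sum_norm_bilinearSum_le (h : IsMinor α N R L q) {A B : ℕ} {b : ℤ} {ρ U : ℝ}
    (hρ : 2 * R ^ 20 ≤ ρ) (hU0 : 0 ≤ U) (hA : N ≤ A) (hB : ∀ n : ℕ, n < B → (n : ℝ) < 2 * N)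
    (S : Finset ℕ) (hS : ∀ d ∈ S, 1 ≤ d ∧ Int.gcd (d : ℤ) b = 1)
    (hSF : ∀ d ∈ S, ∀ M : ℕ, N ≤ 4 * (M : ℝ) ^ 2 → (M * U : ℝ) ≤ 2 * N → FactorsAt N ρ M d)
    (f g : ℕ → ℂ) (hf : ∀ m : ℕ, 1 ≤ m → (m : ℝ) ≤ 8 * N → ‖f m‖ ≤ 2 * L * tau m)
    (hg : ∀ m : ℕ, 1 ≤ m → (m : ℝ) ≤ 8 * N → ‖g m‖ ≤ 2 * L * tau m)
    (hfg : ∀ m k : ℕ, A ≤ m * k → m * k < B → f m * g k ≠ 0 → U ≤ m ∧ U ≤ k) :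
    ∑ d ∈ S, ‖bilinearSum A B α b d (Ico 1 B) (Ico 1 B) f g‖ ≤ N * (L ^ 20 / Real.sqrt R) := by
  have hL := h.le_L
  have hN := h.one_le_N
  have hR := h.one_le_R
  obtain ⟨n, hn, hn'⟩ := exists_two_pow (show (1 : ℝ) ≤ 2 * N by linarith)
  have hnL : (n : ℝ) + 1 ≤ 4 * L := h.level_le (by linarith)
  have hBn : B ≤ 2 ^ n := by
    by_contra hlt
    have := hB (2 ^ n) (by lia)
    push_cast at this
    linarith
  have hext : ∀ d, bilinearSum A B α b d (Ico 1 B) (Ico 1 B) f g =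
      ∑ i ∈ range n, ∑ j ∈ range n, bilinearSum A B α b d (Ico (2 ^ i) (2 * 2 ^ i))
        (Ico (2 ^ j) (2 * 2 ^ j)) f g := by
    intro d
    have hsub : Ico 1 B ⊆ Ico 1 (2 ^ n) := Ico_subset_Ico_right hBn
    unfold bilinearSum
    have e1 : ∀ i, ∑ j ∈ range n, ∑ m ∈ Ico (2 ^ i) (2 * 2 ^ i), ∑ k ∈ Ico (2 ^ j) (2 * 2 ^ j),
        (if (A ≤ m * k ∧ m * k < B) ∧ ((m * k : ℕ) : ℤ) ≡ b [ZMOD (d : ℤ)] then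
          f m * g k * e (α * ((m * k : ℕ) : ℝ)) else 0) =
        ∑ m ∈ Ico (2 ^ i) (2 * 2 ^ i), ∑ k ∈ Ico 1 (2 ^ n),
        (if (A ≤ m * k ∧ m * k < B) ∧ ((m * k : ℕ) : ℤ) ≡ b [ZMOD (d : ℤ)] then
          f m * g k * e (α * ((m * k : ℕ) : ℝ)) else 0) := fun i => by
      rw [sum_comm]
      exact sum_congr rfl fun m _ => sum_dyadic _ n
    simp_rw [e1]
    rw [sum_dyadic]
    have e2 : ∀ m ∈ Ico 1 (2 ^ n), ∑ k ∈ Ico 1 (2 ^ n),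
        (if (A ≤ m * k ∧ m * k < B) ∧ ((m * k : ℕ) : ℤ) ≡ b [ZMOD (d : ℤ)] then
          f m * g k * e (α * ((m * k : ℕ) : ℝ)) else 0) = ∑ k ∈ Ico 1 B,
        (if (A ≤ m * k ∧ m * k < B) ∧ ((m * k : ℕ) : ℤ) ≡ b [ZMOD (d : ℤ)] then
          f m * g k * e (α * ((m * k : ℕ) : ℝ)) else 0) := by
      intro m hm
      refine (sum_subset hsub fun k hk hk' => if_neg ?_).symm
      rw [mem_Ico] at hm hk hk'
      rintro ⟨⟨_, hlt⟩, _⟩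
      exact hk' ⟨hk.1, by nlinarith⟩
    rw [sum_congr rfl e2]
    refine sum_subset hsub fun m hm hm' => sum_eq_zero fun k hk => if_neg ?_
    rw [mem_Ico] at hm hk hm'
    rintro ⟨⟨_, hlt⟩, _⟩
    exact hm' ⟨hm.1, by nlinarith⟩
  have hblock : ∀ i ∈ range n, ∀ j ∈ range n,
      ∑ d ∈ S, ‖bilinearSum A B α b d (Ico (2 ^ i) (2 * 2 ^ i)) (Ico (2 ^ j) (2 * 2 ^ j)) f g‖ ≤
        N * (L ^ 17 / Real.sqrt R) := by
    intro i hi j hj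
    set M := 2 ^ i with hM
    set M' := 2 ^ j with hM'
    have hM1 : 1 ≤ M := Nat.one_le_two_pow
    have hM1' : 1 ≤ M' := Nat.one_le_two_pow
    have hM0 : (1 : ℝ) ≤ M := by exact_mod_cast hM1
    have hM0' : (1 : ℝ) ≤ M' := by exact_mod_cast hM1'
    by_cases hne : ∃ m ∈ Ico M (2 * M), ∃ k ∈ Ico M' (2 * M'),
        (A ≤ m * k ∧ m * k < B) ∧ f m * g k ≠ 0
    · obtain ⟨m, hm, k, hk, ⟨hmk, hmk'⟩, hfg0⟩ := hne
      obtain ⟨hUm, hUk⟩ := hfg m k hmk hmk' hfg0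
      have hlt := hB _ hmk'
      push_cast at hlt
      have hge : N ≤ m * k := hA.trans (by exact_mod_cast hmk)
      rw [mem_Ico] at hm hk
      have m1 : (M : ℝ) ≤ m := by exact_mod_cast hm.1
      have m2 : (m : ℝ) ≤ 2 * M := by exact_mod_cast hm.2.le
      have k1 : (M' : ℝ) ≤ k := by exact_mod_cast hk.1
      have k2 : (k : ℝ) ≤ 2 * M' := by exact_mod_cast hk.2.le
      have hMM : (M * M' : ℝ) ≤ 2 * N := by
        have : (M * M' : ℝ) ≤ m * k := by gcongr
        linarith
      have hMM' : N ≤ 4 * (M * M' : ℝ) := by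
        have : (m * k : ℝ) ≤ (2 * M) * (2 * M') := by gcongr
        linarith
      have hMN : (M : ℝ) ≤ 2 * N := by nlinarith
      have hMN' : (M' : ℝ) ≤ 2 * N := by nlinarith
      have hf' : ∀ m ∈ Ico M (2 * M), ‖f m‖ ≤ 2 * L * tau m := fun x hx => by
        rw [mem_Ico] at hx
        have : (x : ℝ) ≤ 2 * M := by exact_mod_cast hx.2.le
        exact hf x (hM1.trans hx.1) (by linarith)
      have hg' : ∀ m ∈ Ico M' (2 * M'), ‖g m‖ ≤ 2 * L * tau m := fun x hx => by
        rw [mem_Ico] at hx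
        have : (x : ℝ) ≤ 2 * M' := by exact_mod_cast hx.2.le
        exact hg x (hM1'.trans hx.1) (by linarith)
      rcases le_total (M' : ℝ) M with hle | hle
      · refine h.sum_norm_bilinearSum_block_le hρ hM1 hM1' hMM S hS (fun d hd => hSF d hd M ?_ ?_)
          f g hf' hg'
        · nlinarith
        · have : (M * U : ℝ) ≤ m * k := by gcongr
          linarith
      · simp_rw [bilinearSum_comm A B α b _ (Ico M (2 * M))]
        refine h.sum_norm_bilinearSum_block_le hρ hM1' hM1 (by linarith) S hS
          (fun d hd => hSF d hd M' ?_ ?_) g f hg' hf'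
        · nlinarith
        · have : (M' * U : ℝ) ≤ k * m := by gcongr
          linarith
    · have hzero : ∀ d ∈ S, ‖bilinearSum A B α b d (Ico M (2 * M)) (Ico M' (2 * M')) f g‖ = 0 := by
        intro d _
        rw [norm_eq_zero]
        refine sum_eq_zero fun m hm => sum_eq_zero fun k hk => ?_
        split_ifs with hc
        · have : f m * g k = 0 := by
            by_contra h0
            exact hne ⟨m, hm, k, hk, hc.1, h0⟩
          rw [this, zero_mul]
        · rfl
      rw [sum_eq_zero hzero]
      positivity
  calc _ ≤ ∑ d ∈ S, ∑ i ∈ range n, ∑ j ∈ range n, ‖bilinearSum A B α b d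
          (Ico (2 ^ i) (2 * 2 ^ i)) (Ico (2 ^ j) (2 * 2 ^ j)) f g‖ := by
        refine sum_le_sum fun d _ => ?_
        rw [hext]
        exact (norm_sum_le _ _).trans (sum_le_sum fun i _ => norm_sum_le _ _)
    _ = ∑ i ∈ range n, ∑ j ∈ range n, ∑ d ∈ S, ‖bilinearSum A B α b d
          (Ico (2 ^ i) (2 * 2 ^ i)) (Ico (2 ^ j) (2 * 2 ^ j)) f g‖ := by
        rw [sum_comm]
        exact sum_congr rfl fun i _ => sum_comm
    _ ≤ ∑ i ∈ range n, ∑ j ∈ range n, N * (L ^ 17 / Real.sqrt R) :=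
        sum_le_sum fun i hi => sum_le_sum fun j hj => hblock i hi j hj
    _ = n ^ 2 * (N * (L ^ 17 / Real.sqrt R)) := by
        simp only [sum_const, card_range, nsmul_eq_mul]
        ring
    _ ≤ (4 * L) ^ 2 * (N * (L ^ 17 / Real.sqrt R)) := by
        gcongr
        linarith
    _ = N * (16 * L ^ 19 / Real.sqrt R) := by ring
    _ ≤ _ := by
        gcongr
        rw [pow_succ L 19]
        have : 0 ≤ L ^ 19 := by positivity
        nlinarith

end IsMinor

/-! ### Vaughan's identity and the sum over primes -/

/-- The restriction of an arithmetic function to the integers up to `U`. -/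
noncomputable def lowPart (U : ℝ) (f : ArithmeticFunction ℝ) : ArithmeticFunction ℝ :=
  ⟨fun n => if (n : ℝ) ≤ U then f n else 0, by simp⟩

lemma lowPart_apply (U : ℝ) (f : ArithmeticFunction ℝ) (n : ℕ) :
    lowPart U f n = if (n : ℝ) ≤ U then f n else 0 := rfl

lemma highPart_apply (U : ℝ) (f : ArithmeticFunction ℝ) (n : ℕ) :
    (f - lowPart U f) n = if (n : ℝ) ≤ U then 0 else f n := by
  rw [sub_eq_add_neg, ArithmeticFunction.add_apply, ArithmeticFunction.neg_apply, lowPart_apply]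
  split_ifs
  · ring
  · ring

/-- The Möbius function with real values. -/
noncomputable def realMoebius : ArithmeticFunction ℝ :=
  (ArithmeticFunction.moebius : ArithmeticFunction ℤ)

/-- The constant function `1` on positive integers, with real values. -/
noncomputable def realZeta : ArithmeticFunction ℝ :=
  (ArithmeticFunction.zeta : ArithmeticFunction ℕ)

/-- The coefficient `μ_{≤U} * Λ_{≤U}` of Vaughan's identity. -/
noncomputable def vaughanCoeff (U : ℝ) : ArithmeticFunction ℝ :=
  lowPart U realMoebius * lowPart U ArithmeticFunction.vonMangoldt

/-- Vaughan's identity. The part of `μ_{≤U} * Λ_{≤U}` beyond `U` is separated, as it has to be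
treated as a Type II sum. -/
lemma vaughan_identity (U : ℝ) :
    ArithmeticFunction.vonMangoldt = lowPart U ArithmeticFunction.vonMangoldt +
      lowPart U realMoebius * ArithmeticFunction.log - lowPart U (vaughanCoeff U) * realZeta -
      (vaughanCoeff U - lowPart U (vaughanCoeff U)) * realZeta +
      ((realMoebius - lowPart U realMoebius) * realZeta) *
        (ArithmeticFunction.vonMangoldt - lowPart U ArithmeticFunction.vonMangoldt) := by
  have h1 : realMoebius * realZeta = 1 := ArithmeticFunction.coe_moebius_mul_coe_zeta
  have h2 : ArithmeticFunction.vonMangoldt * realZeta = ArithmeticFunction.log :=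
    ArithmeticFunction.vonMangoldt_mul_zeta
  rw [← h2, vaughanCoeff]
  linear_combination (lowPart U ArithmeticFunction.vonMangoldt -
    ArithmeticFunction.vonMangoldt) * h1

lemma realMoebius_apply (n : ℕ) : realMoebius n = (ArithmeticFunction.moebius n : ℝ) := rfl

lemma realZeta_apply {n : ℕ} (hn : n ≠ 0) : realZeta n = 1 := by
  rw [realZeta, ArithmeticFunction.natCoe_apply, ArithmeticFunction.zeta_apply_ne hn, Nat.cast_one]

lemma abs_realMoebius_le_one (n : ℕ) : |realMoebius n| ≤ 1 := by
  rw [realMoebius_apply, ← Int.cast_abs]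
  exact_mod_cast ArithmeticFunction.abs_moebius_le_one

lemma abs_lowPart_realMoebius_le_one (U : ℝ) (n : ℕ) : |lowPart U realMoebius n| ≤ 1 := by
  rw [lowPart_apply]
  split_ifs
  · exact abs_realMoebius_le_one n
  · simp

lemma abs_vaughanCoeff_le (U : ℝ) (n : ℕ) : |vaughanCoeff U n| ≤ Real.log n := by
  rw [vaughanCoeff, ArithmeticFunction.mul_apply, ← ArithmeticFunction.vonMangoldt_sum,
    ← Nat.sum_divisorsAntidiagonal' fun _ j => ArithmeticFunction.vonMangoldt j]
  refine (abs_sum_le_sum_abs _ _).trans (sum_le_sum fun p _ => ?_)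
  rw [abs_mul]
  have h1 : |lowPart U ArithmeticFunction.vonMangoldt p.2| ≤
      ArithmeticFunction.vonMangoldt p.2 := by
    rw [lowPart_apply]
    split_ifs
    · rw [abs_of_nonneg ArithmeticFunction.vonMangoldt_nonneg]
    · simp [ArithmeticFunction.vonMangoldt_nonneg]
  calc _ ≤ 1 * ArithmeticFunction.vonMangoldt p.2 :=
        mul_le_mul (abs_lowPart_realMoebius_le_one U p.1) h1 (abs_nonneg _) zero_le_one
    _ = _ := one_mul _

lemma vaughanCoeff_eq_zero {U : ℝ} {n : ℕ} (hU : 0 ≤ U) (hn : U ^ 2 < n) :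
    vaughanCoeff U n = 0 := by
  rw [vaughanCoeff, ArithmeticFunction.mul_apply]
  refine sum_eq_zero fun p hp => ?_
  have h1 := (Nat.mem_divisorsAntidiagonal.1 hp).1
  rw [lowPart_apply, lowPart_apply]
  split_ifs with h2 h3
  · exfalso
    have : (n : ℝ) ≤ U * U := by
      rw [← h1]
      push_cast
      gcongr
    nlinarith
  · ring
  · ring
  · ring

lemma abs_high_moebius_mul_zeta_le (U : ℝ) (n : ℕ) :
    |((realMoebius - lowPart U realMoebius) * realZeta) n| ≤ tau n := by
  rw [ArithmeticFunction.mul_apply]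
  refine (abs_sum_le_sum_abs _ _).trans ?_
  have h1 : ∀ p ∈ n.divisorsAntidiagonal,
      |(realMoebius - lowPart U realMoebius) p.1 * realZeta p.2| ≤ 1 := by
    intro p hp
    have hp2 : p.2 ≠ 0 := (Nat.ne_zero_of_mem_divisorsAntidiagonal hp).2
    rw [realZeta_apply hp2, mul_one, highPart_apply]
    split_ifs
    · simp
    · exact abs_realMoebius_le_one _
  refine (sum_le_sum h1).trans (le_of_eq ?_)
  rw [sum_const, nsmul_eq_mul, mul_one, ← Nat.map_div_right_divisors, card_map, tau]

lemma high_moebius_mul_zeta_eq_zero {U : ℝ} {n : ℕ} (hnU : (n : ℝ) ≤ U) :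
    ((realMoebius - lowPart U realMoebius) * realZeta) n = 0 := by
  rw [ArithmeticFunction.mul_apply]
  refine sum_eq_zero fun p hp => ?_
  have h1 : p.1 ≤ n := Nat.divisor_le (Nat.fst_mem_divisors_of_mem_antidiagonal hp)
  have h2 : (p.1 : ℝ) ≤ U := le_trans (by exact_mod_cast h1) hnU
  rw [highPart_apply, if_pos h2, zero_mul]

/-- The sum of a Dirichlet convolution over a progression is a bilinear sum. -/
lemma sum_mul_apply_eq_bilinearSum {A : ℕ} (hA : 1 ≤ A) (B : ℕ) (α : ℝ) (b : ℤ) (d : ℕ)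
    (f g : ArithmeticFunction ℝ) :
    ∑ n ∈ (Ico A B).filter (fun n : ℕ => (n : ℤ) ≡ b [ZMOD (d : ℤ)]),
      (((f * g) n : ℝ) : ℂ) * e (α * n) =
    bilinearSum A B α b d (Ico 1 B) (Ico 1 B) (fun m => (f m : ℂ)) fun k => (g k : ℂ) := by
  have h1 : ∀ n ∈ Ico A B, (if (n : ℤ) ≡ b [ZMOD (d : ℤ)] then
      (((f * g) n : ℝ) : ℂ) * e (α * n) else 0) =
      ∑ p ∈ n.divisorsAntidiagonal, if ((p.1 * p.2 : ℕ) : ℤ) ≡ b [ZMOD (d : ℤ)] then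
        (f p.1 : ℂ) * (g p.2 : ℂ) * e (α * ((p.1 * p.2 : ℕ) : ℝ)) else 0 := by
    intro n _
    rw [sum_congr rfl (g := fun p : ℕ × ℕ => if (n : ℤ) ≡ b [ZMOD (d : ℤ)] then
      (f p.1 : ℂ) * (g p.2 : ℂ) * e (α * n) else 0) fun p hp => by
        rw [(Nat.mem_divisorsAntidiagonal.1 hp).1]]
    split_ifs
    · rw [ArithmeticFunction.mul_apply, ← sum_mul]
      push_cast
      rfl
    · rw [sum_const_zero]
  rw [sum_filter, sum_congr rfl h1, sum_divisorsAntidiagonal_Ico hA B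
    (fun m k => if ((m * k : ℕ) : ℤ) ≡ b [ZMOD (d : ℤ)] then
      (f m : ℂ) * (g k : ℂ) * e (α * ((m * k : ℕ) : ℝ)) else 0)]
  unfold bilinearSum
  refine sum_congr rfl fun m _ => sum_congr rfl fun k _ => ?_
  simp only [ite_and]

lemma bilinearSum_filter_left (A B : ℕ) (α : ℝ) (b : ℤ) (d : ℕ) (I J : Finset ℕ) (f g : ℕ → ℂ)
    (P : ℕ → Prop) [DecidablePred P] (hP : ∀ m ∈ I, ¬P m → f m = 0) :
    bilinearSum A B α b d (I.filter P) J f g = bilinearSum A B α b d I J f g := by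
  unfold bilinearSum
  rw [sum_filter]
  refine sum_congr rfl fun m hm => ?_
  split_ifs with h
  · rfl
  · simp [hP m hm h]

lemma bilinearSum_congr_right (A B : ℕ) (α : ℝ) (b : ℤ) (d : ℕ) (I J : Finset ℕ)
    (f : ℕ → ℂ) {g g' : ℕ → ℂ} (h : ∀ k ∈ J, g k = g' k) :
    bilinearSum A B α b d I J f g = bilinearSum A B α b d I J f g' := by
  unfold bilinearSum
  refine sum_congr rfl fun m _ => sum_congr rfl fun k hk => ?_
  rw [h k hk]

namespace IsMinor

variable {α N R L : ℝ} {q : ℕ}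

lemma log_le_two_mul (h : IsMinor α N R L q) {m : ℕ} (hm1 : 1 ≤ m) (hm : (m : ℝ) ≤ 8 * N) :
    Real.log m ≤ 2 * L * tau m := by
  have hm0 : (1 : ℝ) ≤ m := by exact_mod_cast hm1
  have hN := h.one_le_N
  have h1 := h.one_add_log_le (x := m) (by linarith) (by linarith)
  have h2 := one_le_tau hm1
  nlinarith [h.le_L]

/-- The exponential sum over primes, on average over moduli that factor suitably. -/
lemma sum_norm_primeExpSum_le (h : IsMinor α N R L q) {b : ℤ} {ρ U : ℝ} (hρ : 2 * R ^ 20 ≤ ρ)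
    (hU1 : 1 < U) (hUN : U ^ 3 = N) (S : Finset ℕ) (hS : ∀ d ∈ S, 1 ≤ d ∧ Int.gcd (d : ℤ) b = 1)
    (hSU : ∀ d ∈ S, d * U * R ^ 20 ≤ N)
    (hSF : ∀ d ∈ S, ∀ M : ℕ, N ≤ 4 * (M : ℝ) ^ 2 → (M * U : ℝ) ≤ 2 * N → FactorsAt N ρ M d) :
    ∑ d ∈ S, ‖primeExpSum N α b d‖ ≤ N * (L ^ 21 / Real.sqrt R) := by
  have hL := h.le_L
  have hN := h.one_le_N
  have hR := h.one_le_R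
  set A := ⌈N⌉₊ with hAdef
  set B := ⌈2 * N⌉₊ with hBdef
  have hA : N ≤ A := Nat.le_ceil N
  have hA1 : 1 ≤ A := Nat.one_le_iff_ne_zero.2 (Nat.ceil_pos.2 (by linarith)).ne'
  have hB : ∀ n : ℕ, n < B → (n : ℝ) < 2 * N := fun n hn => Nat.lt_ceil.1 hn
  have hB' : (B : ℝ) < 2 * N + 1 := Nat.ceil_lt_add_one (by linarith)
  have hAB : (B : ℝ) - A ≤ 2 * N := by linarith
  have hB1 : 1 ≤ B := Nat.one_le_iff_ne_zero.2 (Nat.ceil_pos.2 (by linarith)).ne'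
  have hUN' : U < N := by
    rw [← hUN]
    nlinarith [mul_pos (sub_pos.2 hU1) (sub_pos.2 hU1)]
  have hU2N : U ^ 2 < N := by
    rw [← hUN]
    nlinarith [mul_pos (sub_pos.2 hU1) (sub_pos.2 hU1)]
  set T := N / R ^ 20 with hTdef
  have hT : T * R ^ 20 ≤ N := by
    rw [hTdef, div_mul_cancel₀]
    positivity
  have hlogB : Real.log B ≤ 2 * L := by
    have hB0 : (1 : ℝ) ≤ B := by exact_mod_cast hB1
    have := h.one_add_log_le (x := B) (by linarith) (by linarith)
    linarith
  have hsqrt : 0 < Real.sqrt R := Real.sqrt_pos.2 (by linarith)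
  have hsqrt' : Real.sqrt R ≤ R := by
    rw [Real.sqrt_le_left (by linarith)]
    nlinarith
  set I := (Ico 1 B).filter fun m : ℕ => (m : ℝ) ≤ U with hI
  have hI1 : ∀ m ∈ I, 1 ≤ m := fun m hm => (mem_Ico.1 (mem_filter.1 hm).1).1
  have hSI : ∀ d ∈ S, ∀ m ∈ I, (d * m : ℝ) ≤ T := fun d hd m hm => by
    rw [hTdef, le_div_iff₀ (by positivity)]
    refine le_trans ?_ (hSU d hd)
    gcongr
    exact (mem_filter.1 hm).2
  -- the two sums of Type I
  set P₁ : ℕ → ℂ := fun d => bilinearSum A B α b d (Ico 1 B) (Ico 1 B)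
    (fun m => (lowPart U realMoebius m : ℂ)) fun k => (ArithmeticFunction.log k : ℂ) with hP₁
  set P₂ : ℕ → ℂ := fun d => bilinearSum A B α b d (Ico 1 B) (Ico 1 B)
    (fun m => (lowPart U (vaughanCoeff U) m : ℂ)) fun k => (realZeta k : ℂ) with hP₂
  -- the two sums of Type II
  set P₃ : ℕ → ℂ := fun d => bilinearSum A B α b d (Ico 1 B) (Ico 1 B)
    (fun m => ((vaughanCoeff U - lowPart U (vaughanCoeff U)) m : ℂ)) fun k => (realZeta k : ℂ)
    with hP₃
  set P₄ : ℕ → ℂ := fun d => bilinearSum A B α b d (Ico 1 B) (Ico 1 B)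
    (fun m => (((realMoebius - lowPart U realMoebius) * realZeta) m : ℂ)) fun k =>
    ((ArithmeticFunction.vonMangoldt - lowPart U ArithmeticFunction.vonMangoldt) k : ℂ) with hP₄
  have hdecomp : ∀ d, primeExpSum N α b d = P₁ d - P₂ d - P₃ d + P₄ d := by
    intro d
    simp only [hP₁, hP₂, hP₃, hP₄]
    rw [← sum_mul_apply_eq_bilinearSum hA1, ← sum_mul_apply_eq_bilinearSum hA1,
      ← sum_mul_apply_eq_bilinearSum hA1, ← sum_mul_apply_eq_bilinearSum hA1,
      ← sum_sub_distrib, ← sum_sub_distrib, ← sum_add_distrib]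
    refine sum_congr rfl fun n hn => ?_
    have hnA : A ≤ n := (mem_Ico.1 (mem_filter.1 hn).1).1
    have hnU : ¬(n : ℝ) ≤ U := by
      have : (A : ℝ) ≤ n := by exact_mod_cast hnA
      linarith
    have h1 := congrArg (fun F : ArithmeticFunction ℝ => F n) (vaughan_identity U)
    simp only [ArithmeticFunction.add_apply, sub_eq_add_neg, ArithmeticFunction.neg_apply] at h1
    rw [lowPart_apply, if_neg hnU, zero_add] at h1
    rw [h1]
    simp only [sub_eq_add_neg]
    push_cast
    ring
  have b₁ : ∑ d ∈ S, ‖P₁ d‖ ≤ 1 * (2 * L) * (N * (L ^ 15 / R)) := by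
    have e1 := h.sum_norm_typeI_le hT (A := A) (B := B) hAB S I hS hI1 hSI
      (fun m => (lowPart U realMoebius m : ℂ)) (F := 1) (fun m _ => by
        rw [Complex.norm_real]
        exact abs_lowPart_realMoebius_le_one U m) zero_le_one (fun k => Real.log k)
      (fun k k' hkk => by
        rcases Nat.eq_zero_or_pos k with rfl | hk
        · simpa using Real.log_natCast_nonneg k'
        · exact Real.log_le_log (by exact_mod_cast hk) (by exact_mod_cast hkk)) (by simp)
    refine le_trans (le_of_eq (sum_congr rfl fun d _ => ?_)) (e1.trans (by gcongr))
    rw [hP₁, hI, bilinearSum_filter_left]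
    · rfl
    · intro m _ hm
      rw [lowPart_apply, if_neg hm, Complex.ofReal_zero]
  have b₂ : ∑ d ∈ S, ‖P₂ d‖ ≤ (2 * L) * 1 * (N * (L ^ 15 / R)) := by
    have e1 := h.sum_norm_typeI_le hT (A := A) (B := B) hAB S I hS hI1 hSI
      (fun m => (lowPart U (vaughanCoeff U) m : ℂ)) (F := 2 * L) (fun m hm => by
        obtain ⟨hm1, hmU⟩ := mem_filter.1 hm
        obtain ⟨hm1, hmB⟩ := mem_Ico.1 hm1
        have hm0 : (1 : ℝ) ≤ m := by exact_mod_cast hm1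
        rw [Complex.norm_real, lowPart_apply, if_pos hmU]
        refine (abs_vaughanCoeff_le U m).trans (le_trans ?_ hlogB)
        exact Real.log_le_log (by linarith) (by exact_mod_cast hmB.le)) (by linarith)
      (fun _ => 1) monotone_const zero_le_one
    refine le_trans (le_of_eq (sum_congr rfl fun d _ => ?_)) e1
    rw [hP₂, hI, bilinearSum_filter_left]
    · simp only
      rw [bilinearSum_congr_right]
      intro k hk
      rw [realZeta_apply (Nat.one_le_iff_ne_zero.1 (mem_Ico.1 hk).1)]
    · intro m _ hm
      rw [lowPart_apply, if_neg hm, Complex.ofReal_zero]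
  have hone : ∀ m : ℕ, 1 ≤ m → (1 : ℝ) ≤ 2 * L * tau m := fun m hm => by
    nlinarith [one_le_tau hm]
  have b₃ : ∑ d ∈ S, ‖P₃ d‖ ≤ N * (L ^ 20 / Real.sqrt R) := by
    refine h.sum_norm_bilinearSum_le hρ (by linarith) hA hB S hS hSF _ _ ?_ ?_ ?_
    · intro m hm hm8
      rw [Complex.norm_real, highPart_apply]
      split_ifs
      · rw [norm_zero]
        exact zero_le_one.trans (hone m hm)
      · exact (abs_vaughanCoeff_le U m).trans (h.log_le_two_mul hm hm8)
    · intro m hm _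
      rw [realZeta_apply (by lia), Complex.ofReal_one, norm_one]
      exact hone m hm
    · intro m k hmk _ hne
      have hm := left_ne_zero_of_mul hne
      rw [highPart_apply] at hm
      split_ifs at hm with hmU
      · simp at hm
      · rw [not_le] at hmU
        refine ⟨hmU.le, ?_⟩
        -- the coefficient is supported on `m ≤ U²`, so `k ≥ N/U² = U`
        have hm2 : (m : ℝ) ≤ U ^ 2 := by
          by_contra hlt
          rw [vaughanCoeff_eq_zero (by linarith) (not_le.1 hlt)] at hm
          simp at hm
        have e1 : N ≤ m * k := hA.trans (by exact_mod_cast hmk)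
        have e2 : U ^ 2 * U ≤ U ^ 2 * k := by
          calc U ^ 2 * U = N := by rw [← hUN]; ring
            _ ≤ m * k := e1
            _ ≤ _ := by gcongr
        exact le_of_mul_le_mul_left e2 (by positivity)
  have b₄ : ∑ d ∈ S, ‖P₄ d‖ ≤ N * (L ^ 20 / Real.sqrt R) := by
    refine h.sum_norm_bilinearSum_le hρ (by linarith) hA hB S hS hSF _ _ ?_ ?_ ?_
    · intro m hm _
      rw [Complex.norm_real]
      refine (abs_high_moebius_mul_zeta_le U m).trans ?_
      nlinarith [one_le_tau hm]
    · intro m hm hm8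
      rw [Complex.norm_real, highPart_apply]
      split_ifs
      · rw [norm_zero]
        exact zero_le_one.trans (hone m hm)
      · rw [Real.norm_of_nonneg ArithmeticFunction.vonMangoldt_nonneg]
        exact ArithmeticFunction.vonMangoldt_le_log.trans (h.log_le_two_mul hm hm8)
    · intro m k _ _ hne
      have hm := left_ne_zero_of_mul hne
      have hk := right_ne_zero_of_mul hne
      constructor
      · by_contra hlt
        rw [high_moebius_mul_zeta_eq_zero (not_le.1 hlt).le] at hm
        simp at hm
      · by_contra hlt
        rw [highPart_apply, if_pos (not_le.1 hlt).le] at hk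
        simp at hk
  calc ∑ d ∈ S, ‖primeExpSum N α b d‖ ≤ ∑ d ∈ S, (‖P₁ d‖ + ‖P₂ d‖ + ‖P₃ d‖ + ‖P₄ d‖) := by
        refine sum_le_sum fun d _ => ?_
        rw [hdecomp]
        have n1 := norm_add_le (P₁ d - P₂ d - P₃ d) (P₄ d)
        have n2 := norm_sub_le (P₁ d - P₂ d) (P₃ d)
        have n3 := norm_sub_le (P₁ d) (P₂ d)
        linarith
    _ ≤ 4 * L * (N * (L ^ 15 / Real.sqrt R)) + 2 * (N * (L ^ 20 / Real.sqrt R)) := by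
        rw [sum_add_distrib, sum_add_distrib, sum_add_distrib]
        have e1 : N * (L ^ 15 / R) ≤ N * (L ^ 15 / Real.sqrt R) := by gcongr
        nlinarith
    _ = N * ((4 * L ^ 16 + 2 * L ^ 20) / Real.sqrt R) := by ring
    _ ≤ _ := by
        gcongr
        have e1 : L ^ 16 ≤ L ^ 20 := pow_le_pow_right₀ (by linarith) (by norm_num)
        have e2 : 0 ≤ L ^ 20 := by positivity
        rw [pow_succ L 20]
        nlinarith

end IsMinor

/-! ### Factoring the elements of the sieve supports -/

/-- The greedy factorisation. Take for `d₁` a maximal divisor of `d` that is a multiple of `p` and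
at most `N/(ρM)`. Unless `d₁ = d`, adjoining a further prime exceeds this bound; as all primes
of `d/p` are at most `y`, this makes `d₁` large and hence `d₂ = d/d₁` small. -/
lemma factorsAt_of_prime_le {N ρ U y : ℝ} {d p M : ℕ} (hN : 0 < N) (hρ : 2 ≤ ρ) (hd : 1 ≤ d)
    (hpd : p ∣ d) (hp : p * ρ ^ 2 ≤ U) (hdρ : 4 * (d * ρ) ^ 2 ≤ N)
    (hy : ∀ s : ℕ, s.Prime → s ∣ d / p → (s : ℝ) ≤ y) (hdy : d ^ 2 * y * ρ ^ 2 ≤ N)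
    (hM : N ≤ 4 * (M : ℝ) ^ 2) (hMU : M * U ≤ 2 * N) : FactorsAt N ρ M d := by
  have hρ0 : 0 < ρ := by linarith
  have hdM : d * ρ ≤ M := by
    refine le_of_sq_le_sq ?_ (Nat.cast_nonneg M)
    linarith
  have hpM : p * M * ρ ≤ N := by
    have h1 : (p * M * ρ) * ρ ≤ N * ρ := by
      calc (p * M * ρ) * ρ = M * (p * ρ ^ 2) := by ring
        _ ≤ M * U := by gcongr
        _ ≤ 2 * N := hMU
        _ ≤ N * ρ := by nlinarith
    exact le_of_mul_le_mul_right h1 hρ0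
  obtain ⟨m, hm, hmax⟩ := exists_max_image
    (d.divisors.filter fun m => p ∣ m ∧ (m * M * ρ : ℝ) ≤ N) id
    ⟨p, mem_filter.2 ⟨Nat.mem_divisors.2 ⟨hpd, by lia⟩, dvd_rfl, hpM⟩⟩
  obtain ⟨hmd, hpm, hmN⟩ := mem_filter.1 hm
  have hmd' : m ∣ d := Nat.dvd_of_mem_divisors hmd
  have hm0 : 0 < m := Nat.pos_of_dvd_of_pos hmd' hd
  refine ⟨m, d / m, (Nat.mul_div_cancel' hmd').symm, ?_, ?_⟩
  · rwa [le_div_iff₀ hρ0]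
  rw [le_div_iff₀ hρ0]
  rcases Nat.eq_or_lt_of_le (Nat.le_of_dvd hd hmd') with rfl | hlt
  · rw [Nat.div_self hm0]
    simpa using hdM
  · have hne : d / m ≠ 1 := fun h1 => by
      have := Nat.mul_div_cancel' hmd'
      rw [h1] at this
      lia
    obtain ⟨s, hs, hsd⟩ := Nat.exists_prime_and_dvd hne
    have hsm : m * s ∣ d := by
      have := Nat.mul_dvd_mul_left m hsd
      rwa [Nat.mul_div_cancel' hmd'] at this
    have hsp : s ∣ d / p := hsd.trans (Nat.div_dvd_div_left hmd' hpm)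
    have hsy := hy s hs hsp
    have hs0 : (0 : ℝ) < s := by exact_mod_cast hs.pos
    have hbig : N < m * s * M * ρ := by
      by_contra hle
      have h2 := hmax (m * s) (mem_filter.2 ⟨Nat.mem_divisors.2 ⟨hsm, by lia⟩,
        hpm.mul_right s, by push_cast; exact not_lt.1 hle⟩)
      have h3 := hs.two_le
      simp only [id] at h2
      nlinarith
    have hdm : (d : ℝ) = m * (d / m : ℕ) := by
      exact_mod_cast (Nat.mul_div_cancel' hmd').symm
    have hm0' : (0 : ℝ) < m := by exact_mod_cast hm0
    set t : ℝ := ((d / m : ℕ) : ℝ) with ht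
    have h4 : (y * ρ * m) * (m * t ^ 2 * ρ) ≤ (y * ρ * m) * M := by
      calc (y * ρ * m) * (m * t ^ 2 * ρ) = d ^ 2 * y * ρ ^ 2 := by
            rw [hdm]
            ring
        _ ≤ N := hdy
        _ ≤ m * s * M * ρ := hbig.le
        _ ≤ m * y * M * ρ := by gcongr
        _ = _ := by ring
    have hy0 : 0 < y := hs0.trans_le hsy
    exact le_of_mul_le_mul_left h4 (by positivity)

lemma IsDecreasingFactorization.exists_eq_of_prime_dvd {z : ℝ} {d r : ℕ} {p : ℕ → ℕ}
    (h : IsDecreasingFactorization z d r p) {I : Finset ℕ} (hI : I ⊆ Icc 1 r) {s : ℕ}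
    (hs : s.Prime) (hsd : s ∣ ∏ i ∈ I, p i) : ∃ i ∈ I, s = p i := by
  obtain ⟨i, hi, hsi⟩ := hs.prime.exists_mem_finset_dvd hsd
  obtain ⟨h1, h2⟩ := mem_Icc.1 (hI hi)
  exact ⟨i, hi, (Nat.prime_dvd_prime_iff_eq hs (h.2.1 i h1 h2).1).1 hsi⟩

lemma IsDecreasingFactorization.antitone {z : ℝ} {d r : ℕ} {p : ℕ → ℕ}
    (h : IsDecreasingFactorization z d r p) {i j : ℕ} (hi : 1 ≤ i) (hij : i ≤ j) (hj : j ≤ r) :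
    p j ≤ p i := by
  rcases Nat.eq_or_lt_of_le hij with rfl | hlt
  · exact le_rfl
  · exact (h.2.2 i j hi hlt hj).le

/-- For the upper bound weights the condition at `k = 1` bounds all prime factors by `D^{1/2}`. -/
lemma sq_le_of_prime_dvd_of_mem_upperSupport {D z : ℝ} {d : ℕ} (hd : d ∈ upperSupport D z) {s : ℕ}
    (hs : s.Prime) (hsd : s ∣ d) : (s : ℝ) ^ 2 ≤ D := by
  obtain ⟨_, r, p, hfac, hp⟩ := hd
  rw [hfac.1] at hsd
  obtain ⟨i, hi, rfl⟩ := hfac.exists_eq_of_prime_dvd Subset.rfl hs hsd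
  obtain ⟨h1, h2⟩ := mem_Icc.1 hi
  have h3 := hp 1 le_rfl (by lia)
  have h4 : (p i : ℝ) ≤ p 1 := by exact_mod_cast hfac.antitone le_rfl h1 h2
  norm_num at h3
  exact (pow_le_pow_left₀ (Nat.cast_nonneg _) h4 2).trans h3

/-- For the lower bound weights the largest prime is only bounded by `z`, but `p₂³ ≤ p₁ p₂² ≤ D`
bounds the other ones by `D^{1/3}`. -/
lemma exists_dvd_of_mem_lowerSupport {D z : ℝ} {d : ℕ} (hd : d ∈ lowerSupport D z) :
    ∃ p, p ∣ d ∧ (p = 1 ∨ (p : ℝ) ≤ z) ∧ ∀ s : ℕ, s.Prime → s ∣ d / p → (s : ℝ) ^ 3 ≤ D := by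
  obtain ⟨_, r, p, hfac, hp⟩ := hd
  rcases Nat.eq_zero_or_pos r with rfl | hr
  · have h1 : d = 1 := by simpa using hfac.1
    refine ⟨1, one_dvd _, Or.inl rfl, fun s hs hsd => ?_⟩
    rw [h1] at hsd
    exact absurd (Nat.dvd_one.1 hsd) hs.ne_one
  · have h1 : d = p 1 * ∏ i ∈ Ioc 1 r, p i := by
      rw [hfac.1, mul_prod_Ioc_eq_prod_Icc hr]
    have hp1 := hfac.2.1 1 le_rfl hr
    refine ⟨p 1, ⟨_, h1⟩, Or.inr hp1.2, fun s hs hsd => ?_⟩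
    rw [h1, Nat.mul_div_cancel_left _ hp1.1.pos] at hsd
    obtain ⟨i, hi, rfl⟩ := hfac.exists_eq_of_prime_dvd Ioc_subset_Icc_self hs hsd
    obtain ⟨h2, h3⟩ := mem_Ioc.1 hi
    have h4 := hp 1 le_rfl (by lia)
    have h5 : (p i : ℝ) ≤ p 2 := by exact_mod_cast hfac.antitone (by norm_num) h2 h3
    have h6 : (p 2 : ℝ) ≤ p 1 := by exact_mod_cast hfac.antitone le_rfl (by norm_num) (by lia)
    norm_num at h4
    calc (p i : ℝ) ^ 3 ≤ (p 2 : ℝ) ^ 3 := by gcongr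
      _ = p 2 * (p 2 : ℝ) ^ 2 := by ring
      _ ≤ p 1 * (p 2 : ℝ) ^ 2 := by gcongr
      _ ≤ D := h4

/-! ### The sieve weights -/

/-- The largeness conditions on `N`; `η` is the small exponent spent on powers of logarithms. -/
structure IsLarge (C η N : ℝ) : Prop where
  one_lt : 1 < N
  le_log : 2000 ≤ Real.log N
  log_rpow_le : 2 * Real.log N ^ (600 * C) ≤ N ^ (η / 2)

lemma exists_forall_isLarge (C : ℝ) {η : ℝ} (hη : 0 < η) :
    ∃ N₀ : ℝ, ∀ N, N₀ ≤ N → IsLarge C η N := by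
  have h1 := (isLittleO_log_rpow_rpow_atTop (600 * C) (half_pos hη)).bound
    (show (0 : ℝ) < 1 / 2 by norm_num)
  have h2 := Real.tendsto_log_atTop.eventually_ge_atTop 2000
  obtain ⟨N₀, h⟩ := Filter.eventually_atTop.1 ((h1.and h2).and (Filter.eventually_gt_atTop 1))
  refine ⟨N₀, fun N hN => ?_⟩
  obtain ⟨⟨h3, h4⟩, h5⟩ := h N hN
  refine ⟨h5, h4, ?_⟩
  rw [Real.norm_of_nonneg (Real.rpow_nonneg (by linarith) _),
    Real.norm_of_nonneg (Real.rpow_nonneg (by linarith) _)] at h3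
  linarith

/-- The weights enter only through the size and the support `X`: it suffices that each `d ∈ X` has
all its prime factors bounded by `N^β`, apart from a divisor `p` a little below `N^{1/3}`. -/
lemma weightedSum_indicator_moebius_le {C η N κ β α : ℝ} {X : Set ℕ} (hC : 10 ≤ C) (hη : 0 < η)
    (hη' : η ≤ 1 / 7) (hN : IsLarge C η N) (hκ : κ ≤ 3 / 7 - η / 2) (hκβ : 2 * κ + β + η ≤ 1)
    (hX : ∀ d ∈ X, ∃ p, p ∣ d ∧ p * N ^ η ≤ N ^ (1 / 3 : ℝ) ∧
      ∀ s : ℕ, s.Prime → s ∣ d / p → (s : ℝ) ≤ N ^ β)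
    {a q : ℤ} (haq : IsCoprime a q) (hq : Real.log N ^ (1000 * C) ≤ q)
    (hqN : q ≤ N * Real.log N ^ (-(1000 * C))) (hα : |α - a / q| ≤ 1 / (q : ℝ) ^ 2) (b : ℤ) :
    weightedSum (X.indicator fun d => (ArithmeticFunction.moebius d : ℝ)) (N ^ κ) N α b
      ≤ N / Real.log N ^ C := by
  classical
  obtain ⟨hN1, hlog, hlogN⟩ := hN
  have hN0 : 0 < N := by linarith
  set L := Real.log N with hL
  have hL0 : 0 < L := by linarith
  have hL1 : 1 ≤ L := by linarith
  have hq0 : (0 : ℝ) < q := (Real.rpow_pos_of_pos hL0 _).trans_le hq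
  lift q to ℕ using by exact_mod_cast hq0.le
  push_cast at hq hqN hα hq0
  have hRpow : ∀ n : ℕ, (L ^ (30 * C)) ^ n = L ^ (30 * C * n) := fun n => by
    rw [Real.rpow_mul hL0.le (30 * C), Real.rpow_natCast]
  have hR32 : (L ^ (30 * C)) ^ 32 ≤ L ^ (1000 * C) := by
    rw [hRpow]
    refine Real.rpow_le_rpow_of_exponent_le hL1 ?_
    push_cast
    linarith
  have hR20 : 2 * (L ^ (30 * C)) ^ 20 ≤ N ^ (η / 2) := by
    rw [hRpow]
    convert hlogN using 3
    push_cast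
    ring
  have hR1 : 1 ≤ L ^ (30 * C) := Real.one_le_rpow hL1 (by linarith)
  have hminor : IsMinor α N (L ^ (30 * C)) L q := by
    refine ⟨⟨by exact_mod_cast hq0, a, haq, hα⟩, hlog, le_rfl, hR1, hR32.trans hq, ?_⟩
    calc q * (L ^ (30 * C)) ^ 32 ≤ N * L ^ (-(1000 * C)) * L ^ (1000 * C) := by gcongr
      _ = N := by
        rw [mul_assoc, ← Real.rpow_add hL0, neg_add_cancel, Real.rpow_zero, mul_one]
  set ρ := N ^ (η / 2) with hρ
  have hρ2 : ρ ^ 2 = N ^ η := by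
    rw [hρ, ← Real.rpow_natCast, ← Real.rpow_mul hN0.le]
    congr 1
    push_cast
    ring
  have hR20' : 1 ≤ (L ^ (30 * C)) ^ 20 := one_le_pow₀ hR1
  have hρ2' : 2 ≤ ρ := by linarith
  have hU3 : (N ^ (1 / 3 : ℝ)) ^ 3 = N := by
    rw [← Real.rpow_natCast, ← Real.rpow_mul hN0.le]
    norm_num
  set S := ((Icc 1 ⌊N ^ κ⌋₊).filter fun d : ℕ => Int.gcd (d : ℤ) b = 1).filter fun d => d ∈ X
    with hS
  have hmem : ∀ d ∈ S, 1 ≤ d ∧ (d : ℝ) ≤ N ^ κ ∧ Int.gcd (d : ℤ) b = 1 ∧ d ∈ X := fun d hd => by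
    simp only [hS, mem_filter, mem_Icc] at hd
    exact ⟨hd.1.1.1, (Nat.le_floor_iff (by positivity)).1 hd.1.1.2, hd.1.2, hd.2⟩
  have hdρ : ∀ d ∈ S, d * ρ ≤ N ^ (3 / 7 : ℝ) := fun d hd => by
    calc d * ρ ≤ N ^ κ * ρ := by
          gcongr
          exact (hmem d hd).2.1
      _ = N ^ (κ + η / 2) := by rw [Real.rpow_add hN0]
      _ ≤ _ := Real.rpow_le_rpow_of_exponent_le hN1.le (by linarith)
  have hmain := hminor.sum_norm_primeExpSum_le (b := b) hR20
    (Real.one_lt_rpow hN1 (by norm_num : (0 : ℝ) < 1 / 3)) hU3 S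
    (fun d hd => ⟨(hmem d hd).1, (hmem d hd).2.2.1⟩) (fun d hd => ?_) (fun d hd M hM hMU => ?_)
  · calc weightedSum (X.indicator fun d => (ArithmeticFunction.moebius d : ℝ)) (N ^ κ) N α b
        ≤ ∑ d ∈ S, ‖primeExpSum N α b d‖ := by
          unfold weightedSum
          rw [hS, sum_filter (fun d => d ∈ X)]
          refine sum_le_sum fun d _ => ?_
          by_cases hd : d ∈ X
          · rw [if_pos hd, Set.indicator_of_mem hd, norm_mul, Complex.norm_real, Real.norm_eq_abs]
            refine mul_le_of_le_one_left (norm_nonneg _) ?_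
            exact_mod_cast ArithmeticFunction.abs_moebius_le_one
          · simp [hd]
      _ ≤ N * (L ^ 21 / Real.sqrt (L ^ (30 * C))) := hmain
      _ = N * L ^ (21 - 15 * C) := by
          rw [Real.sqrt_eq_rpow, ← Real.rpow_mul hL0.le, ← Real.rpow_natCast, ← Real.rpow_sub hL0]
          congr 2
          push_cast
          ring
      _ ≤ N * L ^ (-C) := by
          gcongr
          linarith
      _ = N / L ^ C := by rw [Real.rpow_neg hL0.le, div_eq_mul_inv]
  · calc d * N ^ (1 / 3 : ℝ) * (L ^ (30 * C)) ^ 20 ≤ d * N ^ (1 / 3 : ℝ) * ρ := by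
          gcongr
          linarith
      _ = d * ρ * N ^ (1 / 3 : ℝ) := by ring
      _ ≤ N ^ (3 / 7 : ℝ) * N ^ (1 / 3 : ℝ) := by
          gcongr
          exact hdρ d hd
      _ = N ^ (3 / 7 + 1 / 3 : ℝ) := by rw [Real.rpow_add hN0]
      _ ≤ N ^ (1 : ℝ) := Real.rpow_le_rpow_of_exponent_le hN1.le (by norm_num)
      _ = N := Real.rpow_one N
  · obtain ⟨hd1, hdκ, _, hdX⟩ := hmem d hd
    obtain ⟨p, hpd, hp, hs⟩ := hX d hdX
    refine factorsAt_of_prime_le hN0 hρ2' hd1 hpd (by rwa [hρ2]) ?_ hs ?_ hM hMU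
    · calc 4 * (d * ρ) ^ 2 ≤ ρ ^ 2 * (N ^ (3 / 7 : ℝ)) ^ 2 := by
            gcongr
            · nlinarith
            · exact hdρ d hd
        _ = N ^ (η + 3 / 7 * 2) := by
            rw [hρ2, Real.rpow_add hN0, Real.rpow_mul hN0.le, Real.rpow_two]
        _ ≤ N ^ (1 : ℝ) := Real.rpow_le_rpow_of_exponent_le hN1.le (by linarith)
        _ = N := Real.rpow_one N
    · calc d ^ 2 * N ^ β * ρ ^ 2 ≤ (N ^ κ) ^ 2 * N ^ β * ρ ^ 2 := by gcongr
        _ = N ^ (κ * 2 + β + η) := by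
            rw [hρ2, Real.rpow_add hN0, Real.rpow_add hN0, Real.rpow_mul hN0.le, Real.rpow_two]
        _ ≤ N ^ (1 : ℝ) := Real.rpow_le_rpow_of_exponent_le hN1.le (by linarith)
        _ = N := Real.rpow_one N

lemma le_rpow_div_of_pow_le {N κ x : ℝ} {n : ℕ} (hN : 0 < N) (hn : n ≠ 0)
    (h : x ^ n ≤ N ^ κ) : x ≤ N ^ (κ / n) := by
  refine le_of_pow_le_pow_left₀ hn (by positivity) (h.trans_eq ?_)
  rw [← Real.rpow_natCast, ← Real.rpow_mul hN.le, div_mul_cancel₀ _ (by exact_mod_cast hn)]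

end SemilinearSieve

theorem theorem5 (ε C : ℝ) (hε : 0 < ε) (hC : 10 ≤ C) :
    (∃ K N₀ : ℝ, ∀ N : ℝ, N₀ ≤ N → ∀ z : ℝ, z ≤ N ^ (1 / 2 : ℝ) →
      ∀ (α : ℝ) (a q : ℤ), IsCoprime a q →
        Real.log N ^ (1000 * C) ≤ (q : ℝ) → (q : ℝ) ≤ N * Real.log N ^ (-(1000 * C)) →
        |α - (a : ℝ) / (q : ℝ)| ≤ 1 / (q : ℝ) ^ 2 →
      ∀ b : ℤ, b ≠ 0 →
        SemilinearSieve.weightedSum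
            (SemilinearSieve.upperWeight (N ^ (2 / 5 - ε : ℝ)) z) (N ^ (2 / 5 - ε : ℝ)) N α b
          ≤ K * (N / Real.log N ^ C)) ∧
    (∃ K N₀ : ℝ, ∀ N : ℝ, N₀ ≤ N → ∀ z : ℝ, z ≤ N ^ (1 / 3 - ε : ℝ) →
      ∀ (α : ℝ) (a q : ℤ), IsCoprime a q →
        Real.log N ^ (1000 * C) ≤ (q : ℝ) → (q : ℝ) ≤ N * Real.log N ^ (-(1000 * C)) →
        |α - (a : ℝ) / (q : ℝ)| ≤ 1 / (q : ℝ) ^ 2 →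
      ∀ b : ℤ, b ≠ 0 →
        SemilinearSieve.weightedSum
            (SemilinearSieve.lowerWeight (N ^ (3 / 7 - ε : ℝ)) z) (N ^ (3 / 7 - ε : ℝ)) N α b
          ≤ K * (N / Real.log N ^ C)) := by
  obtain ⟨η, hη, hηε, hη'⟩ : ∃ η : ℝ, 0 < η ∧ η ≤ ε ∧ η ≤ 1 / 7 :=
    ⟨min ε (1 / 7), by positivity, min_le_left _ _, min_le_right _ _⟩
  obtain ⟨N₀, hN₀⟩ := SemilinearSieve.exists_forall_isLarge C hη
  refine ⟨⟨1, N₀, fun N hN z _ α a q haq hq hqN hα b _ => ?_⟩,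
    ⟨1, N₀, fun N hN z hz α a q haq hq hqN hα b _ => ?_⟩⟩
  · have hlarge := hN₀ N hN
    have hN0 : 0 < N := zero_lt_one.trans hlarge.one_lt
    rw [one_mul]
    -- All primes are at most `D^{1/2}`, and `2 (2/5 - ε) + (2/5 - ε) / 2 ≤ 1 - η`.
    refine SemilinearSieve.weightedSum_indicator_moebius_le (β := (2 / 5 - ε) / (2 : ℕ)) hC hη hη'
      hlarge (by linarith) (by push_cast; linarith)
      (fun d hd => ⟨1, one_dvd d, ?_, fun s hs hsd => ?_⟩) haq hq hqN hα b
    · rw [Nat.cast_one, one_mul]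
      exact Real.rpow_le_rpow_of_exponent_le hlarge.one_lt.le (by linarith)
    · rw [Nat.div_one] at hsd
      exact SemilinearSieve.le_rpow_div_of_pow_le hN0 two_ne_zero
        (SemilinearSieve.sq_le_of_prime_dvd_of_mem_upperSupport hd hs hsd)
  · have hlarge := hN₀ N hN
    have hN0 : 0 < N := zero_lt_one.trans hlarge.one_lt
    rw [one_mul]
    -- All primes but the largest are at most `D^{1/3}`, and `2 (3/7 - ε) + (3/7 - ε) / 3 ≤ 1 - η`.
    refine SemilinearSieve.weightedSum_indicator_moebius_le (β := (3 / 7 - ε) / (3 : ℕ)) hC hη hη'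
      hlarge (by linarith) (by push_cast; linarith) (fun d hd => ?_) haq hq hqN hα b
    obtain ⟨p, hpd, hp, hs⟩ := SemilinearSieve.exists_dvd_of_mem_lowerSupport hd
    refine ⟨p, hpd, ?_, fun s hs' hsd => SemilinearSieve.le_rpow_div_of_pow_le hN0
      three_ne_zero (hs s hs' hsd)⟩
    rcases hp with rfl | hpz
    · rw [Nat.cast_one, one_mul]
      exact Real.rpow_le_rpow_of_exponent_le hlarge.one_lt.le (by linarith)
    · calc p * N ^ η ≤ N ^ (1 / 3 - ε) * N ^ ε := by
            gcongr
            · exact hpz.trans hz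
            · exact hlarge.one_lt.le
        _ = N ^ (1 / 3 : ℝ) := by rw [← Real.rpow_add hN0, sub_add_cancel]
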